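/- All Lie algebras are over $\mathbb{C}$. The index of a finite-dimensional Lie algebra $\mathfrak{g}$ is $\operatorname{ind}\mathfrak{g}=\min_{\varphi\in\mathfrak{g}^*}\dim\ker B_\varphi$, where $B_\varphi(x,y)=\varphi([x,y])$. **Type-C seaweeds.** Let $n\ge 0$, and let $\underline{a}=(a_1,\dots,a_m)$ and $\underline{b}=(b_1,\dots,b_t)$ be (possibly empty) sequences of positive integers with $\sum a_i\le n$ and $\sum b_i\le n$. Realize $\mathfrak{sp}(2n)$ as the matrices $A\in M_{2n}(\mathbb{C})$ with $A^{T}J=-JA$, where $J$ has antidiagonal entries $1$ in its first $n$ rows and $-1$ in its last $n$ rows, and all other entries zero. Let $X_{\underline{a}}$ be the space of block-diagonal matrices with blocks of sizes $a_1,\dots,a_m,\,2(n-\sum a_i),\,a_m,\dots,a_1$, define $X_{\underline{b}}$ similarly, and let $\mathscr{L}$ and $\mathscr{U}$ be the spaces of lower and upper triangular matrices. The type-C seaweed $\mathfrak{g}=\mathfrak{p}^C_{2n}\frac{a_1|\dots|a_m}{b_1|\dots|b_t}$ is the Lie algebra $\mathfrak{sp}(2n)\cap\big((X_{\underline{a}}\cap\mathscr{L})+(X_{\underline{b}}\cap\mathscr{U})\big)$.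 **Homotopy type.** Starting from the triple $(n;\,a_1|\dots|a_m;\,b_1|\dots|b_t)$, apply the following moves until one of the two sequences is empty: * if $a_1<b_1$ (flip), exchange the two sequences; * if $a_1=b_1=c$ (component deletion $C(c)$), delete $a_1$ and $b_1$ and replace $n$ by $n-c$; * if $b_1<a_1<2b_1$ (rotation contraction), pass to $(n-a_1+b_1;\ b_1|a_2|\dots|a_m;\ (2b_1-a_1)|b_2|\dots|b_t)$; * if $a_1=2b_1$ (block elimination), pass to $(n-b_1;\ b_1|a_2|\dots|a_m;\ b_2|\dots|b_t)$; * if $a_1>2b_1$ (pure contraction), pass to $(n-b_1;\ (a_1-2b_1)|b_1|a_2|\dots|a_m;\ b_2|\dots|b_t)$. Let $c_1,\dots,c_p$ be the sizes of the component deletions performed, in order (the non-tail components). When the process stops at a triple with first entry $k$, let $d_1,\dots,d_q$ be the sequence that remains, empty if both are empty (the tail components), and let $e=2\big(k-\sum d_j\big)$ (the aftertail component, regarded as absent if $e=0$). The homotopy type of $\mathfrak{g}$ is $\mathcal{H}_C(c_1,\dots,c_p\,;\,d_1,\dots,d_q\,;\,e)$. **Statement.** The type-C seaweed $\mathfrak{g}$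 has index one if and only if its homotopy type is one of the following: * (1a) $\mathcal{H}_C(\,;\,1,\dots,1,2,1,\dots,1\,;\,0)$: there are no non-tail components and no aftertail component, exactly one tail component is $2$, and all others are $1$; * (1b) $\mathcal{H}_C(\,;\,1,\dots,1,3,1,\dots,1\,;\,0)$: the same with $3$ in place of $2$; * (2) $\mathcal{H}_C(\,;\,1,\dots,1\,;\,2)$: there are no non-tail components, all tail components are $1$, and the aftertail component is $2$; * (3) $\mathcal{H}_C(1\,;\,1,\dots,1\,;\,0)$: there is exactly one non-tail component, it is $1$, all tail components are $1$, and there is no aftertail component. In each case the strings of $1$'s among the tail components may be empty. -/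

import Mathlib

attribute [local instance 100] LieRing.ofAssociativeRing

section Index

variable (K : Type*) [Field K] (L : Type*) [LieRing L] [LieAlgebra K L]

/-- The Kirillov form `B_φ(x, y) = φ([x, y])` of a one-form `φ` on a Lie algebra. -/
def kirillovForm (φ : Module.Dual K L) : L →ₗ[K] L →ₗ[K] K :=
  LinearMap.mk₂ K (fun x y => φ ⁅x, y⁆)
    (fun x₁ x₂ y => by rw [add_lie, map_add])
    (fun c x y => by rw [smul_lie, map_smul])
    (fun x y₁ y₂ => by rw [lie_add, map_add])
    (fun c x y => by rw [lie_smul, map_smul])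

/-- The index of a finite-dimensional Lie algebra `L`: the minimum over all one-forms `φ` of the
dimension of the kernel of the Kirillov form `B_φ`. -/
noncomputable def lieIndex [Module.Finite K L] : ℕ :=
  sInf (Set.range fun φ : Module.Dual K L =>
    Module.finrank K (LinearMap.ker (kirillovForm K L φ)))

end Index

section Seaweed

/-- The palindromic composition `a₁ | … | a_m | 2(n - ∑ aᵢ) | a_m | … | a₁` of `2n` attached to a
partial composition `a` of `n` (the middle block is empty when `∑ aᵢ = n`). -/
def fullComposition (n : ℕ) (a : List ℕ) : List ℕ :=
  a ++ [2 * (n - a.sum)] ++ a.reverse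

/-- The number (from 0) of the block of the composition `c` that contains the position `i`, when
consecutive blocks of lengths `c₁, c₂, …` are laid out on `0, 1, 2, …`. -/
def blockIndex : List ℕ → ℕ → ℕ
  | [], _ => 0
  | c :: cs, i => if i < c then 0 else blockIndex cs (i - c) + 1

theorem blockIndex_mono (l : List ℕ) : Monotone (blockIndex l) := by
  induction l with
  | nil => intro i j _; simp [blockIndex]
  | cons c cs ih =>
    intro i j hij
    simp only [blockIndex]
    split_ifs with h1 h2
    · exact le_rfl
    · exact Nat.zero_le _
    · omega
    · have := ih (Nat.sub_le_sub_right hij c)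
      omega

/-- The admissible locations of the seaweed: on or below the diagonal in a common block of the
composition given by `a`, or on or above the diagonal in a common block of the one given by `b`. -/
def IsAdmissible (n : ℕ) (a b : List ℕ) (i j : Fin (2 * n)) : Prop :=
  (j ≤ i ∧ blockIndex (fullComposition n a) i = blockIndex (fullComposition n a) j) ∨
  (i ≤ j ∧ blockIndex (fullComposition n b) i = blockIndex (fullComposition n b) j)

theorem isAdmissible_iff (n : ℕ) (a b : List ℕ) (i j : Fin (2 * n)) :
    IsAdmissible n a b i j ↔
      blockIndex (fullComposition n a) i ≤ blockIndex (fullComposition n a) j ∧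
      blockIndex (fullComposition n b) j ≤ blockIndex (fullComposition n b) i := by
  unfold IsAdmissible
  constructor
  · rintro (⟨h, e⟩ | ⟨h, e⟩)
    · exact ⟨e.le, blockIndex_mono _ (Fin.le_def.mp h)⟩
    · exact ⟨blockIndex_mono _ (Fin.le_def.mp h), e.ge⟩
  · rintro ⟨h1, h2⟩
    rcases le_total j i with h | h
    · exact Or.inl ⟨h, le_antisymm h1 (blockIndex_mono _ (Fin.le_def.mp h))⟩
    · exact Or.inr ⟨h, le_antisymm (blockIndex_mono _ (Fin.le_def.mp h)) h2⟩

theorem IsAdmissible.trans {n : ℕ} {a b : List ℕ} {i j k : Fin (2 * n)}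
    (h1 : IsAdmissible n a b i j) (h2 : IsAdmissible n a b j k) : IsAdmissible n a b i k := by
  rw [isAdmissible_iff] at *
  exact ⟨h1.1.trans h2.1, h2.2.trans h1.2⟩

theorem mul_apply_eq_zero_of_not_isAdmissible {n : ℕ} {a b : List ℕ}
    {A B : Matrix (Fin (2 * n)) (Fin (2 * n)) ℂ}
    (hA : ∀ i j, ¬ IsAdmissible n a b i j → A i j = 0)
    (hB : ∀ i j, ¬ IsAdmissible n a b i j → B i j = 0)
    {i k : Fin (2 * n)} (h : ¬ IsAdmissible n a b i k) : (A * B) i k = 0 := by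
  rw [Matrix.mul_apply]
  refine Finset.sum_eq_zero fun j _ => ?_
  by_cases hij : IsAdmissible n a b i j
  · rw [hB j k fun hjk => h (hij.trans hjk), mul_zero]
  · rw [hA i j hij, zero_mul]

/-- The matrices in `(X_a ∩ 𝓛) + (X_b ∩ 𝓤)`: all `2n × 2n` complex matrices whose entries vanish
outside the admissible locations. They form a Lie subalgebra of `𝔤𝔩(2n)`. -/
def admissibleSubalgebra (n : ℕ) (a b : List ℕ) :
    LieSubalgebra ℂ (Matrix (Fin (2 * n)) (Fin (2 * n)) ℂ) where
  carrier := {A | ∀ i j, ¬ IsAdmissible n a b i j → A i j = 0}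
  add_mem' hA hB i j h := by rw [Matrix.add_apply, hA i j h, hB i j h, add_zero]
  zero_mem' _ _ _ := rfl
  smul_mem' c A hA i j h := by rw [Matrix.smul_apply, hA i j h, smul_zero]
  lie_mem' hA hB i j h := by
    rw [Ring.lie_def, Matrix.sub_apply, mul_apply_eq_zero_of_not_isAdmissible hA hB h,
      mul_apply_eq_zero_of_not_isAdmissible hB hA h, sub_zero]

/-- The antidiagonal symplectic form on `ℂ²ⁿ`: its nonzero entries lie on the antidiagonal and are
`1` in the first `n` rows and `-1` in the last `n` rows. -/
def symplecticForm (n : ℕ) : Matrix (Fin (2 * n)) (Fin (2 * n)) ℂ :=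
  Matrix.of fun i j => if j = Fin.rev i then (if (i : ℕ) < n then 1 else -1) else 0

/-- The type-C seaweed given by the partial compositions `a` and `b` of `n`, in standard form:
the elements of `𝔰𝔭(2n)` (realized by the antidiagonal symplectic form, so that the defining
conditions are symmetry conditions across the antidiagonal) which vanish outside the admissible
locations. -/
noncomputable def seaweedC (n : ℕ) (a b : List ℕ) :
    LieSubalgebra ℂ (Matrix (Fin (2 * n)) (Fin (2 * n)) ℂ) :=
  skewAdjointMatricesLieSubalgebra (symplecticForm n) ⊓ admissibleSubalgebra n a b

end Seaweed

section Homotopy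

/-- A type-C homotopy type `H_C(c₁, …, c_{q₁}, c_{q₁+1}, …, c_{q₂}, c_{q₂+1})`, with its three
kinds of entries kept apart. An absent aftertail component is recorded as `0`. -/
@[ext]
structure HomotopyType where
  /-- the non-tail components, in order -/
  nontail : List ℕ
  /-- the tail components, in order -/
  tail : List ℕ
  /-- the aftertail component -/
  aftertail : ℕ

/-- The homotopy type of the meander on `n` vertices of fractional form `a / b`, found by winding
it down until one of the two compositions is empty. The branches are, in this order, the flip, the
component deletion, the rotation contraction, the block elimination and the pure contraction.
Only lists of positive numbers are meaningful; the test `y = 0` just makes the function total. -/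
def homotopyTypeC (n : ℕ) (a b : List ℕ) : HomotopyType :=
  match a, b with
  | [], b => ⟨[], b, 2 * (n - b.sum)⟩
  | x :: xs, [] => ⟨[], x :: xs, 2 * (n - (x :: xs).sum)⟩
  | x :: xs, y :: ys =>
    if x < y then homotopyTypeC n (y :: ys) (x :: xs)
    else if x = y then
      let H := homotopyTypeC (n - x) xs ys
      ⟨x :: H.nontail, H.tail, H.aftertail⟩
    else if x < 2 * y then homotopyTypeC (n - (x - y)) (y :: xs) ((2 * y - x) :: ys)
    else if x = 2 * y then homotopyTypeC (n - y) (y :: xs) ys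
    else if y = 0 then homotopyTypeC n (x :: xs) ys
    else homotopyTypeC (n - y) ((x - 2 * y) :: y :: xs) ys
termination_by 2 * (a.sum + b.sum + a.length + b.length) +
  min 1 (b.headD 0 - a.headD 0)
decreasing_by
  all_goals
    simp only [List.headD_cons, List.sum_cons, List.length_cons]
    omega

end Homotopy

/-! The index adds up along the winding: it equals `Σ cᵢ + Σ ⌊dⱼ/2⌋ + e/2`, which is
`HomotopyType.index` (`lieIndex_seaweedC_eq_index`). The listed homotopy types are the ones for
which this sum is 1, since for positive `d` the number `⌊d/2⌋` is 0 only at 1 and is 1 only at 2 and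
3, and `e` is even (`HomotopyType.index_eq_one_iff`).

The formula is proved move by move with one reduction principle, `lieIndex_eq_of_reduction`. Fix a
one-form `φ₁` and subspaces `V`, `H` of `L`, and suppose that on every line of direction `φ₁` all
but finitely many forms are conjugate to one agreeing with `φ₁` on `V + H`. If for such a form `V^⊥
= V + H + M` with `M` a subalgebra, `H` nondegenerate and `V` disjoint from the radical, then the
radical has the dimension of the radical of the restriction to `M`. Every form on `M` is such a
restriction, so `L` and `M` have the same index. Semicontinuity of kernel dimensions makes the
finitely many bad parameters harmless.

A seaweed is viewed as an algebra of skew matrices supported on a preorder (`SignedPreorder`): the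
location `(i, j)` is admissible when the block level for `a` weakly increases and the one for `b`
weakly decreases from `i` to `j`. Let `x > y` be the leading blocks and `B` the first `y` positions.
The entries leading into `B` from outside, with their mirror images, form an abelian ideal `V`. A
generic form on `V` can be conjugated to the one pairing `b ∈ B` with `b + (x - y)`, the position
found by reflecting `b` in the block `y` and then in the block `x`, that is, by following two arcs
of the meander. Orthogonality to `V` then says that entries at paired positions agree, so `V^⊥` is
`V` plus the matrices pulled back from the quotient that identifies paired positions. This quotient
is the seaweed after the contraction move (`Folding.lieIndex_eq`, `Folding.of_rotation`,
`Folding.of_contraction`).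

A flip is a reversal of positions. A component deletion splits off a direct factor `gl_c`, of index
`c`. If one sequence is empty, a leading block of size `d` gives a grading in degrees 0, 1, 2: a
generic form on degree 2 is an invertible symmetric matrix with stabiliser `so_d` in `gl_d`, and
degree 1 is nondegenerate and drops out, which leaves `⌊d/2⌋` plus the index of the rest
(`lieIndex_extension_true`). The remaining symplectic algebra contributes its rank `e/2`. -/

set_option linter.unusedSectionVars false

/-! ### Kirillov forms, semicontinuity and the reduction principle -/

section IndexTheory

open Module

@[simp]
theorem kirillovForm_apply {K L : Type*} [Field K] [LieRing L] [LieAlgebra K L]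
    (φ : Module.Dual K L) (x y : L) : kirillovForm K L φ x y = φ ⁅x, y⁆ := rfl

/-- The dimension of the kernel of the Kirillov form of `φ`. -/
noncomputable def kerDim {L : Type*} [LieRing L] [LieAlgebra ℂ L] (φ : Module.Dual ℂ L) : ℕ :=
  finrank ℂ (LinearMap.ker (kirillovForm ℂ L φ))

section

theorem kerDim_comp_equiv {L M : Type*} [LieRing L] [LieAlgebra ℂ L] [LieRing M]
    [LieAlgebra ℂ M] (e : M ≃ₗ⁅ℂ⁆ L) (φ : Module.Dual ℂ L) :
    kerDim (φ ∘ₗ (e : M →ₗ[ℂ] L)) = kerDim φ := by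
  have h : LinearMap.ker (kirillovForm ℂ M (φ ∘ₗ (e : M →ₗ[ℂ] L))) =
      (LinearMap.ker (kirillovForm ℂ L φ)).comap (e.toLinearEquiv : M →ₗ[ℂ] L) := by
    ext x
    simp only [LinearMap.mem_ker, Submodule.mem_comap, LinearMap.ext_iff, kirillovForm_apply,
      LinearMap.zero_apply]
    constructor
    · intro h y
      have : φ (e ⁅x, e.symm y⁆) = 0 := h (e.symm y)
      rwa [LieEquiv.map_lie, LieEquiv.apply_symm_apply] at this
    · intro h y
      change φ (e ⁅x, y⁆) = 0
      rw [LieEquiv.map_lie]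
      exact h (e y)
  unfold kerDim
  rw [h, Submodule.comap_equiv_eq_map_symm]
  exact LinearEquiv.finrank_map_eq _ _

variable {L : Type*} [LieRing L] [LieAlgebra ℂ L] [Module.Finite ℂ L]
variable {M : Type*} [LieRing M] [LieAlgebra ℂ M] [Module.Finite ℂ M]

theorem lieIndex_le_kerDim (φ : Module.Dual ℂ L) : lieIndex ℂ L ≤ kerDim φ :=
  Nat.sInf_le ⟨φ, rfl⟩

variable (L) in
theorem exists_kerDim_eq_lieIndex : ∃ φ : Module.Dual ℂ L, kerDim φ = lieIndex ℂ L :=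
  Nat.sInf_mem (Set.range_nonempty fun φ : Module.Dual ℂ L => kerDim φ)

theorem le_lieIndex {k : ℕ} (h : ∀ φ : Module.Dual ℂ L, k ≤ kerDim φ) : k ≤ lieIndex ℂ L := by
  obtain ⟨φ, hφ⟩ := exists_kerDim_eq_lieIndex L
  exact hφ ▸ h φ

theorem lieIndex_congr (e : M ≃ₗ⁅ℂ⁆ L) : lieIndex ℂ M = lieIndex ℂ L := by
  apply le_antisymm
  · refine le_lieIndex fun φ => ?_
    rw [← kerDim_comp_equiv e φ]
    exact lieIndex_le_kerDim _
  · refine le_lieIndex fun φ => ?_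
    rw [← kerDim_comp_equiv e.symm φ]
    exact lieIndex_le_kerDim _

end

/-- A family of vectors depending polynomially on a parameter, if independent for one value of the
parameter, is so for all but finitely many. -/
theorem finite_not_linearIndependent {ι E : Type*} [Fintype ι] [AddCommGroup E] [Module ℂ E]
    (v : ι → ℂ → E)
    (hv : ∀ (f : Module.Dual ℂ E) (i : ι), ∃ p : Polynomial ℂ, ∀ t, f (v i t) = p.eval t)
    (t₀ : ℂ) (h₀ : LinearIndependent ℂ fun i => v i t₀) :
    {t | ¬ LinearIndependent ℂ fun i => v i t}.Finite := by
  classical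
  -- In the coordinates given by a left inverse at `t₀`, the determinant of the family is a
  -- polynomial in the parameter with value `1` at `t₀`. Only its roots can spoil independence.
  obtain ⟨g, hg⟩ := LinearMap.exists_leftInverse_of_injective
    (Fintype.linearCombination ℂ fun i => v i t₀)
    (LinearMap.ker_eq_bot.2 (linearIndependent_iff_injective_fintypeLinearCombination.1 h₀))
  choose p hp using fun i j => hv (LinearMap.proj j ∘ₗ g) i
  let q : Polynomial ℂ := (Matrix.of p).det
  have hq : ∀ t, q.eval t = (Matrix.of fun i j => g (v i t) j).det := by
    intro t
    rw [← Polynomial.coe_evalRingHom, RingHom.map_det]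
    congr 1
    ext i j
    simp [← hp]
  have hq0 : q ≠ 0 := by
    intro h
    have h1 := hq t₀
    have : (Matrix.of fun i j => g (v i t₀) j) = 1 := by
      ext i j
      have h2 := congrArg (fun f => f (Pi.single i 1) j) hg
      simp only [LinearMap.comp_apply, Fintype.linearCombination_apply_single, one_smul,
        LinearMap.id_apply] at h2
      simp [h2, Matrix.one_apply, Pi.single_apply, eq_comm]
    rw [this, h] at h1
    simp at h1
  refine (q.rootSet_finite ℂ).subset fun t ht => ?_
  rw [Polynomial.mem_rootSet]
  refine ⟨hq0, ?_⟩
  rw [Polynomial.coe_aeval_eq_eval, hq]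
  by_contra hne
  apply ht
  have hrow := Matrix.linearIndependent_rows_of_det_ne_zero hne
  exact LinearIndependent.of_comp g hrow

/-- The dimension of the kernel of a pencil of linear maps is upper semicontinuous. -/
theorem le_finrank_ker_of_infinite {E F : Type*} [AddCommGroup E] [Module ℂ E]
    [Module.Finite ℂ E] [AddCommGroup F] [Module ℂ F] (A B : E →ₗ[ℂ] F) (N : ℕ)
    (h : {t : ℂ | N ≤ finrank ℂ (LinearMap.ker (A + t • B))}.Infinite) :
    N ≤ finrank ℂ (LinearMap.ker A) := by
  -- Preimages of a basis of the range of `A` keep independent images under `A + t • B` for almost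
  -- all `t`, so the rank at `t = 0` is at most the generic one.
  let b := finBasis ℂ (LinearMap.range A)
  choose x hx using fun i => (b i).2
  have hind : LinearIndependent ℂ fun i => (A + (0 : ℂ) • B) (x i) := by
    have : (fun i => (A + (0 : ℂ) • B) (x i)) = fun i => (LinearMap.range A).subtype (b i) := by
      funext i
      simp [hx]
    rw [this]
    exact b.linearIndependent.map' _ (LinearMap.range A).ker_subtype
  have hfin := finite_not_linearIndependent (fun i t => (A + t • B) (x i))
    (fun f i => ⟨Polynomial.C (f (A (x i))) + Polynomial.C (f (B (x i))) * Polynomial.X,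
      fun t => by
        simp only [LinearMap.add_apply, LinearMap.smul_apply, map_add, map_smul, smul_eq_mul,
          Polynomial.eval_add, Polynomial.eval_mul, Polynomial.eval_C, Polynomial.eval_X]
        ring⟩) 0 hind
  obtain ⟨t, ht, ht'⟩ := (h.sdiff hfin).nonempty
  simp only [Set.mem_ofPred_eq, not_not] at ht ht'
  have h1 : finrank ℂ (LinearMap.range A) ≤ finrank ℂ (LinearMap.range (A + t • B)) := by
    have h2 : LinearIndependent ℂ
        fun i => (⟨(A + t • B) (x i), LinearMap.mem_range_self _ _⟩ :
          LinearMap.range (A + t • B)) :=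
      LinearIndependent.of_comp (LinearMap.range (A + t • B)).subtype ht'
    simpa using h2.fintype_card_le_finrank
  have h3 := LinearMap.finrank_range_add_finrank_ker A
  have h4 := LinearMap.finrank_range_add_finrank_ker (A + t • B)
  have ht : N ≤ finrank ℂ (LinearMap.ker (A + t • B)) := ht
  omega

theorem infinite_of_finite_not {p : ℂ → Prop} (h : {t | ¬ p t}.Finite) : {t | p t}.Infinite := by
  have := h.infinite_compl
  simpa [Set.compl_ofPred] using this

section

variable {L : Type*} [LieRing L] [LieAlgebra ℂ L] [Module.Finite ℂ L]
variable {M : Type*} [LieRing M] [LieAlgebra ℂ M] [Module.Finite ℂ M]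

/-- The Kirillov form is linear in the one-form, so a line of one-forms is a pencil: a lower bound
holding at almost all points of the line passes to the point `φ`. -/
theorem le_kerDim_of_finite (φ ψ : Module.Dual ℂ L) (N : ℕ)
    (h : {t : ℂ | ¬ N ≤ kerDim (φ + t • ψ)}.Finite) : N ≤ kerDim φ := by
  apply le_finrank_ker_of_infinite (kirillovForm ℂ L φ) (kirillovForm ℂ L ψ) N
  have hk : ∀ t : ℂ, kirillovForm ℂ L φ + t • kirillovForm ℂ L ψ = kirillovForm ℂ L (φ + t • ψ) :=
    fun _ => rfl
  refine (infinite_of_finite_not h).mono fun t (ht : N ≤ kerDim (φ + t • ψ)) => ?_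
  rw [Set.mem_ofPred_eq, hk]
  exact ht

/-- If almost every form on each of the lines of direction `φ₁` is conjugate to a form in `S`,
and the Kirillov forms of the members of `S` have the same kernel dimensions as those of the
one-forms on `M`, then `L` and `M` have the same index. -/
theorem lieIndex_eq_of_normal (S : Set (Module.Dual ℂ L)) (φ₁ : Module.Dual ℂ L)
    (h1 : ∀ ψ : Module.Dual ℂ M, ∃ φ ∈ S, kerDim φ = kerDim ψ)
    (h2 : ∀ φ ∈ S, ∃ ψ : Module.Dual ℂ M, kerDim φ = kerDim ψ)
    (h3 : ∀ φ : Module.Dual ℂ L,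
      {t : ℂ | ¬ ∃ e : L ≃ₗ⁅ℂ⁆ L, (φ + t • φ₁) ∘ₗ (e : L →ₗ[ℂ] L) ∈ S}.Finite) :
    lieIndex ℂ L = lieIndex ℂ M := by
  apply le_antisymm
  · obtain ⟨ψ, hψ⟩ := exists_kerDim_eq_lieIndex M
    obtain ⟨φ, -, hφ⟩ := h1 ψ
    rw [← hψ, ← hφ]
    exact lieIndex_le_kerDim φ
  -- A generic point of the line through `φ` is conjugate into `S`, so its kernel dimension is at
  -- least the index of `M`; semicontinuity carries this bound back to `φ`.
  · refine le_lieIndex fun φ => le_kerDim_of_finite φ φ₁ _ ((h3 φ).subset ?_)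
    intro t ht he
    obtain ⟨e, he⟩ := he
    obtain ⟨ψ, hψ⟩ := h2 _ he
    apply ht
    rw [← kerDim_comp_equiv e, hψ]
    exact lieIndex_le_kerDim ψ

theorem finrank_submodule_prod {E F : Type*} [AddCommGroup E] [Module ℂ E] [Module.Finite ℂ E]
    [AddCommGroup F] [Module ℂ F] [Module.Finite ℂ F] (p : Submodule ℂ E) (q : Submodule ℂ F) :
    finrank ℂ (p.prod q) = finrank ℂ p + finrank ℂ q := by
  have h : p.prod q = LinearMap.range (p.subtype.prodMap q.subtype) := by
    rw [LinearMap.range_prodMap, Submodule.range_subtype, Submodule.range_subtype]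
  rw [h, LinearMap.finrank_range_of_inj, finrank_prod]
  exact Function.Injective.prodMap p.injective_subtype q.injective_subtype

variable (L M) in
theorem lieIndex_prod : lieIndex ℂ (L × M) = lieIndex ℂ L + lieIndex ℂ M := by
  have key : ∀ φ : Module.Dual ℂ (L × M),
      kerDim φ = kerDim (φ ∘ₗ LinearMap.inl ℂ L M) + kerDim (φ ∘ₗ LinearMap.inr ℂ L M) := by
    intro φ
    have h : LinearMap.ker (kirillovForm ℂ (L × M) φ) =
        (LinearMap.ker (kirillovForm ℂ L (φ ∘ₗ LinearMap.inl ℂ L M))).prod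
          (LinearMap.ker (kirillovForm ℂ M (φ ∘ₗ LinearMap.inr ℂ L M))) := by
      ext ⟨x, y⟩
      simp only [LinearMap.mem_ker, Submodule.mem_prod, LinearMap.ext_iff, kirillovForm_apply,
        LinearMap.zero_apply, LinearMap.comp_apply, LinearMap.inl_apply, LinearMap.inr_apply]
      constructor
      · intro h
        constructor
        · intro z
          have := h (z, 0)
          simpa using this
        · intro z
          have := h (0, z)
          simpa using this
      · rintro ⟨hx, hy⟩ ⟨z, w⟩
        have : (⁅(x, y), (z, w)⁆ : L × M) = (⁅x, z⁆, 0) + (0, ⁅y, w⁆) := by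
          ext <;> simp
        rw [this, map_add, hx z, hy w, add_zero]
    unfold kerDim
    rw [h, finrank_submodule_prod]
  apply le_antisymm
  · obtain ⟨φ, hφ⟩ := exists_kerDim_eq_lieIndex L
    obtain ⟨ψ, hψ⟩ := exists_kerDim_eq_lieIndex M
    rw [← hφ, ← hψ]
    refine (lieIndex_le_kerDim (φ.coprod ψ)).trans (key _).le |>.trans ?_
    rw [LinearMap.coprod_inl, LinearMap.coprod_inr]
  · refine le_lieIndex fun φ => ?_
    rw [key]
    exact add_le_add (lieIndex_le_kerDim _) (lieIndex_le_kerDim _)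

end

/-- Reduction of a skew form: if the orthogonal complement of an isotropic subspace `V` that misses
the radical is `V + H + f M`, with `H` nondegenerate and orthogonal to `f M`, then the radical has
the same dimension as that of the form pulled back to `M`. -/
theorem finrank_ker_eq_of_reduction {E M : Type*} [AddCommGroup E] [Module ℂ E]
    [Module.Finite ℂ E] [AddCommGroup M] [Module ℂ M] [Module.Finite ℂ M]
    (B : E →ₗ[ℂ] E →ₗ[ℂ] ℂ) (hB : ∀ x y, B x y = -B y x) (C : M →ₗ[ℂ] M →ₗ[ℂ] ℂ)
    (f : M →ₗ[ℂ] E) (V H : Submodule ℂ E)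
    (hperp : ∀ x, (∀ v ∈ V, B x v = 0) → ∃ v ∈ V, ∃ h ∈ H, ∃ m, x = v + h + f m)
    (hHV : ∀ h ∈ H, ∀ v ∈ V, B h v = 0)
    (hfV : ∀ m, ∀ v ∈ V, B (f m) v = 0) (hHf : ∀ h ∈ H, ∀ m, B h (f m) = 0)
    (hHH : ∀ h ∈ H, (∀ h' ∈ H, B h h' = 0) → h = 0)
    (hV : ∀ v ∈ V, (∀ x, B v x = 0) → v = 0)
    (hfin : ∀ m, f m ∈ V → m = 0)
    (hf : ∀ m m', B (f m) (f m') = C m m') :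
    finrank ℂ (LinearMap.ker B) = finrank ℂ (LinearMap.ker C) := by
  -- The two radicals have the same sum with `V`, and both sums are direct; this yields the equality
  -- of dimensions.
  have e1 : V ⊔ LinearMap.ker B = V ⊔ (LinearMap.ker C).map f := by
    apply le_antisymm
    · refine sup_le le_sup_left fun x hx => ?_
      have hx' : ∀ y, B x y = 0 := fun y => by rw [LinearMap.mem_ker.1 hx]; rfl
      obtain ⟨v, hv, h, hh, m, rfl⟩ := hperp x fun v _ => hx' v
      have h0 : h = 0 := hHH h hh fun h' hh' => by
        have := hx' h'
        rwa [map_add, map_add, LinearMap.add_apply, LinearMap.add_apply, hB v, hHV h' hh' v hv,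
          hB (f m), hHf h' hh' m, neg_zero, zero_add, add_zero] at this
      subst h0
      rw [add_zero] at hx' ⊢
      refine Submodule.add_mem_sup hv ⟨m, ?_, rfl⟩
      rw [SetLike.mem_coe, LinearMap.mem_ker]
      ext m'
      have := hx' (f m')
      rwa [map_add, LinearMap.add_apply, hB v, hfV m' v hv, neg_zero, zero_add, hf] at this
    · refine sup_le le_sup_left ?_
      rintro _ ⟨m, hm, rfl⟩
      have hm' : ∀ m', C m m' = 0 := fun m' => by rw [LinearMap.mem_ker.1 hm]; rfl
      -- The vector `f m` itself need not be in the radical. The functional `B (f m)` vanishes on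
      -- `V^⊥`, hence by the double annihilator it is `B v` for some `v ∈ V`, and `f m - v` is in
      -- the radical.
      have : B (f m) ∈ V.map B := by
        rw [← Subspace.dualCoannihilator_dualAnnihilator_eq (W := V.map B),
          Submodule.mem_dualAnnihilator]
        intro x hx
        rw [Submodule.mem_dualCoannihilator] at hx
        obtain ⟨v, hv, h, hh, m', rfl⟩ := hperp x fun v hv => by
          rw [hB, hx _ ⟨v, hv, rfl⟩, neg_zero]
        rw [map_add, map_add, hfV m v hv, hB, hHf h hh m, hf, hm']
        simp
      obtain ⟨v, hv, hvm⟩ := this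
      have : f m = v + (f m - v) := by abel
      rw [this]
      refine Submodule.add_mem_sup hv ?_
      rw [LinearMap.mem_ker, map_sub, hvm, sub_self]
  have d1 : Disjoint V (LinearMap.ker B) := by
    rw [Submodule.disjoint_def]
    intro v hv hk
    exact hV v hv fun x => by rw [LinearMap.mem_ker.1 hk]; rfl
  have d2 : Disjoint V ((LinearMap.ker C).map f) := by
    rw [Submodule.disjoint_def]
    rintro _ hv ⟨m, -, rfl⟩
    rw [hfin m hv, map_zero]
  have hinj : Function.Injective f := by
    rw [← LinearMap.ker_eq_bot, Submodule.eq_bot_iff]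
    intro m hm
    exact hfin m (by rw [LinearMap.mem_ker.1 hm]; exact V.zero_mem)
  have h1 := Submodule.finrank_sup_add_finrank_inf_eq V (LinearMap.ker B)
  have h2 := Submodule.finrank_sup_add_finrank_inf_eq V ((LinearMap.ker C).map f)
  rw [d1.eq_bot, finrank_bot] at h1
  rw [d2.eq_bot, finrank_bot, ← e1,
    ← LinearEquiv.finrank_eq (Submodule.equivMapOfInjective f hinj _)] at h2
  omega

/-- The index of a Lie algebra is computed by a subalgebra `f M` when generic one-forms can be
conjugated so as to agree with a fixed one on `V + H`, where `V` is isotropic, `H` is nondegenerate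
and `V + H + f M` is the orthogonal complement of `V`. -/
theorem lieIndex_eq_of_reduction {L M : Type*} [LieRing L] [LieAlgebra ℂ L] [Module.Finite ℂ L]
    [LieRing M] [LieAlgebra ℂ M] [Module.Finite ℂ M] (f : M →ₗ⁅ℂ⁆ L) (V H : Submodule ℂ L)
    (φ₁ : Module.Dual ℂ L) (hfin : ∀ m, f m ∈ V ⊔ H → m = 0) (hφ₁ : ∀ m, φ₁ (f m) = 0)
    (h : ∀ φ : Module.Dual ℂ L, (∀ w ∈ V ⊔ H, φ w = φ₁ w) →
      (∀ x, (∀ v ∈ V, φ ⁅x, v⁆ = 0) → ∃ v ∈ V, ∃ h ∈ H, ∃ m, x = v + h + f m) ∧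
      (∀ h ∈ H, ∀ v ∈ V, φ ⁅h, v⁆ = 0) ∧ (∀ m, ∀ v ∈ V, φ ⁅f m, v⁆ = 0) ∧
      (∀ h ∈ H, ∀ m, φ ⁅h, f m⁆ = 0) ∧ (∀ h ∈ H, (∀ h' ∈ H, φ ⁅h, h'⁆ = 0) → h = 0) ∧
      (∀ v ∈ V, (∀ x, φ ⁅v, x⁆ = 0) → v = 0))
    (hconj : ∀ φ : Module.Dual ℂ L,
      {t : ℂ | ¬ ∃ e : L ≃ₗ⁅ℂ⁆ L, ∀ w ∈ V ⊔ H, (φ + t • φ₁) (e w) = φ₁ w}.Finite) :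
    lieIndex ℂ L = lieIndex ℂ M := by
  have key : ∀ φ : Module.Dual ℂ L, (∀ w ∈ V ⊔ H, φ w = φ₁ w) →
      kerDim φ = kerDim (φ ∘ₗ (f : M →ₗ[ℂ] L)) := by
    intro φ hφ
    obtain ⟨c1, c2, c3, c4, c5, c6⟩ := h φ hφ
    refine finrank_ker_eq_of_reduction (kirillovForm ℂ L φ) ?_ (kirillovForm ℂ M _)
      (f : M →ₗ[ℂ] L) V H c1 c2 c3 c4 c5 c6
      (fun m hm => hfin m (Submodule.mem_sup_left hm)) ?_
    · intro x y
      rw [kirillovForm_apply, kirillovForm_apply, ← lie_skew, map_neg]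
    · intro m m'
      simp
  -- As `f M` meets `V + H` trivially, every one-form on `M` extends to `L` with the prescribed
  -- values on `V + H`.
  obtain ⟨g, hg⟩ := LinearMap.exists_leftInverse_of_injective
    ((V ⊔ H).mkQ ∘ₗ (f : M →ₗ[ℂ] L)) (by
      rw [Submodule.eq_bot_iff]
      intro m hm
      rw [LinearMap.mem_ker, LinearMap.comp_apply, Submodule.mkQ_apply,
        Submodule.Quotient.mk_eq_zero] at hm
      exact hfin m hm)
  refine lieIndex_eq_of_normal {φ | ∀ w ∈ V ⊔ H, φ w = φ₁ w} φ₁ ?_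
    (fun φ hφ => ⟨_, key φ hφ⟩) hconj
  intro ψ
  have hn : ∀ w ∈ V ⊔ H, (ψ ∘ₗ g ∘ₗ (V ⊔ H).mkQ + φ₁) w = φ₁ w := by
    intro w hw
    have : (V ⊔ H).mkQ w = 0 := (Submodule.Quotient.mk_eq_zero _).2 hw
    rw [LinearMap.add_apply, LinearMap.comp_apply, LinearMap.comp_apply, this, map_zero, map_zero,
      zero_add]
  refine ⟨_, hn, ?_⟩
  rw [key _ hn]
  congr 1
  ext m
  have := LinearMap.congr_fun hg m
  simp only [LinearMap.comp_apply, LinearMap.id_apply] at this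
  simp only [LinearMap.comp_apply, LinearMap.add_apply, this]
  erw [hφ₁ m, add_zero]

end IndexTheory

/-! ### Signed preorders and their Lie algebras of skew matrices -/

section Frames

open Matrix Module

/-- A preorder with an order-reversing involution and signs, which prescribe a Lie algebra of
matrices that are supported on the preorder and skew for the form attached to the signs. -/
structure SignedPreorder (I : Type*) where
  /-- the involution -/
  σ : I → I
  /-- the signs -/
  ε : I → ℂ
  /-- the preorder -/
  R : I → I → Prop
  σ_σ : ∀ i, σ (σ i) = i
  ε_mul_self : ∀ i, ε i * ε i = 1
  -- Only products of two signs enter the adjoint, so this covers the symplectic case `ε (σ i) = -ε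
  -- i` and the orthogonal case `ε = 1` alike.
  ε_σ : ∀ i j, ε (σ i) * ε (σ j) = ε i * ε j
  refl : ∀ i, R i i
  trans : ∀ {i j k}, R i j → R j k → R i k
  R_σ : ∀ {i j}, R i j → R (σ j) (σ i)

namespace SignedPreorder

variable {I : Type*} (F : SignedPreorder I)

theorem σ_injective : Function.Injective F.σ := fun i j h => by
  rw [← F.σ_σ i, h, F.σ_σ]

theorem R_σ_iff {i j : I} : F.R (F.σ i) (F.σ j) ↔ F.R j i := by
  constructor
  · intro h
    have := F.R_σ h
    rwa [F.σ_σ, F.σ_σ] at this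
  · exact F.R_σ

/-- The adjoint of a matrix with respect to the form attached to the signs. -/
def adj : Matrix I I ℂ →ₗ[ℂ] Matrix I I ℂ where
  toFun A := of fun i j => F.ε i * F.ε j * A (F.σ j) (F.σ i)
  map_add' A B := by ext i j; simp [mul_add]
  map_smul' c A := by ext i j; simp; ring

theorem adj_apply (A : Matrix I I ℂ) (i j : I) :
    F.adj A i j = F.ε i * F.ε j * A (F.σ j) (F.σ i) := rfl

@[simp]
theorem adj_adj (A : Matrix I I ℂ) : F.adj (F.adj A) = A := by
  ext i j
  rw [adj_apply, adj_apply, F.σ_σ, F.σ_σ, F.ε_σ]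
  linear_combination (F.ε i * F.ε i * A i j) * F.ε_mul_self j + A i j * F.ε_mul_self i

/-- A matrix is supported on the preorder. -/
def Supp (A : Matrix I I ℂ) : Prop := ∀ i j, ¬ F.R i j → A i j = 0

variable {F}

theorem Supp.rel {A : Matrix I I ℂ} (hA : F.Supp A) {i j : I} (h : A i j ≠ 0) : F.R i j := by
  by_contra hR
  exact h (hA i j hR)

theorem Supp.add {A B : Matrix I I ℂ} (hA : F.Supp A) (hB : F.Supp B) : F.Supp (A + B) :=
  fun i j h => by rw [Matrix.add_apply, hA i j h, hB i j h, add_zero]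

theorem Supp.sub {A B : Matrix I I ℂ} (hA : F.Supp A) (hB : F.Supp B) : F.Supp (A - B) :=
  fun i j h => by rw [Matrix.sub_apply, hA i j h, hB i j h, sub_zero]

theorem Supp.smul {A : Matrix I I ℂ} (hA : F.Supp A) (c : ℂ) : F.Supp (c • A) :=
  fun i j h => by rw [Matrix.smul_apply, hA i j h, smul_zero]

theorem Supp.adj {A : Matrix I I ℂ} (hA : F.Supp A) : F.Supp (F.adj A) := fun i j h => by
  rw [adj_apply, hA _ _ fun h' => h (F.R_σ_iff.1 h'), mul_zero]

theorem supp_one [DecidableEq I] : F.Supp 1 := fun i j h => by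
  rw [Matrix.one_apply_ne]
  rintro rfl
  exact h (F.refl i)

theorem supp_single [DecidableEq I] {i j : I} (h : F.R i j) (c : ℂ) : F.Supp (single i j c) :=
  fun k l hkl => by
    rw [Matrix.single_apply, if_neg]
    rintro ⟨rfl, rfl⟩
    exact hkl h

theorem Supp.mul [Fintype I] {A B : Matrix I I ℂ} (hA : F.Supp A) (hB : F.Supp B) :
    F.Supp (A * B) := fun i j h => by
  rw [Matrix.mul_apply]
  refine Finset.sum_eq_zero fun k _ => ?_
  by_contra hne
  exact h (F.trans (hA.rel (left_ne_zero_of_mul hne)) (hB.rel (right_ne_zero_of_mul hne)))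

variable (F)

theorem adj_one [DecidableEq I] : F.adj 1 = 1 := by
  ext i j
  rw [adj_apply, Matrix.one_apply, Matrix.one_apply]
  by_cases h : i = j
  · subst h
    rw [if_pos rfl, if_pos rfl, F.ε_mul_self, one_mul]
  · rw [if_neg h, if_neg fun h' => h (F.σ_injective h').symm, mul_zero]

theorem adj_single [DecidableEq I] (i j : I) :
    F.adj (single i j 1) = single (F.σ j) (F.σ i) (F.ε i * F.ε j) := by
  ext k l
  rw [adj_apply, Matrix.single_apply, Matrix.single_apply]
  by_cases h : F.σ j = k ∧ F.σ i = l
  · obtain ⟨rfl, rfl⟩ := h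
    rw [if_pos ⟨(F.σ_σ i).symm, (F.σ_σ j).symm⟩, if_pos ⟨rfl, rfl⟩, F.ε_σ, mul_one, mul_comm]
  · rw [if_neg h, if_neg, mul_zero]
    rintro ⟨rfl, rfl⟩
    exact h ⟨F.σ_σ k, F.σ_σ l⟩

variable [Fintype I]

theorem adj_mul (A B : Matrix I I ℂ) : F.adj (A * B) = F.adj B * F.adj A := by
  ext i j
  rw [adj_apply, Matrix.mul_apply, Matrix.mul_apply, Finset.mul_sum]
  refine Fintype.sum_equiv ⟨F.σ, F.σ, F.σ_σ, F.σ_σ⟩ _ _ fun k => ?_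
  change _ = F.adj B i (F.σ k) * F.adj A (F.σ k) j
  rw [adj_apply, adj_apply, F.σ_σ]
  linear_combination (-(F.ε i * F.ε j * A (F.σ j) k * B k (F.σ i))) * F.ε_mul_self (F.σ k)

variable [DecidableEq I]

/-- The Lie algebra of skew matrices supported on the preorder. -/
def algebra : LieSubalgebra ℂ (Matrix I I ℂ) where
  carrier := {A | F.adj A = -A ∧ F.Supp A}
  add_mem' hA hB := ⟨by rw [map_add, hA.1, hB.1, neg_add], hA.2.add hB.2⟩
  zero_mem' := ⟨by rw [map_zero, neg_zero], fun _ _ _ => rfl⟩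
  smul_mem' c A hA := ⟨by rw [map_smul, hA.1, smul_neg], hA.2.smul c⟩
  lie_mem' {A B} hA hB := by
    refine ⟨?_, ?_⟩
    · rw [Ring.lie_def, map_sub, adj_mul, adj_mul, hA.1, hB.1]
      noncomm_ring
    · rw [Ring.lie_def]
      exact (hA.2.mul hB.2).sub (hB.2.mul hA.2)

variable {F} in
theorem adj_coe (x : F.algebra) : F.adj (x : Matrix I I ℂ) = -x := x.2.1

variable {F} in
theorem supp_coe (x : F.algebra) : F.Supp (x : Matrix I I ℂ) := x.2.2

variable {F} in
theorem coe_lie (x y : F.algebra) :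
    ((⁅x, y⁆ : F.algebra) : Matrix I I ℂ) = x * y - y * x := rfl

open scoped Classical in
/-- The entries of a matrix on the preorder. -/
noncomputable def mask : Matrix I I ℂ →ₗ[ℂ] Matrix I I ℂ where
  toFun A := of fun i j => if F.R i j then A i j else 0
  map_add' A B := by ext i j; by_cases h : F.R i j <;> simp [h]
  map_smul' c A := by ext i j; by_cases h : F.R i j <;> simp [h]

theorem mask_apply_of_rel (A : Matrix I I ℂ) {i j : I} (h : F.R i j) : F.mask A i j = A i j :=
  if_pos h

theorem supp_mask (A : Matrix I I ℂ) : F.Supp (F.mask A) := fun _ _ h => if_neg h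

variable {F} in
theorem Supp.mask_eq {A : Matrix I I ℂ} (hA : F.Supp A) : F.mask A = A := by
  ext i j
  by_cases h : F.R i j
  · exact F.mask_apply_of_rel A h
  · rw [F.supp_mask A i j h, hA i j h]

theorem mask_adj (A : Matrix I I ℂ) : F.mask (F.adj A) = F.adj (F.mask A) := by
  ext i j
  by_cases h : F.R i j
  · rw [F.mask_apply_of_rel _ h, adj_apply, adj_apply, F.mask_apply_of_rel _ (F.R_σ h)]
  · rw [F.supp_mask _ i j h, (F.supp_mask A).adj i j h]

/-- The skew part of the entries of a matrix on the preorder. -/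
noncomputable def sk : Matrix I I ℂ →ₗ[ℂ] F.algebra :=
  LinearMap.codRestrict F.algebra.toSubmodule (F.mask - F.adj ∘ₗ F.mask) fun A =>
    ⟨by simp, (F.supp_mask A).sub (F.supp_mask A).adj⟩

variable {F}

theorem Supp.coe_sk {A : Matrix I I ℂ} (hA : F.Supp A) :
    (F.sk A : Matrix I I ℂ) = A - F.adj A := by
  change F.mask A - F.adj (F.mask A) = _
  rw [hA.mask_eq]

theorem sk_adj (A : Matrix I I ℂ) : F.sk (F.adj A) = -F.sk A := by
  apply Subtype.ext
  change F.mask (F.adj A) - F.adj (F.mask (F.adj A)) = -(F.mask A - F.adj (F.mask A))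
  rw [mask_adj, adj_adj]
  abel

theorem sk_coe (x : F.algebra) : F.sk (x : Matrix I I ℂ) = (2 : ℂ) • x := by
  apply Subtype.ext
  rw [(supp_coe x).coe_sk, adj_coe, sub_neg_eq_add]
  change _ = (2 : ℂ) • (x : Matrix I I ℂ)
  rw [two_smul]

theorem sk_eq_zero_of_mask {A : Matrix I I ℂ} (h : F.mask A = 0) : F.sk A = 0 := by
  apply Subtype.ext
  change F.mask A - F.adj (F.mask A) = 0
  rw [h, map_zero, sub_zero]

/-- The skew extension of a one-form to all matrices. -/
noncomputable def ext (φ : Dual ℂ F.algebra) : Dual ℂ (Matrix I I ℂ) := φ ∘ₗ F.sk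

theorem ext_apply (φ : Dual ℂ F.algebra) (A : Matrix I I ℂ) : ext φ A = φ (F.sk A) := rfl

theorem ext_adj (φ : Dual ℂ F.algebra) (A : Matrix I I ℂ) : ext φ (F.adj A) = -ext φ A := by
  rw [ext_apply, sk_adj, map_neg, ext_apply]

theorem ext_coe (φ : Dual ℂ F.algebra) (x : F.algebra) :
    ext φ (x : Matrix I I ℂ) = 2 * φ x := by
  rw [ext_apply, sk_coe, map_smul, smul_eq_mul]

/-- For skew `x` and `y`, the product `y * x` is the adjoint of `x * y`, on which the skew extension
changes sign. The commutator therefore counts `x * y` twice, which cancels the factor `2` of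
`ext_coe`, and brackets can be evaluated through associative products. -/
theorem apply_lie (φ : Dual ℂ F.algebra) (x y : F.algebra) : φ ⁅x, y⁆ = ext φ (x * y) := by
  have h1 := ext_coe φ ⁅x, y⁆
  have h2 : ext φ ((y : Matrix I I ℂ) * x) = -ext φ ((x : Matrix I I ℂ) * y) := by
    rw [← ext_adj, adj_mul, adj_coe, adj_coe, neg_mul_neg]
  rw [coe_lie, map_sub, h2] at h1
  linear_combination (-1 / 2 : ℂ) * h1

/-- The contribution of the adjoint half of `sk E` folds back onto `E`. For a matrix unit `E` the
two remaining terms involve only one column and one row of `x`. -/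
theorem apply_lie_sk (φ : Dual ℂ F.algebra) (x : F.algebra) {E : Matrix I I ℂ} (hE : F.Supp E) :
    φ ⁅x, F.sk E⁆ = ext φ (x * E) - ext φ (E * x) := by
  rw [apply_lie, hE.coe_sk, mul_sub, map_sub, ← neg_neg (ext φ (x * F.adj E)), ← ext_adj, adj_mul,
    adj_adj, adj_coe, mul_neg, map_neg, neg_neg]

theorem ext_eq_sum (φ : Dual ℂ F.algebra) (A : Matrix I I ℂ) :
    ext φ A = ∑ i, ∑ j, A i j * ext φ (single i j 1) := by
  conv_lhs => rw [matrix_eq_sum_single A]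
  simp only [map_sum]
  refine Finset.sum_congr rfl fun i _ => Finset.sum_congr rfl fun j _ => ?_
  rw [← mul_one (A i j), ← smul_eq_mul, ← smul_single, map_smul, smul_eq_mul, smul_eq_mul, mul_one]

theorem ext_single_of_not_rel (φ : Dual ℂ F.algebra) {i j : I} (h : ¬ F.R i j) :
    ext φ (single i j 1) = 0 := by
  rw [ext_apply, sk_eq_zero_of_mask, map_zero]
  ext k l
  by_cases hkl : F.R k l
  · rw [F.mask_apply_of_rel _ hkl, Matrix.single_apply, if_neg, Matrix.zero_apply]
    rintro ⟨rfl, rfl⟩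
    exact h hkl
  · rw [F.supp_mask _ k l hkl, Matrix.zero_apply]

variable (F) in
/-- The one-form with the given coefficients. -/
noncomputable def formOf (c : Matrix I I ℂ) : Dual ℂ F.algebra :=
  Matrix.traceLinearMap I ℂ ℂ ∘ₗ LinearMap.mulLeft ℂ cᵀ ∘ₗ F.algebra.toSubmodule.subtype

theorem formOf_apply (c : Matrix I I ℂ) (x : F.algebra) :
    F.formOf c x = ∑ i, ∑ j, c i j * (x : Matrix I I ℂ) i j := by
  change (cᵀ * (x : Matrix I I ℂ)).trace = _
  rw [Matrix.trace, Finset.sum_comm]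
  simp [Matrix.mul_apply]

theorem ext_formOf_single (c : Matrix I I ℂ) {i j : I} (h : F.R i j) :
    ext (F.formOf c) (single i j 1) = c i j - F.ε i * F.ε j * c (F.σ j) (F.σ i) := by
  rw [ext_apply, formOf_apply, (supp_single h 1).coe_sk, adj_single]
  simp [Matrix.single_apply, mul_sub, Finset.sum_sub_distrib, ite_and, mul_comm]

/-- Conjugation by a supported matrix that preserves the form. -/
def conj (P : Matrix I I ℂ) (hP : F.Supp P) (h : P * F.adj P = 1) :
    F.algebra ≃ₗ⁅ℂ⁆ F.algebra where
  toFun x := ⟨P * x * F.adj P, by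
    rw [adj_mul, adj_mul, adj_adj, adj_coe]
    noncomm_ring, (hP.mul (supp_coe x)).mul hP.adj⟩
  map_add' x y := by
    apply Subtype.ext
    change P * (x + y) * F.adj P = P * x * F.adj P + P * y * F.adj P
    noncomm_ring
  map_smul' c x := by
    apply Subtype.ext
    change P * (c • (x : Matrix I I ℂ)) * F.adj P = c • (P * x * F.adj P)
    simp
  map_lie' {x y} := by
    have h' := mul_eq_one_comm.1 h
    apply Subtype.ext
    change P * (x * y - y * x) * F.adj P = P * x * F.adj P * (P * y * F.adj P) -
      P * y * F.adj P * (P * x * F.adj P)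
    calc _ = P * x * 1 * y * F.adj P - P * y * 1 * x * F.adj P := by noncomm_ring
      _ = _ := by rw [← h']; noncomm_ring
  invFun x := ⟨F.adj P * x * P, by
    rw [adj_mul, adj_mul, adj_adj, adj_coe]
    noncomm_ring, (hP.adj.mul (supp_coe x)).mul hP⟩
  left_inv x := by
    have h' := mul_eq_one_comm.1 h
    apply Subtype.ext
    change F.adj P * (P * x * F.adj P) * P = x
    calc _ = F.adj P * P * x * (F.adj P * P) := by noncomm_ring
      _ = _ := by rw [h', one_mul, mul_one]
  right_inv x := by
    apply Subtype.ext
    change P * (F.adj P * x * P) * F.adj P = x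
    calc _ = P * F.adj P * x * (P * F.adj P) := by noncomm_ring
      _ = _ := by rw [h, one_mul, mul_one]

theorem coe_conj (P : Matrix I I ℂ) (hP : F.Supp P) (h : P * F.adj P = 1) (x : F.algebra) :
    (conj P hP h x : Matrix I I ℂ) = P * x * F.adj P := rfl

theorem apply_conj_sk (φ : Dual ℂ F.algebra) (P : Matrix I I ℂ) (hP : F.Supp P)
    (h : P * F.adj P = 1) {E : Matrix I I ℂ} (hE : F.Supp E) :
    φ (conj P hP h (F.sk E)) = ext φ (P * E * F.adj P) := by
  rw [ext_apply]
  congr 1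
  apply Subtype.ext
  rw [coe_conj, hE.coe_sk, ((hP.mul hE).mul hP.adj).coe_sk, adj_mul, adj_mul, adj_adj]
  noncomm_ring

/-- Matrices whose columns, respectively rows, are supported on disjoint sets. -/
theorem mul_eq_zero_of_support {A B : Matrix I I ℂ}
    (h : ∀ i k j, A i k ≠ 0 → B k j ≠ 0 → False) : A * B = 0 := by
  ext i j
  rw [Matrix.mul_apply, Matrix.zero_apply]
  refine Finset.sum_eq_zero fun k _ => ?_
  by_contra hne
  exact h i k j (left_ne_zero_of_mul hne) (right_ne_zero_of_mul hne)

/-- An invertible matrix concentrated on an isotropic set of indices extends to a conjugation. -/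
theorem exists_conj (W : I → Prop) (hW : ∀ i, W i → ¬ W (F.σ i)) (p q : Matrix I I ℂ)
    (hpq : p * q = 1) (hp : F.Supp p) (hq : F.Supp q)
    (hpW : ∀ i j, (p - 1) i j ≠ 0 → W i ∧ W j) (hqW : ∀ i j, (q - 1) i j ≠ 0 → W i ∧ W j) :
    ∃ e : F.algebra ≃ₗ⁅ℂ⁆ F.algebra, ∀ (φ : Dual ℂ F.algebra) (E : Matrix I I ℂ), F.Supp E →
      (∀ i j, E i j ≠ 0 → W i) →
      ((∀ i j, E i j ≠ 0 → W j) → φ (e (F.sk E)) = ext φ (p * E * q)) ∧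
      ((∀ i j, E i j ≠ 0 → ¬ W j) → φ (e (F.sk E)) = ext φ (p * E * F.adj p)) := by
  have hadj : ∀ r : Matrix I I ℂ, (∀ i j, (r - 1) i j ≠ 0 → W i ∧ W j) →
      ∀ i j, (F.adj r - 1) i j ≠ 0 → ¬ W i ∧ ¬ W j := by
    intro r hr i j h
    rw [← F.adj_one, ← map_sub, adj_apply] at h
    have := hr _ _ (right_ne_zero_of_mul h)
    refine ⟨fun hi => hW _ hi this.2, fun hj => hW _ hj this.1⟩
  have hp' := hadj p hpW
  have hq' := hadj q hqW
  have z1 : (q - 1) * (F.adj q - 1) = 0 :=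
    mul_eq_zero_of_support fun i k j h1 h2 => (hq' _ _ h2).1 (hqW _ _ h1).2
  have z2 : (F.adj q - 1) * (q - 1) = 0 :=
    mul_eq_zero_of_support fun i k j h1 h2 => (hq' _ _ h1).2 (hqW _ _ h2).1
  have z3 : (q - 1) * (F.adj p - 1) = 0 :=
    mul_eq_zero_of_support fun i k j h1 h2 => (hp' _ _ h2).1 (hqW _ _ h1).2
  have z4 : (F.adj p - 1) * (q - 1) = 0 :=
    mul_eq_zero_of_support fun i k j h1 h2 => (hp' _ _ h1).2 (hqW _ _ h2).1
  have c1 : F.adj q * q = q * F.adj q := by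
    have : F.adj q * q - q * F.adj q = (F.adj q - 1) * (q - 1) - (q - 1) * (F.adj q - 1) := by
      noncomm_ring
    rw [z1, z2, sub_zero] at this
    exact sub_eq_zero.1 this
  have c2 : F.adj p * q = q * F.adj p := by
    have : F.adj p * q - q * F.adj p = (F.adj p - 1) * (q - 1) - (q - 1) * (F.adj p - 1) := by
      noncomm_ring
    rw [z3, z4, sub_zero] at this
    exact sub_eq_zero.1 this
  have hP : (p * F.adj q) * F.adj (p * F.adj q) = 1 := by
    rw [adj_mul, adj_adj]
    calc _ = p * (F.adj q * q) * F.adj p := by noncomm_ring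
      _ = (p * q) * (F.adj q * F.adj p) := by rw [c1]; noncomm_ring
      _ = 1 := by rw [← adj_mul, hpq, adj_one, mul_one]
  -- The conjugating element is `p` on `W` and the inverse of `F.adj p` on the mirror image of `W`.
  -- The factors commute because they live on disjoint sets of indices.
  refine ⟨conj (p * F.adj q) (hp.mul hq.adj) hP, fun φ E hE hEW => ?_⟩
  have e1 : F.adj q * E = E := by
    have : (F.adj q - 1) * E = 0 :=
      mul_eq_zero_of_support fun i k j h1 h2 => (hq' _ _ h1).2 (hEW _ _ h2)
    rwa [sub_mul, one_mul, sub_eq_zero] at this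
  rw [apply_conj_sk φ _ _ _ hE, adj_mul, adj_adj, mul_assoc p, e1]
  constructor
  · intro h
    have e2 : E * F.adj p = E := by
      have : E * (F.adj p - 1) = 0 :=
        mul_eq_zero_of_support fun i k j h1 h2 => (hp' _ _ h2).1 (h _ _ h1)
      rwa [mul_sub, mul_one, sub_eq_zero] at this
    rw [← c2, mul_assoc p, ← mul_assoc E, e2, mul_assoc]
  · intro h
    have e2 : E * q = E := by
      have : E * (q - 1) = 0 :=
        mul_eq_zero_of_support fun i k j h1 h2 => h _ _ h1 (hqW _ _ h2).1
      rwa [mul_sub, mul_one, sub_eq_zero] at this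
    rw [mul_assoc p, ← mul_assoc E, e2, mul_assoc]

end SignedPreorder

end Frames

/-! ### The index of general linear, orthogonal and symplectic algebras -/

section Reductive

open Matrix Module

variable {d : ℕ}

theorem exists_polynomial_pencil_pow (A B : Matrix (Fin d) (Fin d) ℂ) (k : ℕ)
    (f : Dual ℂ (Matrix (Fin d) (Fin d) ℂ)) :
    ∃ p : Polynomial ℂ, ∀ t : ℂ, f ((A + t • B) ^ k) = p.eval t := by
  let M : Matrix (Fin d) (Fin d) (Polynomial ℂ) :=
    (A.map Polynomial.C + (Polynomial.X : Polynomial ℂ) • B.map Polynomial.C) ^ k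
  refine ⟨∑ i, ∑ j, M i j * Polynomial.C (f (single i j 1)), fun t => ?_⟩
  have hM : (A + t • B) ^ k = (Polynomial.evalRingHom t).mapMatrix M := by
    rw [map_pow]
    congr 1
    ext i j
    simp
    exact mul_comm _ _
  rw [hM, matrix_eq_sum_single ((Polynomial.evalRingHom t).mapMatrix M), map_sum,
    Polynomial.eval_finsetSum]
  refine Finset.sum_congr rfl fun i _ => ?_
  rw [map_sum, Polynomial.eval_finsetSum]
  refine Finset.sum_congr rfl fun j _ => ?_
  rw [← mul_one ((Polynomial.evalRingHom t).mapMatrix M i j), ← smul_eq_mul, ← smul_single,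
    map_smul, Polynomial.eval_mul, Polynomial.eval_C]
  simp

theorem linearIndependent_diagonal_pow {x : Fin d → ℂ} (hx : Function.Injective x) :
    LinearIndependent ℂ fun k : Fin d => diagonal x ^ (k : ℕ) := by
  apply LinearIndependent.of_comp (Matrix.diagLinearMap (Fin d) ℂ ℂ)
  have h := linearIndependent_cols_of_det_ne_zero (det_vandermonde_ne_zero_iff.2 hx)
  have e : (Matrix.diagLinearMap (Fin d) ℂ ℂ ∘ fun k : Fin d => diagonal x ^ (k : ℕ)) =
      (vandermonde x).col := by
    funext k i
    simp [diagonal_pow, vandermonde_apply]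
  rw [e]
  exact h

/-- The powers of a matrix become independent after adding almost any multiple of a regular
diagonal matrix. -/
theorem finite_not_linearIndependent_pow (A : Matrix (Fin d) (Fin d) ℂ) {x : Fin d → ℂ}
    (hx : Function.Injective x) :
    {t : ℂ | ¬ LinearIndependent ℂ fun k : Fin d => (A + t • diagonal x) ^ (k : ℕ)}.Finite := by
  have h1 := finite_not_linearIndependent
    (fun (k : Fin d) (s : ℂ) => (diagonal x + s • A) ^ (k : ℕ))
    (fun f k => exists_polynomial_pencil_pow _ _ _ f) 0
    (by simpa using linearIndependent_diagonal_pow hx)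
  -- Independence is known at the diagonal matrix (Vandermonde), which is the point at infinity of
  -- the pencil `A + t • diagonal x`. So one passes to `diagonal x + s • A` with `s ≠ 0` generic and
  -- rescales by `s⁻¹`, which does not affect the independence of powers.
  obtain ⟨s, hs, hs0⟩ := ((infinite_of_finite_not h1).sdiff (Set.finite_singleton 0)).nonempty
  have hs : LinearIndependent ℂ fun k : Fin d => (diagonal x + s • A) ^ (k : ℕ) := hs
  have hs0 : s ≠ 0 := hs0
  refine finite_not_linearIndependent (fun (k : Fin d) (t : ℂ) => (A + t • diagonal x) ^ (k : ℕ))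
    (fun f k => exists_polynomial_pencil_pow _ _ _ f) s⁻¹ ?_
  have h2 := hs.units_smul fun k => (Units.mk0 s hs0)⁻¹ ^ (k : ℕ)
  suffices e : (fun k : Fin d => (A + s⁻¹ • diagonal x) ^ (k : ℕ)) =
      (fun k : Fin d => (Units.mk0 s hs0)⁻¹ ^ (k : ℕ)) •
        fun k : Fin d => (diagonal x + s • A) ^ (k : ℕ) by
    rw [e]
    exact h2
  funext k
  rw [Pi.smul_apply', Units.smul_def]
  simp only [Units.val_pow_eq_pow_val, Units.val_inv_eq_inv_val, Units.val_mk0]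
  rw [← smul_pow, smul_add, smul_smul, inv_mul_cancel₀ hs0, one_smul, add_comm]

/-- The index of a Lie algebra of matrices with nondegenerate trace form that contains a regular
diagonal matrix and is closed under suitable powers. -/
theorem lieIndex_eq_card_of_trace (L : LieSubalgebra ℂ (Matrix (Fin d) (Fin d) ℂ))
    (htr : ∀ A ∈ L, (∀ B ∈ L, (A * B).trace = 0) → A = 0)
    {x : Fin d → ℂ} (hx : Function.Injective x) (hxL : diagonal x ∈ L)
    {ι : Type*} [Fintype ι] (k : ι → Fin d) (hk : Function.Injective k)
    (hkL : ∀ A ∈ L, ∀ i, A ^ (k i : ℕ) ∈ L)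
    (g : (Fin d → ℂ) →ₗ[ℂ] ι → ℂ) (hg : ∀ y, diagonal y ∈ L → g y = 0 → y = 0) :
    lieIndex ℂ L = Fintype.card ι := by
  let T : L →ₗ[ℂ] Dual ℂ L := LinearMap.mk₂ ℂ
    (fun A B => ((A : Matrix (Fin d) (Fin d) ℂ) * (B : Matrix (Fin d) (Fin d) ℂ)).trace)
    (fun A A' B => by simp [add_mul]) (fun c A B => by simp)
    (fun A B B' => by simp [mul_add]) (fun c A B => by simp)
  have hT : ∀ A B : L,
      T A B = ((A : Matrix (Fin d) (Fin d) ℂ) * (B : Matrix (Fin d) (Fin d) ℂ)).trace :=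
    fun _ _ => rfl
  have hTinj : Function.Injective T := by
    rw [← LinearMap.ker_eq_bot, Submodule.eq_bot_iff]
    intro A hA
    refine Subtype.ext (htr A A.2 fun B hB => ?_)
    have := LinearMap.congr_fun (LinearMap.mem_ker.1 hA) ⟨B, hB⟩
    exact this
  have hTsurj : Function.Surjective T :=
    (LinearMap.injective_iff_surjective_of_finrank_eq_finrank
      Subspace.dual_finrank_eq.symm).1 hTinj
  have hker : ∀ A B : L, B ∈ LinearMap.ker (kirillovForm ℂ L (T A)) ↔
      (A : Matrix (Fin d) (Fin d) ℂ) * B = B * A := by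
    intro A B
    have h1 : ∀ C : L, kirillovForm ℂ L (T A) B C = T ⁅A, B⁆ C := by
      intro C
      rw [kirillovForm_apply, hT, hT]
      have h3 : ∀ a b c : Matrix (Fin d) (Fin d) ℂ,
          (a * (b * c - c * b)).trace = ((a * b - b * a) * c).trace := by
        intro a b c
        rw [mul_sub, sub_mul, trace_sub, trace_sub, ← mul_assoc, ← mul_assoc,
          trace_mul_comm (a * c), mul_assoc b]
      exact h3 A B C
    rw [LinearMap.mem_ker]
    have h2 : kirillovForm ℂ L (T A) B = 0 ↔ T ⁅A, B⁆ = 0 := by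
      rw [LinearMap.ext_iff, LinearMap.ext_iff]
      simp only [h1]
    rw [h2, map_eq_zero_iff T hTinj, ← sub_eq_zero (a := (A : Matrix (Fin d) (Fin d) ℂ) * B)]
    exact Subtype.ext_iff
  apply le_antisymm
  -- Upper bound: the radical of the trace form of the regular diagonal matrix is its centralizer in
  -- `L`, which consists of diagonal matrices.
  · refine (lieIndex_le_kerDim (T ⟨diagonal x, hxL⟩)).trans ?_
    let G : LinearMap.ker (kirillovForm ℂ L (T ⟨diagonal x, hxL⟩)) →ₗ[ℂ] ι → ℂ :=
      g ∘ₗ Matrix.diagLinearMap (Fin d) ℂ ℂ ∘ₗ L.toSubmodule.subtype ∘ₗ Submodule.subtype _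
    have hG : Function.Injective G := by
      rw [← LinearMap.ker_eq_bot, Submodule.eq_bot_iff]
      rintro ⟨B, hB⟩ h0
      have hB' : diagonal x * (B : Matrix (Fin d) (Fin d) ℂ) = B * diagonal x := (hker _ _).1 hB
      have hd : (B : Matrix (Fin d) (Fin d) ℂ) = diagonal (diag B) := by
        ext i j
        by_cases hij : i = j
        · subst hij; simp
        · rw [diagonal_apply_ne _ hij]
          have := congrFun (congrFun hB' i) j
          rw [diagonal_mul, mul_diagonal] at this
          have hne : x i - x j ≠ 0 := sub_ne_zero.2 fun h => hij (hx h)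
          have : (x i - x j) * (B : Matrix (Fin d) (Fin d) ℂ) i j = 0 := by
            linear_combination this
          exact (mul_eq_zero.1 this).resolve_left hne
      have h1 := hg (diag (B : Matrix (Fin d) (Fin d) ℂ)) (hd ▸ B.2) h0
      apply Subtype.ext
      apply Subtype.ext
      change (B : Matrix (Fin d) (Fin d) ℂ) = 0
      rw [hd, h1]
      exact diagonal_zero
    have := LinearMap.finrank_le_finrank_of_injective hG
    rwa [finrank_fintype_fun_eq_card] at this
  -- Lower bound: every form is the trace form of some matrix, whose chosen powers lie in its
  -- centralizer in `L`; generically on the line these powers are independent.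
  · refine le_lieIndex fun φ => le_kerDim_of_finite φ (T ⟨diagonal x, hxL⟩) _ ?_
    obtain ⟨A, rfl⟩ := hTsurj φ
    refine (finite_not_linearIndependent_pow (A : Matrix (Fin d) (Fin d) ℂ) hx).subset ?_
    intro t ht hind
    apply ht
    have hC := (A + t • (⟨diagonal x, hxL⟩ : L)).2
    have e : T A + t • T ⟨diagonal x, hxL⟩ = T (A + t • ⟨diagonal x, hxL⟩) := by
      rw [map_add, map_smul]
    rw [e]
    let v : ι → LinearMap.ker (kirillovForm ℂ L (T (A + t • ⟨diagonal x, hxL⟩))) := fun i =>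
      ⟨⟨_, hkL _ hC i⟩, (hker _ _).2 (Commute.self_pow _ _)⟩
    have hv : LinearIndependent ℂ v :=
      LinearIndependent.of_comp (L.toSubmodule.subtype ∘ₗ Submodule.subtype _) (hind.comp k hk)
    exact hv.fintype_card_le_finrank

theorem eq_zero_of_trace_mul_eq_zero {A : Matrix (Fin d) (Fin d) ℂ}
    (h : ∀ i j, (A * single i j 1).trace = 0) : A = 0 := by
  ext i j
  have := h j i
  rwa [trace_mul_comm, trace_single_mul, one_smul] at this

variable (d) in
theorem lieIndex_gl : lieIndex ℂ (⊤ : LieSubalgebra ℂ (Matrix (Fin d) (Fin d) ℂ)) = d := by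
  rw [lieIndex_eq_card_of_trace ⊤ (x := fun i => ((i : ℕ) : ℂ)) (ι := Fin d) _ _ trivial id
    Function.injective_id (fun _ _ _ => trivial) LinearMap.id (fun _ _ h => h), Fintype.card_fin]
  · intro A _ h
    exact eq_zero_of_trace_mul_eq_zero fun i j => h _ trivial
  · intro i j h
    exact Fin.ext (Nat.cast_injective h)

namespace SignedPreorder

theorem trace_adj {I : Type*} [Fintype I] (F : SignedPreorder I) (A : Matrix I I ℂ) :
    (F.adj A).trace = A.trace := by
  rw [Matrix.trace, Matrix.trace]
  refine Fintype.sum_equiv ⟨F.σ, F.σ, F.σ_σ, F.σ_σ⟩ _ _ fun i => ?_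
  rw [diag_apply, adj_apply, F.ε_mul_self, one_mul]
  rfl

theorem adj_pow {I : Type*} [Fintype I] [DecidableEq I] (F : SignedPreorder I)
    (A : Matrix I I ℂ) (k : ℕ) : F.adj (A ^ k) = F.adj A ^ k := by
  induction k with
  | zero => rw [pow_zero, pow_zero, adj_one]
  | succ k ih => rw [pow_succ, adj_mul, ih, pow_succ']

/-- The index of the orthogonal and symplectic Lie algebras. -/
theorem lieIndex_of_rel_true (F : SignedPreorder (Fin d)) (hσ : ∀ i, F.σ i = Fin.rev i)
    (hR : ∀ i j, F.R i j) : lieIndex ℂ F.algebra = d / 2 := by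
  have hS : ∀ A, F.Supp A := fun A i j h => (h (hR i j)).elim
  -- The diagonal entries `d - 1, d - 3, …, 1 - d` are distinct and change sign under reversal. Odd
  -- powers of a skew matrix are skew, and exactly `⌊d/2⌋` odd exponents are below `d`.
  rw [lieIndex_eq_card_of_trace F.algebra
    (x := fun i => (((d : ℤ) - 1 - 2 * ((i : ℕ) : ℤ) : ℤ) : ℂ)) (ι := Fin (d / 2)) _ _ _
    (fun i => ⟨2 * i + 1, by omega⟩) _ _
    (LinearMap.funLeft ℂ ℂ (Fin.castLE (Nat.div_le_self d 2))) _, Fintype.card_fin]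
  · intro A hA h
    refine eq_zero_of_trace_mul_eq_zero fun i j => ?_
    have h1 := h _ (F.sk (single i j 1)).2
    rw [(hS _).coe_sk, mul_sub, trace_sub, ← F.trace_adj (A * F.adj _), adj_mul, adj_adj, hA.1,
      mul_neg, trace_neg, trace_mul_comm (single i j 1)] at h1
    linear_combination (1 / 2 : ℂ) * h1
  · intro i j h
    have h : ((d : ℤ) - 1 - 2 * ((i : ℕ) : ℤ) : ℤ) = (d : ℤ) - 1 - 2 * ((j : ℕ) : ℤ) :=
      Int.cast_injective h
    exact Fin.ext (by omega)
  · refine ⟨?_, hS _⟩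
    ext i j
    rw [adj_apply, hσ, hσ, neg_apply]
    by_cases h : i = j
    · subst h
      rw [diagonal_apply_eq, diagonal_apply_eq, F.ε_mul_self, one_mul, ← Int.cast_neg]
      congr 1
      rw [Fin.val_rev]
      have := i.2
      omega
    · rw [diagonal_apply_ne _ h, diagonal_apply_ne _ fun h' => h (Fin.rev_injective h').symm,
        mul_zero, neg_zero]
  · intro i j h
    rw [Fin.mk.injEq] at h
    exact Fin.ext (by omega)
  · intro A hA i
    refine ⟨?_, hS _⟩
    rw [adj_pow, hA.1, Odd.neg_pow ⟨(i : ℕ), rfl⟩]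
  · intro y hy h0
    have hs : ∀ i, y (Fin.rev i) = -y i := by
      intro i
      have := congrFun (congrFun hy.1 i) i
      rwa [adj_apply, hσ, F.ε_mul_self, one_mul, diagonal_apply_eq, neg_apply,
        diagonal_apply_eq] at this
    have hlow : ∀ i : Fin d, (i : ℕ) < d / 2 → y i = 0 := by
      intro i hi
      exact congrFun h0 ⟨i, hi⟩
    funext i
    have hi := i.2
    rcases lt_trichotomy (2 * (i : ℕ) + 1) d with h | h | h
    · exact hlow i (by omega)
    · have hr : Fin.rev i = i := Fin.ext (by rw [Fin.val_rev]; omega)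
      have := hs i
      rw [hr] at this
      rw [Pi.zero_apply]
      linear_combination (1 / 2 : ℂ) * this
    · have h1 := hlow (Fin.rev i) (by rw [Fin.val_rev]; omega)
      rw [hs] at h1
      exact neg_eq_zero.1 h1

end SignedPreorder

end Reductive

/-! ### Foldings and the orthogonal complement of the connecting ideal -/

section Folding

open Matrix Module

namespace SignedPreorder

section

variable {I : Type*} [Fintype I] [DecidableEq I] {F : SignedPreorder I}

theorem ext_mul_single (φ : Dual ℂ F.algebra) (A : Matrix I I ℂ) (i j : I) :
    ext φ (A * single i j 1) = ∑ k, A k i * ext φ (single k j 1) := by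
  rw [ext_eq_sum]
  refine Finset.sum_congr rfl fun k _ => ?_
  rw [Finset.sum_eq_single j]
  · rw [mul_single_apply_same, mul_one]
  · intro l _ hl
    rw [mul_single_apply_of_ne _ _ _ _ _ hl, zero_mul]
  · intro h
    exact (h (Finset.mem_univ j)).elim

theorem ext_single_mul (φ : Dual ℂ F.algebra) (A : Matrix I I ℂ) (i j : I) :
    ext φ (single i j 1 * A) = ∑ k, A j k * ext φ (single i k 1) := by
  rw [ext_eq_sum, Finset.sum_eq_single i]
  · refine Finset.sum_congr rfl fun k _ => ?_
    rw [single_mul_apply_same, one_mul]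
  · intro l _ hl
    refine Finset.sum_eq_zero fun k _ => ?_
    rw [single_mul_apply_of_ne _ _ _ _ _ hl, zero_mul]
  · intro h
    exact (h (Finset.mem_univ i)).elim

theorem ext_eq_zero_of_single {φ : Dual ℂ F.algebra} {A : Matrix I I ℂ}
    (h : ∀ i j, A i j ≠ 0 → φ (F.sk (single i j 1)) = 0) : φ (F.sk A) = 0 := by
  rw [← ext_apply, ext_eq_sum]
  refine Finset.sum_eq_zero fun i _ => Finset.sum_eq_zero fun j _ => ?_
  by_cases hA : A i j = 0
  · rw [hA, zero_mul]
  · rw [ext_apply, h i j hA, mul_zero]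

end

variable {I J : Type*}

/-- A folding `π` of a signed preorder `F` onto a signed preorder `G`, which identifies elements
of an initial set `B` with elements outside `B` that lie above `B`. -/
structure Folding (F : SignedPreorder I) (G : SignedPreorder J) (B : I → Prop) (π : I → J) :
    Prop where
  row : ∀ {i j}, B i → F.R i j → B j
  full : ∀ {i j}, B i → B j → F.R i j
  iso : ∀ {i j}, B i → B j → ¬ F.R (F.σ i) j
  map_σ : ∀ i, π (F.σ i) = G.σ (π i)
  map_ε : ∀ i, G.ε (π i) = F.ε i
  inj : ∀ {i j}, (B i ↔ B j) → (B (F.σ i) ↔ B (F.σ j)) → π i = π j → i = j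
  rel_of_eq : ∀ {i j}, ¬ B i → B j → π i = π j → F.R i j
  -- Each slot `(d, b)` of the ideal is seen by a partner of `d` in `B` or by a suitable partner of
  -- `b` outside `B`. This keeps the ideal away from the radical and also makes the generic
  -- normalisation possible.
  matched : ∀ {d b}, ¬ B d → B b → F.R d b →
    (∃ k, B k ∧ π k = π d) ∨ ∃ k, ¬ B k ∧ π k = π b ∧ F.R k d
  -- This condition and the next two make the pullback of matrices respect supports, be
  -- multiplicative and be injective, respectively.
  rel_of_map : ∀ {i j}, (B i ↔ B j) → (B (F.σ i) ↔ B (F.σ j)) → G.R (π i) (π j) → F.R i j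
  exists_mid : ∀ {i j l}, (B i ↔ B j) → (B (F.σ i) ↔ B (F.σ j)) → G.R (π i) l → G.R l (π j) →
    ∃ k, (B i ↔ B k) ∧ (B (F.σ i) ↔ B (F.σ k)) ∧ π k = l
  exists_rel : ∀ {l l'}, G.R l l' →
    ∃ i j, (B i ↔ B j) ∧ (B (F.σ i) ↔ B (F.σ j)) ∧ π i = l ∧ π j = l'
  -- For a pulled back matrix, the two sums in `apply_lie_single` either both reduce to its entry at
  -- `(π b, π d)` or are both empty; hence the image of `G` is orthogonal to the ideal.
  balance : ∀ {d b}, ¬ B d → B b → F.R d b → G.R (π b) (π d) →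
    ((∃ k, ((B k ↔ B d) ∧ (B (F.σ k) ↔ B (F.σ d))) ∧ π k = π b) ↔ ∃ k, B k ∧ π k = π d)
  -- A relation of `F` within a part that `G` lacks must disappear in the complement: orthogonality
  -- to one slot `(d, b)` equates that entry, or its mirror image, with an empty sum.
  killed : ∀ {i j}, (B i ↔ B j) → (B (F.σ i) ↔ B (F.σ j)) → F.R i j → ¬ G.R (π i) (π j) →
    ∃ d b, ¬ B d ∧ B b ∧ F.R d b ∧
      ((π b = π i ∧ π d = π j ∧
        ((i = b ∧ ∀ k, ¬ B k → π k = π b → ¬ F.R k d) ∨ (j = d ∧ ∀ k, B k → π k ≠ π d))) ∨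
      (π b = π (F.σ j) ∧ π d = π (F.σ i) ∧
        ((F.σ j = b ∧ ∀ k, ¬ B k → π k = π b → ¬ F.R k d) ∨ (F.σ i = d ∧ ∀ k, B k → π k ≠ π d))))

namespace Folding

variable {F : SignedPreorder I} {G : SignedPreorder J} {B : I → Prop} {π : I → J}

/-- Two elements lie in the same part: in `B`, in its mirror image, or in the rest. -/
def Same (F : SignedPreorder I) (B : I → Prop) (i j : I) : Prop :=
  (B i ↔ B j) ∧ (B (F.σ i) ↔ B (F.σ j))

theorem Same.symm {i j : I} (h : Same F B i j) : Same F B j i := ⟨h.1.symm, h.2.symm⟩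

theorem Same.trans {i j k : I} (h : Same F B i j) (h' : Same F B j k) : Same F B i k :=
  ⟨h.1.trans h'.1, h.2.trans h'.2⟩

theorem same_σ_iff {i j : I} : Same F B (F.σ i) (F.σ j) ↔ Same F B i j := by
  unfold Same
  rw [F.σ_σ, F.σ_σ, and_comm]

theorem same_σ_iff' {i j : I} : Same F B (F.σ j) (F.σ i) ↔ Same F B i j :=
  same_σ_iff.trans ⟨Same.symm, Same.symm⟩

variable (h : Folding F G B π)
include h

theorem not_mirror {i : I} (hi : B i) : ¬ B (F.σ i) := fun h' => by
  have := h.iso h' hi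
  rw [F.σ_σ] at this
  exact this (F.refl i)

theorem not_mirror_of_rel {d b : I} (hb : B b) (hdb : F.R d b) : ¬ B (F.σ d) := fun h' => by
  have := h.iso h' hb
  rw [F.σ_σ] at this
  exact this hdb

theorem same_of_mem {i j : I} (hi : B i) (hj : B j) : Same F B i j :=
  ⟨iff_of_true hi hj, iff_of_false (h.not_mirror hi) (h.not_mirror hj)⟩

theorem same_of_above {d d' b b' : I} (hd : ¬ B d) (hd' : ¬ B d') (hb : B b) (hb' : B b')
    (hdb : F.R d b) (hdb' : F.R d' b') : Same F B d d' :=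
  ⟨iff_of_false hd hd',
    iff_of_false (h.not_mirror_of_rel hb hdb) (h.not_mirror_of_rel hb' hdb')⟩

theorem not_same {d b : I} (hd : ¬ B d) (hb : B b) : ¬ Same F B d b := fun h' => hd (h'.1.2 hb)

theorem cases_of_not_same {i j : I} (hR : F.R i j) (hs : ¬ Same F B i j) :
    (¬ B i ∧ B j) ∨ (B (F.σ i) ∧ ¬ B (F.σ j)) := by
  have h1 : B i → B j := fun hi => h.row hi hR
  have h2 : B (F.σ j) → B (F.σ i) := fun hi => h.row hi (F.R_σ hR)
  unfold Same at hs
  tauto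

omit h in
open scoped Classical in
/-- The pullback of a matrix along a folding. -/
noncomputable def pull (F : SignedPreorder I) (B : I → Prop) (π : I → J) :
    Matrix J J ℂ →ₗ[ℂ] Matrix I I ℂ where
  toFun A := of fun i j => if Same F B i j then A (π i) (π j) else 0
  map_add' A A' := by ext i j; by_cases h : Same F B i j <;> simp [h]
  map_smul' c A := by ext i j; by_cases h : Same F B i j <;> simp [h]

omit h in
theorem pull_of_same (A : Matrix J J ℂ) {i j : I} (hs : Same F B i j) :
    pull F B π A i j = A (π i) (π j) := if_pos hs

omit h in
theorem pull_of_not_same (A : Matrix J J ℂ) {i j : I} (hs : ¬ Same F B i j) :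
    pull F B π A i j = 0 := if_neg hs

theorem adj_pull (A : Matrix J J ℂ) : F.adj (pull F B π A) = pull F B π (G.adj A) := by
  ext i j
  rw [adj_apply]
  by_cases hs : Same F B i j
  · rw [pull_of_same _ hs, pull_of_same _ (same_σ_iff'.2 hs), adj_apply, h.map_σ, h.map_σ, h.map_ε,
      h.map_ε]
  · rw [pull_of_not_same _ hs, pull_of_not_same _ fun h' => hs (same_σ_iff'.1 h'), mul_zero]

theorem supp_pull {A : Matrix J J ℂ} (hA : G.Supp A) : F.Supp (pull F B π A) := by
  intro i j hR
  by_cases hs : Same F B i j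
  · rw [pull_of_same _ hs]
    exact hA _ _ fun h' => hR (h.rel_of_map hs.1 hs.2 h')
  · exact pull_of_not_same _ hs

theorem pull_injective {A : Matrix J J ℂ} (hA : G.Supp A) (h0 : pull F B π A = 0) : A = 0 := by
  ext l l'
  by_cases hl : G.R l l'
  · obtain ⟨i, j, h1, h2, rfl, rfl⟩ := h.exists_rel hl
    rw [← pull_of_same (F := F) (B := B) (π := π) A ⟨h1, h2⟩, h0]
    rfl
  · exact hA _ _ hl

variable [Fintype I] [DecidableEq I] [Fintype J] [DecidableEq J]

/-- Within one part `π` is injective, and by `exists_mid` that part contains a lift of every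
intermediate index contributing to the product; so the sums over the part and over `J` agree. -/
theorem pull_mul {A A' : Matrix J J ℂ} (hA : G.Supp A) (hA' : G.Supp A') :
    pull F B π (A * A') = pull F B π A * pull F B π A' := by
  classical
  ext i j
  rw [Matrix.mul_apply]
  by_cases hs : Same F B i j
  · rw [pull_of_same _ hs, Matrix.mul_apply]
    have h1 : ∑ k, pull F B π A i k * pull F B π A' k j =
        ∑ k with Same F B i k, A (π i) (π k) * A' (π k) (π j) := by
      rw [Finset.sum_filter]
      refine Finset.sum_congr rfl fun k _ => ?_
      by_cases hk : Same F B i k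
      · rw [if_pos hk, pull_of_same _ hk, pull_of_same _ (hk.symm.trans hs)]
      · rw [if_neg hk, pull_of_not_same _ hk, zero_mul]
    rw [h1, ← Finset.sum_image (g := π) (f := fun l => A (π i) l * A' l (π j))]
    · symm
      refine Finset.sum_subset (Finset.subset_univ _) fun l _ hl => ?_
      by_contra hne
      obtain ⟨k, hk1, hk2, rfl⟩ := h.exists_mid hs.1 hs.2 (hA.rel (left_ne_zero_of_mul hne))
        (hA'.rel (right_ne_zero_of_mul hne))
      exact hl (Finset.mem_image_of_mem π (Finset.mem_filter.2 ⟨Finset.mem_univ _, hk1, hk2⟩))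
    · intro k hk k' hk' e
      have hk := (Finset.mem_filter.1 hk).2
      have hk' := (Finset.mem_filter.1 hk').2
      have := hk.symm.trans hk'
      exact h.inj this.1 this.2 e
  · rw [pull_of_not_same _ hs]
    refine (Finset.sum_eq_zero fun k _ => ?_).symm
    by_cases hk : Same F B i k
    · rw [pull_of_not_same (i := k) _ fun h' => hs (hk.trans h'), mul_zero]
    · rw [pull_of_not_same _ hk, zero_mul]

/-- The embedding of Lie algebras attached to a folding. -/
noncomputable def hom : G.algebra →ₗ⁅ℂ⁆ F.algebra where
  toFun x := ⟨pull F B π x, by rw [h.adj_pull, adj_coe, map_neg], h.supp_pull (supp_coe x)⟩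
  map_add' x y := Subtype.ext (map_add (pull F B π) (x : Matrix J J ℂ) y)
  map_smul' c x := Subtype.ext (map_smul (pull F B π) c (x : Matrix J J ℂ))
  map_lie' {x y} := by
    apply Subtype.ext
    change pull F B π (x * y - y * x) = pull F B π x * pull F B π y - pull F B π y * pull F B π x
    rw [map_sub, h.pull_mul (supp_coe x) (supp_coe y), h.pull_mul (supp_coe y) (supp_coe x)]

theorem coe_hom (x : G.algebra) : (h.hom x : Matrix I I ℂ) = pull F B π x := rfl

omit h in
/-- The abelian ideal of the elements that connect different parts. -/
def ideal (F : SignedPreorder I) (B : I → Prop) : Submodule ℂ F.algebra where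
  carrier := {x | ∀ i j, Same F B i j → (x : Matrix I I ℂ) i j = 0}
  add_mem' hx hy i j hs := by
    change (_ + _ : ℂ) = 0
    rw [hx i j hs, hy i j hs, add_zero]
  zero_mem' _ _ _ := rfl
  smul_mem' c x hx i j hs := by
    change c * _ = (0 : ℂ)
    rw [hx i j hs, mul_zero]

theorem sk_single_mem {d b : I} (hd : ¬ B d) (hb : B b) (hdb : F.R d b) :
    F.sk (single d b 1) ∈ ideal F B := by
  intro i j hs
  rw [(supp_single hdb 1).coe_sk, adj_single, Matrix.sub_apply, Matrix.single_apply,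
    Matrix.single_apply, if_neg, if_neg, sub_zero]
  · rintro ⟨rfl, rfl⟩
    exact h.not_same hd hb (same_σ_iff'.1 hs)
  · rintro ⟨rfl, rfl⟩
    exact h.not_same hd hb hs

/-- An entry connecting different parts either leads from outside into `B` or is the mirror image of
such an entry. So the skew matrix units of the slots `(d, b)` span the ideal, and identities on the
ideal need checking only there. -/
theorem exists_sk {v : F.algebra} (hv : v ∈ ideal F B) :
    ∃ A : Matrix I I ℂ, (∀ i j, A i j ≠ 0 → ¬ B i ∧ B j ∧ F.R i j ∧
      A i j = (v : Matrix I I ℂ) i j) ∧ v = F.sk A := by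
  classical
  let A : Matrix I I ℂ := of fun i j => if ¬ B i ∧ B j then (v : Matrix I I ℂ) i j else 0
  have hA : ∀ i j, A i j = if ¬ B i ∧ B j then (v : Matrix I I ℂ) i j else 0 := fun _ _ => rfl
  have hA0 : ∀ i j, A i j ≠ 0 → ¬ B i ∧ B j ∧ F.R i j ∧ A i j = (v : Matrix I I ℂ) i j := by
    intro i j hne
    rw [hA] at hne ⊢
    by_cases hc : ¬ B i ∧ B j
    · rw [if_pos hc] at hne ⊢
      exact ⟨hc.1, hc.2, (supp_coe v).rel hne, rfl⟩
    · rw [if_neg hc] at hne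
      exact (hne rfl).elim
  have hAS : F.Supp A := fun i j hR => by
    by_contra hne
    exact hR (hA0 i j hne).2.2.1
  refine ⟨A, hA0, Subtype.ext ?_⟩
  rw [hAS.coe_sk]
  ext i j
  have hadj : (v : Matrix I I ℂ) i j = -(F.ε i * F.ε j * (v : Matrix I I ℂ) (F.σ j) (F.σ i)) := by
    have := congrFun (congrFun (adj_coe v) i) j
    rw [adj_apply, neg_apply] at this
    rw [this, neg_neg]
  rw [Matrix.sub_apply, adj_apply, hA, hA]
  by_cases hR : F.R i j
  · by_cases hs : Same F B i j
    · rw [hv i j hs, hv _ _ (same_σ_iff'.2 hs)]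
      simp
    · rcases h.cases_of_not_same hR hs with hc | hc
      · rw [if_pos hc, if_neg fun h' => h.not_mirror_of_rel hc.2 hR h'.2, mul_zero, sub_zero]
      · rw [if_neg fun h' => h.not_mirror_of_rel h'.2 hR hc.1, if_pos ⟨hc.2, hc.1⟩, zero_sub, hadj]
  · rw [supp_coe v _ _ hR, supp_coe v _ _ fun h' => hR (F.R_σ_iff.1 h')]
    simp

theorem eq_zero_on_ideal {φ : Dual ℂ F.algebra}
    (hφ : ∀ d b, ¬ B d → B b → F.R d b → φ (F.sk (single d b 1)) = 0) {v : F.algebra}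
    (hv : v ∈ ideal F B) : φ v = 0 := by
  obtain ⟨A, hA, rfl⟩ := h.exists_sk hv
  exact ext_eq_zero_of_single fun i j hne =>
    hφ i j (hA i j hne).1 (hA i j hne).2.1 (hA i j hne).2.2.1

omit h in
open scoped Classical in
/-- The coefficients of the normal form on the ideal. -/
noncomputable def coeff (B : I → Prop) (π : I → J) : Matrix I I ℂ :=
  of fun i j => if ¬ B i ∧ B j ∧ π i = π j then 1 else 0

omit h in
theorem coeff_apply {d b : I} (hd : ¬ B d) (hb : B b) :
    coeff B π d b = if π d = π b then 1 else 0 := by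
  rw [coeff, of_apply]
  by_cases e : π d = π b
  · rw [if_pos e, if_pos ⟨hd, hb, e⟩]
  · rw [if_neg e, if_neg fun h' => e h'.2.2]

theorem ext_form_single {d b : I} (hd : ¬ B d) (hb : B b) (hdb : F.R d b) :
    ext (F.formOf (coeff B π)) (single d b 1) = if π d = π b then 1 else 0 := by
  rw [ext_formOf_single _ hdb, coeff_apply hd hb]
  have : coeff B π (F.σ b) (F.σ d) = 0 := if_neg fun h' => h.not_mirror_of_rel hb hdb h'.2.1
  rw [this, mul_zero, sub_zero]

theorem form_hom (m : G.algebra) : F.formOf (coeff B π) (h.hom m) = 0 := by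
  rw [formOf_apply]
  refine Finset.sum_eq_zero fun i _ => Finset.sum_eq_zero fun j _ => ?_
  rw [coe_hom]
  by_cases hc : ¬ B i ∧ B j ∧ π i = π j
  · rw [pull_of_not_same _ (h.not_same hc.1 hc.2.1), mul_zero]
  · have : coeff B π i j = 0 := if_neg hc
    rw [this, zero_mul]

theorem hom_mem_ideal {m : G.algebra} (hm : h.hom m ∈ ideal F B) : m = 0 := by
  refine Subtype.ext (h.pull_injective (supp_coe m) ?_)
  ext i j
  by_cases hs : Same F B i j
  · exact hm i j hs
  · exact pull_of_not_same _ hs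

section Normal

variable {φ : Dual ℂ F.algebra}
  (hφ : ∀ d b, ¬ B d → B b → F.R d b → ext φ (single d b 1) = if π d = π b then 1 else 0)
include hφ

/-- The normal form sees only pairs with equal image, so the bracket with a slot `(d, b)` compares
column `d` of `x` over the fibre of `b` with row `b` over the fibre of `d`. The description of the
complement rests on this identity. -/
theorem apply_lie_single (x : F.algebra) {d b : I} (hd : ¬ B d) (hb : B b) (hdb : F.R d b) :
    φ ⁅x, F.sk (single d b 1)⁆ =
      (∑ k, if π k = π b then (x : Matrix I I ℂ) k d else 0) -
        ∑ k, if π d = π k then (x : Matrix I I ℂ) b k else 0 := by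
  rw [apply_lie_sk φ x (supp_single hdb 1), ext_mul_single, ext_single_mul]
  congr 1
  · refine Finset.sum_congr rfl fun k _ => ?_
    by_cases hx : (x : Matrix I I ℂ) k d = 0
    · rw [hx, zero_mul, ite_self]
    · have hR := (supp_coe x).rel hx
      rw [hφ k b (fun hk => hd (h.row hk hR)) hb (F.trans hR hdb), mul_ite, mul_one, mul_zero]
  · refine Finset.sum_congr rfl fun k _ => ?_
    by_cases hx : (x : Matrix I I ℂ) b k = 0
    · rw [hx, zero_mul, ite_self]
    · have hR := (supp_coe x).rel hx
      rw [hφ d k hd (h.row hb hR) (F.trans hdb hR), mul_ite, mul_one, mul_zero]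

theorem apply_lie_hom (m : G.algebra) {v : F.algebra} (hv : v ∈ ideal F B) :
    φ ⁅h.hom m, v⁆ = 0 := by
  refine h.eq_zero_on_ideal (φ := kirillovForm ℂ F.algebra φ (h.hom m)) ?_ hv
  intro d b hd hb hdb
  rw [kirillovForm_apply, h.apply_lie_single hφ _ hd hb hdb, coe_hom]
  by_cases hm : (m : Matrix J J ℂ) (π b) (π d) = 0
  · rw [Finset.sum_eq_zero, Finset.sum_eq_zero, sub_zero]
    · intro k _
      by_cases hk : π d = π k
      · rw [if_pos hk]
        by_cases hs : Same F B b k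
        · rw [pull_of_same _ hs, ← hk, hm]
        · exact pull_of_not_same _ hs
      · exact if_neg hk
    · intro k _
      by_cases hk : π k = π b
      · rw [if_pos hk]
        by_cases hs : Same F B k d
        · rw [pull_of_same _ hs, hk, hm]
        · exact pull_of_not_same _ hs
      · exact if_neg hk
  · have hbal := h.balance hd hb hdb ((supp_coe m).rel hm)
    by_cases hex : ∃ k, B k ∧ π k = π d
    · obtain ⟨k, hk, hkd⟩ := hex
      obtain ⟨k', hk', hkb⟩ := hbal.2 ⟨k, hk, hkd⟩
      rw [Finset.sum_eq_single k', Finset.sum_eq_single k, if_pos hkb, if_pos hkd.symm,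
        pull_of_same _ hk', pull_of_same _ (h.same_of_mem hb hk), hkb, hkd, sub_self]
      · intro l _ hl
        by_cases hl' : π d = π l
        · rw [if_pos hl']
          refine pull_of_not_same _ fun hs => hl ?_
          have := hs.symm.trans (h.same_of_mem hb hk)
          exact h.inj this.1 this.2 (hl'.symm.trans hkd.symm)
        · exact if_neg hl'
      · exact fun h' => (h' (Finset.mem_univ _)).elim
      · intro l _ hl
        by_cases hl' : π l = π b
        · rw [if_pos hl']
          refine pull_of_not_same _ fun hs => hl ?_
          have := hs.trans (Same.symm hk')
          exact h.inj this.1 this.2 (hl'.trans hkb.symm)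
        · exact if_neg hl'
      · exact fun h' => (h' (Finset.mem_univ _)).elim
    · rw [Finset.sum_eq_zero, Finset.sum_eq_zero, sub_zero]
      · intro k _
        by_cases hk : π d = π k
        · rw [if_pos hk]
          refine pull_of_not_same _ fun hs => hex ⟨k, hs.1.1 hb, hk.symm⟩
        · exact if_neg hk
      · intro k _
        by_cases hk : π k = π b
        · rw [if_pos hk]
          refine pull_of_not_same _ fun hs => hex (hbal.1 ⟨k, hs, hk⟩)
        · exact if_neg hk

/-- The entry of `v` at `(d, b)` is, up to sign, its bracket value with a single unit: `(b, k)` for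
a partner `k ∈ B` of `d`, or `(k, d)` for a partner `k ∉ B` of `b`, as `matched` provides. -/
theorem eq_zero_of_lie {v : F.algebra} (hv : v ∈ ideal F B) (h0 : ∀ x, φ ⁅v, x⁆ = 0) : v = 0 := by
  obtain ⟨A, hA, hvA⟩ := h.exists_sk hv
  suffices A = 0 by rw [hvA, this, map_zero]
  ext d b
  by_contra hne
  obtain ⟨hd, hb, hdb, hAv⟩ := hA d b hne
  rcases h.matched hd hb hdb with ⟨k, hk, hkd⟩ | ⟨k, hk, hkb, hkd⟩
  · have h1 := h0 (F.sk (single b k 1))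
    have hz : single b k 1 * (v : Matrix I I ℂ) = 0 := by
      apply mul_eq_zero_of_support
      intro i l j hi hl
      have hkl : k = l := by
        by_contra hkl
        rw [Matrix.single_apply, if_neg fun h' => hkl h'.2] at hi
        exact hi rfl
      subst hkl
      exact hl (hv _ _ (h.same_of_mem hk (h.row hk ((supp_coe v).rel hl))))
    rw [apply_lie_sk φ v (supp_single (h.full hb hk) 1), hz, map_zero, sub_zero, ext_mul_single,
      Finset.sum_eq_single d, hφ d k hd hk (F.trans hdb (h.full hb hk)), if_pos hkd.symm,
      mul_one] at h1
    · exact hne (hAv.trans h1)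
    · intro i _ hi
      by_cases hvi : (v : Matrix I I ℂ) i b = 0
      · rw [hvi, zero_mul]
      · have hib := (supp_coe v).rel hvi
        have hBi : ¬ B i := fun hBi => hvi (hv _ _ (h.same_of_mem hBi hb))
        rw [hφ i k hBi hk (F.trans hib (h.full hb hk)), if_neg, mul_zero]
        intro e
        have hs := h.same_of_above hBi hd hb hb hib hdb
        exact hi (h.inj hs.1 hs.2 (e.trans hkd))
    · exact fun h' => (h' (Finset.mem_univ _)).elim
  · have h1 := h0 (F.sk (single k d 1))
    have hz : (v : Matrix I I ℂ) * single k d 1 = 0 := by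
      apply mul_eq_zero_of_support
      intro i l j hl hi
      have hkl : k = l := by
        by_contra hkl
        rw [Matrix.single_apply, if_neg fun h' => hkl h'.1] at hi
        exact hi rfl
      subst hkl
      have hR := (supp_coe v).rel hl
      rcases h.cases_of_not_same hR fun hs => hl (hv _ _ hs) with c | c
      · exact hk c.2
      · exact h.not_mirror_of_rel hb (F.trans hR (F.trans hkd hdb)) c.1
    rw [apply_lie_sk φ v (supp_single hkd 1), hz, map_zero, zero_sub, neg_eq_zero, ext_single_mul,
      Finset.sum_eq_single b, hφ k b hk hb (F.trans hkd hdb), if_pos hkb, mul_one] at h1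
    · exact hne (hAv.trans h1)
    · intro j _ hj
      by_cases hvj : (v : Matrix I I ℂ) d j = 0
      · rw [hvj, zero_mul]
      · have hdj := (supp_coe v).rel hvj
        have hBj : B j := by
          rcases h.cases_of_not_same hdj fun hs => hvj (hv _ _ hs) with c | c
          · exact c.2
          · exact (h.not_mirror_of_rel hb hdb c.1).elim
        rw [hφ k j hk hBj (F.trans hkd hdj), if_neg, mul_zero]
        intro e
        have hs := h.same_of_mem hBj hb
        exact hj (h.inj hs.1 hs.2 (e.symm.trans hkb))
    · exact fun h' => (h' (Finset.mem_univ _)).elim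

variable {x : F.algebra} (hx : ∀ v ∈ ideal F B, φ ⁅x, v⁆ = 0)
include hx

theorem sum_eq_sum_of_perp {d b : I} (hd : ¬ B d) (hb : B b) (hdb : F.R d b) :
    (∑ k, if π k = π b then (x : Matrix I I ℂ) k d else 0) =
      ∑ k, if π d = π k then (x : Matrix I I ℂ) b k else 0 := by
  rw [← sub_eq_zero, ← h.apply_lie_single hφ x hd hb hdb]
  exact hx _ (h.sk_single_mem hd hb hdb)

theorem sum_left {d b i : I} (hd : ¬ B d) (hb : B b) (hdb : F.R d b) (hi : ¬ B i)
    (hib : π i = π b) :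
    (∑ k, if π k = π b then (x : Matrix I I ℂ) k d else 0) = (x : Matrix I I ℂ) i d := by
  rw [Finset.sum_eq_single i, if_pos hib]
  · intro k _ hki
    by_cases hk : π k = π b
    · rw [if_pos hk]
      by_contra hne
      have hR := (supp_coe x).rel hne
      have hBk : ¬ B k := fun hk => hd (h.row hk hR)
      have hs := h.same_of_above hBk hi hb hb (F.trans hR hdb) (h.rel_of_eq hi hb hib)
      exact hki (h.inj hs.1 hs.2 (hk.trans hib.symm))
    · exact if_neg hk
  · exact fun h' => (h' (Finset.mem_univ _)).elim

theorem sum_right {d b j : I} (hb : B b) (hj : B j) (hdj : π d = π j) :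
    (∑ k, if π d = π k then (x : Matrix I I ℂ) b k else 0) = (x : Matrix I I ℂ) b j := by
  rw [Finset.sum_eq_single j, if_pos hdj]
  · intro k _ hkj
    by_cases hk : π d = π k
    · rw [if_pos hk]
      by_contra hne
      have hs := h.same_of_mem (h.row hb ((supp_coe x).rel hne)) hj
      exact hkj (h.inj hs.1 hs.2 (hk.symm.trans hdj))
    · exact if_neg hk
  · exact fun h' => (h' (Finset.mem_univ _)).elim

/-- Orthogonality to the slot `(j', i)`: since both indices have partners on the other side of `B`,
each of the two sums has a single term. -/
theorem entry_eq_of_mem {i j i' j' : I} (hi : B i) (hj : B j) (hi' : ¬ B i') (hj' : ¬ B j')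
    (ei : π i = π i') (ej : π j = π j') :
    (x : Matrix I I ℂ) i j = (x : Matrix I I ℂ) i' j' := by
  have hR := F.trans (h.rel_of_eq hj' hj ej.symm) (h.full hj hi)
  have := h.sum_eq_sum_of_perp hφ hx hj' hi hR
  rw [h.sum_left hφ hx hj' hi hR hi' ei.symm, h.sum_right hφ hx hi hj ej.symm] at this
  exact this.symm

omit h hφ hx in
theorem entry_mirror (x : F.algebra) (i j : I) :
    (x : Matrix I I ℂ) i j = -(F.ε i * F.ε j * (x : Matrix I I ℂ) (F.σ j) (F.σ i)) := by
  have := congrFun (congrFun (adj_coe x) i) j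
  rw [adj_apply, neg_apply] at this
  rw [this, neg_neg]

theorem entry_eq {i j i' j' : I} (hs : Same F B i j) (hs' : Same F B i' j')
    (ei : π i = π i') (ej : π j = π j') :
    (x : Matrix I I ℂ) i j = (x : Matrix I I ℂ) i' j' := by
  by_cases h1 : B i
  · by_cases h2 : B i'
    · have t1 := h.same_of_mem h1 h2
      have t2 := hs.symm.trans (t1.trans hs')
      rw [h.inj t1.1 t1.2 ei, h.inj t2.1 t2.2 ej]
    · exact h.entry_eq_of_mem hφ hx h1 (hs.1.1 h1) h2 (fun h' => h2 (hs'.1.2 h')) ei ej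
  by_cases h2 : B i'
  · exact (h.entry_eq_of_mem hφ hx h2 (hs'.1.1 h2) h1 (fun h' => h1 (hs.1.2 h')) ei.symm
      ej.symm).symm
  have eε : F.ε i * F.ε j = F.ε i' * F.ε j' := by
    rw [← h.map_ε, ← h.map_ε, ei, ej, h.map_ε, h.map_ε]
  have ei' : π (F.σ i) = π (F.σ i') := by rw [h.map_σ, h.map_σ, ei]
  have ej' : π (F.σ j) = π (F.σ j') := by rw [h.map_σ, h.map_σ, ej]
  by_cases h3 : B (F.σ i)
  · by_cases h4 : B (F.σ i')
    · have t1 : Same F B i i' := same_σ_iff.1 (h.same_of_mem h3 h4)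
      have t2 := hs.symm.trans (t1.trans hs')
      rw [h.inj t1.1 t1.2 ei, h.inj t2.1 t2.2 ej]
    · rw [entry_mirror x i j, entry_mirror x i' j', eε, h.entry_eq_of_mem hφ hx (hs.2.1 h3) h3
        (fun h' => h4 (hs'.2.2 h')) h4 ej' ei']
  · by_cases h4 : B (F.σ i')
    · rw [entry_mirror x i j, entry_mirror x i' j', eε, h.entry_eq_of_mem hφ hx (hs'.2.1 h4) h4
        (fun h' => h3 (hs.2.2 h')) h3 ej'.symm ei'.symm]
    · have t1 : Same F B i i' := ⟨iff_of_false h1 h2, iff_of_false h3 h4⟩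
      have t2 := hs.symm.trans (t1.trans hs')
      rw [h.inj t1.1 t1.2 ei, h.inj t2.1 t2.2 ej]

theorem entry_eq_zero_aux {i j d b : I} (hs : Same F B i j) (hd : ¬ B d) (hb : B b)
    (hdb : F.R d b) (ei : π b = π i) (ej : π d = π j)
    (hc : (i = b ∧ ∀ k, ¬ B k → π k = π b → ¬ F.R k d) ∨ (j = d ∧ ∀ k, B k → π k ≠ π d)) :
    (x : Matrix I I ℂ) i j = 0 := by
  have hsum := h.sum_eq_sum_of_perp hφ hx hd hb hdb
  rcases hc with ⟨rfl, hk⟩ | ⟨rfl, hk⟩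
  · rw [h.sum_right hφ hx hb (hs.1.1 hb) ej, Finset.sum_eq_zero] at hsum
    · exact hsum.symm
    · intro k _
      by_cases hkb : π k = π i
      · rw [if_pos hkb]
        by_contra hne
        have hR := (supp_coe x).rel hne
        exact hk k (fun hBk => hd (h.row hBk hR)) hkb hR
      · exact if_neg hkb
  · rw [h.sum_left hφ hx hd hb hdb (fun h' => hd (hs.1.1 h')) ei.symm, Finset.sum_eq_zero] at hsum
    · exact hsum
    · intro k _
      by_cases hkb : π j = π k
      · rw [if_pos hkb]
        by_contra hne
        exact hk k (h.row hb ((supp_coe x).rel hne)) hkb.symm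
      · exact if_neg hkb

theorem entry_eq_zero {i j : I} (hs : Same F B i j) (hG : ¬ G.R (π i) (π j)) :
    (x : Matrix I I ℂ) i j = 0 := by
  by_cases hR : F.R i j
  · obtain ⟨d, b, hd, hb, hdb, ⟨ei, ej, hc⟩ | ⟨ei, ej, hc⟩⟩ := h.killed hs.1 hs.2 hR hG
    · exact h.entry_eq_zero_aux hφ hx hs hd hb hdb ei ej hc
    · rw [entry_mirror, h.entry_eq_zero_aux hφ hx (same_σ_iff'.2 hs) hd hb hdb ei ej hc, mul_zero,
        neg_zero]
  · exact supp_coe x _ _ hR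

/-- By `entry_eq` and `entry_eq_zero` the entries of `x` within parts depend only on the images of
their indices and vanish off the relation of `G`. They are thus pulled back from a matrix on `J`,
whose skewness follows from injectivity of the pullback; what remains of `x` lies in the ideal. -/
theorem exists_add_hom : ∃ v ∈ ideal F B, ∃ m, x = v + h.hom m := by
  classical
  let A : Matrix J J ℂ := of fun l l' =>
    if hl : G.R l l' then
      (x : Matrix I I ℂ) (h.exists_rel hl).choose (h.exists_rel hl).choose_spec.choose else 0
  have hAS : G.Supp A := fun l l' hl => dif_neg hl
  have hA : ∀ i j, Same F B i j → A (π i) (π j) = (x : Matrix I I ℂ) i j := by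
    intro i j hs
    by_cases hl : G.R (π i) (π j)
    · have hc := (h.exists_rel hl).choose_spec.choose_spec
      change dite _ _ _ = _
      rw [dif_pos hl]
      exact h.entry_eq hφ hx ⟨hc.1, hc.2.1⟩ hs hc.2.2.1 hc.2.2.2
    · rw [hAS _ _ hl, h.entry_eq_zero hφ hx hs hl]
  have hadj : G.adj A = -A := by
    rw [← sub_eq_zero, sub_neg_eq_add]
    refine h.pull_injective (hAS.adj.add hAS) ?_
    rw [map_add, ← h.adj_pull]
    ext i j
    rw [Matrix.add_apply, adj_apply, Matrix.zero_apply]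
    by_cases hs : Same F B i j
    · rw [pull_of_same _ hs, pull_of_same _ (same_σ_iff'.2 hs), hA _ _ hs,
        hA _ _ (same_σ_iff'.2 hs), entry_mirror x i j, add_neg_cancel]
    · rw [pull_of_not_same _ hs, pull_of_not_same _ fun h' => hs (same_σ_iff'.1 h'), mul_zero,
        add_zero]
  refine ⟨x - h.hom ⟨A, hadj, hAS⟩, ?_, ⟨A, hadj, hAS⟩, by abel⟩
  intro i j hs
  change (x : Matrix I I ℂ) i j - pull F B π A i j = 0
  rw [pull_of_same _ hs, hA _ _ hs, sub_self]

end Normal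

end Folding

end SignedPreorder

end Folding

/-! ### Generic normalisation on the ideal and invariance of the index under foldings -/

section FoldingIndex

open Matrix Module

/-- All but finitely many translates of a square matrix by scalars are invertible. -/
theorem finite_det_add_smul_one_eq_zero {I : Type*} [Fintype I] [DecidableEq I]
    (A : Matrix I I ℂ) : {t : ℂ | (A + t • (1 : Matrix I I ℂ)).det = 0}.Finite := by
  have h0 : (-A).charpoly ≠ 0 := (charpoly_monic _).ne_zero
  refine ((-A).charpoly.rootSet_finite ℂ).subset fun t ht => ?_
  rw [Polynomial.mem_rootSet]
  refine ⟨h0, ?_⟩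
  rw [Polynomial.coe_aeval_eq_eval, eval_charpoly]
  have ht : (A + t • (1 : Matrix I I ℂ)).det = 0 := ht
  rw [← ht]
  congr 1
  rw [sub_neg_eq_add, add_comm, scalar_apply, smul_one_eq_diagonal]

namespace SignedPreorder.Folding

variable {I J : Type*} [Fintype I] [DecidableEq I] [Fintype J] [DecidableEq J]
  {F : SignedPreorder I} {G : SignedPreorder J} {B : I → Prop} {π : I → J}
  (h : Folding F G B π)
include h

-- The coefficients of the form on the ideal make up a matrix `ξt = ξ + t ξ₀` with rows in `B`, on
-- which the conjugation given by `p` and `q = p⁻¹` acts as `q ξt p`. The invertible block `N` on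
-- `B` normalises the columns that have a partner in `B`: `N⁻¹ ξt = ξ₀ + X` with `X ξ₀ᵀ = 0`. By
-- `matched` the nonzero rows of `X` have partners outside `B`, and a unipotent factor outside `B`
-- clears `X`.
open scoped Classical in
theorem exists_conj_normal (φ : Dual ℂ F.algebra) (t : ℂ) (ξ ξ₀ : Matrix I I ℂ)
    (hξ : ∀ i j, ξ i j = if B i ∧ ¬ B j then ext φ (single j i 1) else 0)
    (hξ₀ : ∀ i j, ξ₀ i j = if B i ∧ ¬ B j ∧ π i = π j then 1 else 0)
    (ht : (ξ * ξ₀ᵀ + t • (1 : Matrix I I ℂ)).det ≠ 0) :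
    ∃ e : F.algebra ≃ₗ⁅ℂ⁆ F.algebra, ∀ d b, ¬ B d → B b → F.R d b →
      (φ + t • F.formOf (coeff B π)) (e (F.sk (single d b 1))) = if π d = π b then 1 else 0 := by
  set N := ξ * ξ₀ᵀ + t • (1 : Matrix I I ℂ) with hN
  obtain ⟨Ni, hNi, hNi'⟩ : ∃ Ni, N * Ni = 1 ∧ Ni * N = 1 :=
    ⟨N⁻¹, mul_nonsing_inv _ (isUnit_iff_ne_zero.2 ht), nonsing_inv_mul _ (isUnit_iff_ne_zero.2 ht)⟩
  set ξt := ξ + t • ξ₀ with hξt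
  set X := Ni * ξt - ξ₀ with hX
  let e : Matrix I I ℂ := diagonal fun i => if B i then 1 else 0
  have left : ∀ A : Matrix I I ℂ, (∀ i j, A i j ≠ 0 → B i) → e * A = A := by
    intro A hA
    ext i j
    rw [diagonal_mul]
    by_cases hi : B i
    · rw [if_pos hi, one_mul]
    · rw [if_neg hi, zero_mul]
      by_contra hne
      exact hi (hA i j fun h' => hne h'.symm)
  have right : ∀ A : Matrix I I ℂ, (∀ i j, A i j ≠ 0 → ¬ B j) → A * e = 0 := by
    intro A hA
    ext i j
    rw [mul_diagonal, Matrix.zero_apply]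
    by_cases hj : B j
    · rw [if_pos hj, mul_one]
      by_contra hne
      exact hA i j hne hj
    · rw [if_neg hj, mul_zero]
  have sξ : ∀ i j, ξ i j ≠ 0 → B i ∧ ¬ B j ∧ F.R j i := by
    intro i j hne
    rw [hξ] at hne
    by_cases hc : B i ∧ ¬ B j
    · rw [if_pos hc] at hne
      refine ⟨hc.1, hc.2, ?_⟩
      by_contra hR
      exact hne (ext_single_of_not_rel φ hR)
    · rw [if_neg hc] at hne
      exact (hne rfl).elim
  have sξ₀' : ∀ i j, ξ₀ i j ≠ 0 → B i ∧ ¬ B j ∧ π i = π j := by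
    intro i j hne
    rw [hξ₀] at hne
    by_contra hc
    rw [if_neg hc] at hne
    exact hne rfl
  have sξ₀ : ∀ i j, ξ₀ i j ≠ 0 → B i ∧ ¬ B j ∧ F.R j i := by
    intro i j hne
    obtain ⟨h1, h2, h3⟩ := sξ₀' i j hne
    exact ⟨h1, h2, h.rel_of_eq h2 h1 h3.symm⟩
  have sξt : ∀ i j, ξt i j ≠ 0 → B i ∧ ¬ B j ∧ F.R j i := by
    intro i j hne
    by_cases h1 : ξ i j = 0
    · refine sξ₀ i j fun h2 => hne ?_
      rw [hξt, Matrix.add_apply, Matrix.smul_apply, h1, h2, smul_zero, add_zero]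
    · exact sξ i j h1
  have ee : e * e = e := left e fun i j hne => by
    by_contra hi
    refine hne ?_
    by_cases hij : i = j
    · subst hij
      exact (diagonal_apply_eq _ _).trans (if_neg hi)
    · exact diagonal_apply_ne _ hij
  have eT : eᵀ = e := diagonal_transpose _
  have e1 : e * ξ = ξ := left _ fun i j hne => (sξ i j hne).1
  have e2 : e * ξ₀ = ξ₀ := left _ fun i j hne => (sξ₀ i j hne).1
  have e3 : e * ξt = ξt := left _ fun i j hne => (sξt i j hne).1
  have e4 : ξ₀ * e = 0 := right _ fun i j hne => (sξ₀ i j hne).2.1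
  have e5 : ξt * e = 0 := right _ fun i j hne => (sξt i j hne).2.1
  have e6 : ξ₀ᵀ * e = ξ₀ᵀ := by
    have := congrArg transpose e2
    rwa [transpose_mul, eT] at this
  have e7 : e * ξ₀ᵀ = 0 := by
    have := congrArg transpose e4
    rwa [transpose_mul, eT, transpose_zero] at this
  have eN : e * N = N * e := by
    rw [hN, mul_add, add_mul, ← mul_assoc, e1, mul_assoc ξ, e6, Matrix.mul_smul, Matrix.smul_mul,
      mul_one, one_mul]
  have eNi : e * Ni = Ni * e := by
    calc e * Ni = Ni * (N * e) * Ni := by rw [← mul_assoc Ni N, hNi', one_mul]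
      _ = Ni * e * (N * Ni) := by rw [← eN]; noncomm_ring
      _ = Ni * e := by rw [hNi, mul_one]
  have Xe : X * e = 0 := by rw [hX, sub_mul, mul_assoc, e5, e4, mul_zero, sub_zero]
  have eX : e * X = X := by rw [hX, mul_sub, ← mul_assoc, eNi, mul_assoc, e3, e2]
  have above : ∀ {d d' b b' : I}, ¬ B d → ¬ B d' → B b → B b' → F.R d b → F.R d' b' →
      π d = π d' → d = d' := by
    intro d d' b b' hd hd' hb hb' hdb hdb' hπ
    have hs := h.same_of_above hd hd' hb hb' hdb hdb'
    exact h.inj hs.1 hs.2 hπ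
  -- The matrix `ξ₀` is a partial permutation matrix, because `π` is injective on `B` and on the
  -- elements above `B`.
  have ξ₀3 : ξ₀ᵀ * ξ₀ * ξ₀ᵀ = ξ₀ᵀ := by
    have : ∀ i j, (ξ₀ᵀ * ξ₀) i j ≠ 0 → i = j := by
      intro i j hne
      rw [Matrix.mul_apply] at hne
      obtain ⟨k, -, hk⟩ := Finset.exists_ne_zero_of_sum_ne_zero hne
      have h1 := sξ₀ _ _ (left_ne_zero_of_mul hk)
      have h2 := sξ₀ _ _ (right_ne_zero_of_mul hk)
      exact above h1.2.1 h2.2.1 h1.1 h2.1 h1.2.2 h2.2.2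
        ((sξ₀' _ _ (left_ne_zero_of_mul hk)).2.2.symm.trans
          (sξ₀' _ _ (right_ne_zero_of_mul hk)).2.2)
    ext i j
    rw [Matrix.mul_apply, Finset.sum_eq_single i]
    · by_cases hji : ξ₀ j i = 0
      · rw [transpose_apply, hji, mul_zero]
      · obtain ⟨h1, h2, h3⟩ := sξ₀' _ _ hji
        rw [Matrix.mul_apply, Finset.sum_eq_single j]
        · rw [transpose_apply, hξ₀, if_pos ⟨h1, h2, h3⟩]
          norm_num
        · intro k _ hk
          by_contra hne
          obtain ⟨h4, h5, h6⟩ := sξ₀' _ _ (right_ne_zero_of_mul hne)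
          have hs := h.same_of_mem h4 h1
          exact hk (h.inj hs.1 hs.2 (h6.trans h3.symm))
        · exact fun h' => (h' (Finset.mem_univ _)).elim
    · intro k _ hk
      by_contra hne
      exact hk (this i k (left_ne_zero_of_mul hne)).symm
    · exact fun h' => (h' (Finset.mem_univ _)).elim
  have Xξ : X * ξ₀ᵀ = 0 := by
    have h1 : ξt * ξ₀ᵀ = N * (ξ₀ * ξ₀ᵀ) := by
      rw [hξt, hN, add_mul, add_mul, mul_assoc ξ, ← mul_assoc ξ₀ᵀ, ξ₀3, Matrix.smul_mul,
        Matrix.smul_mul, one_mul]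
    rw [hX, sub_mul, mul_assoc, h1, ← mul_assoc, hNi', one_mul, sub_self]
  have sX : ∀ b d, X b d ≠ 0 → B b ∧ ¬ B d ∧ F.R d b ∧ ∀ k, B k → π k ≠ π d := by
    intro b d hne
    have hb : B b := by
      by_contra hb
      rw [← eX, diagonal_mul, if_neg hb, zero_mul] at hne
      exact hne rfl
    have hd : ¬ B d := by
      intro hd
      have := congrFun (congrFun Xe b) d
      rw [mul_diagonal, if_pos hd, mul_one] at this
      exact hne this
    have hR : F.R d b := by
      by_contra hR
      have hz : ∀ k, B k → ¬ F.R d k := fun k hk hdk => hR (F.trans hdk (h.full hk hb))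
      refine hne ?_
      rw [hX, Matrix.sub_apply, Matrix.mul_apply, Finset.sum_eq_zero, zero_sub, neg_eq_zero]
      · by_contra h'
        exact hR (sξ₀ _ _ h').2.2
      · intro k _
        by_contra h'
        have := sξt _ _ (right_ne_zero_of_mul h')
        exact hz k this.1 this.2.2
    refine ⟨hb, hd, hR, fun k hk hkd => hne ?_⟩
    have := congrFun (congrFun Xξ b) k
    rw [Matrix.mul_apply, Matrix.zero_apply, Finset.sum_eq_single d] at this
    · rwa [transpose_apply, hξ₀, if_pos ⟨hk, hd, hkd⟩, mul_one] at this
    · intro j _ hj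
      by_contra hne'
      have h1 := sξ₀ _ _ (right_ne_zero_of_mul hne')
      have h2 := sξ₀' _ _ (right_ne_zero_of_mul hne')
      exact hj (above h1.2.1 hd h1.1 hb h1.2.2 hR (h2.2.2.symm.trans hkd))
    · exact fun h' => (h' (Finset.mem_univ _)).elim
  have match' : ∀ b d, X b d ≠ 0 → ∃ k, ¬ B k ∧ π k = π b ∧ F.R k d := by
    intro b d hne
    obtain ⟨h1, h2, h3, h4⟩ := sX b d hne
    rcases h.matched h2 h1 h3 with ⟨k, hk, hkd⟩ | hk
    · exact (h4 k hk hkd).elim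
    · exact hk
  have ξξX : ξ₀ * ξ₀ᵀ * X = X := by
    ext b d
    rw [Matrix.mul_apply, Finset.sum_eq_single b]
    · by_cases hbd : X b d = 0
      · rw [hbd, mul_zero]
      · obtain ⟨k, hk, hkb, hkd⟩ := match' b d hbd
        have hb := (sX b d hbd).1
        rw [Matrix.mul_apply, Finset.sum_eq_single k]
        · rw [transpose_apply, hξ₀, if_pos ⟨hb, hk, hkb.symm⟩, one_mul, one_mul]
        · intro l _ hl
          by_contra hne
          have h1 := sξ₀ _ _ (left_ne_zero_of_mul hne)
          have h2 := sξ₀' _ _ (left_ne_zero_of_mul hne)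
          exact hl (above h1.2.1 hk h1.1 hb h1.2.2 (h.rel_of_eq hk hb hkb)
            (h2.2.2.symm.trans hkb.symm))
        · exact fun h' => (h' (Finset.mem_univ _)).elim
    · intro k _ hk
      by_contra hne
      have hne := left_ne_zero_of_mul hne
      rw [Matrix.mul_apply] at hne
      obtain ⟨l, -, hl⟩ := Finset.exists_ne_zero_of_sum_ne_zero hne
      have h1 := sξ₀' _ _ (left_ne_zero_of_mul hl)
      have h2 := sξ₀' _ _ (right_ne_zero_of_mul hl)
      have hs := h.same_of_mem h2.1 h1.1
      exact hk (h.inj hs.1 hs.2 (h2.2.2.trans h1.2.2.symm))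
    · exact fun h' => (h' (Finset.mem_univ _)).elim
  -- From `X ξ₀ᵀ = 0` one gets `u² = 0`, and with `ξ₀ ξ₀ᵀ X = X` also `(ξ₀ + X)(1 + u) = ξ₀`.
  set u := -(ξ₀ᵀ * X) with hu
  have ue : u * e = 0 := by rw [hu, neg_mul, mul_assoc, Xe, mul_zero, neg_zero]
  have eu : e * u = 0 := by rw [hu, mul_neg, ← mul_assoc, e7, zero_mul, neg_zero]
  have uu : u * u = 0 := by
    rw [hu, neg_mul_neg, mul_assoc, ← mul_assoc X, Xξ, zero_mul, mul_zero]
  have su : ∀ k d, u k d ≠ 0 → F.R k d ∧ ∃ b, B b ∧ F.R k b ∧ F.R d b := by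
    intro k d hne
    rw [hu, neg_apply, neg_ne_zero, Matrix.mul_apply] at hne
    obtain ⟨b, -, hb⟩ := Finset.exists_ne_zero_of_sum_ne_zero hne
    have h1 := sξ₀ _ _ (left_ne_zero_of_mul hb)
    have h1' := sξ₀' _ _ (left_ne_zero_of_mul hb)
    have h2 := sX _ _ (right_ne_zero_of_mul hb)
    obtain ⟨k', hk', hkb, hkd⟩ := match' b d (right_ne_zero_of_mul hb)
    have hkk : k' = k := above hk' h1.2.1 h1.1 h1.1 (h.rel_of_eq hk' h1.1 hkb) h1.2.2
      (hkb.trans h1'.2.2)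
    subst hkk
    exact ⟨hkd, b, h1.1, h1.2.2, h2.2.2.1⟩
  have block : ∀ A : Matrix I I ℂ, e * A = A * e → ∀ i j, (A * e) i j ≠ 0 → B i ∧ B j := by
    intro A hA i j hne
    constructor
    · by_contra hi
      rw [← hA, diagonal_mul, if_neg hi, zero_mul] at hne
      exact hne rfl
    · by_contra hj
      rw [mul_diagonal, if_neg hj, mul_zero] at hne
      exact hne rfl
  let p : Matrix I I ℂ := 1 + ((N - 1) * e + u)
  let q : Matrix I I ℂ := 1 + ((Ni - 1) * e - u)
  have pq : p * q = 1 := by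
    calc p * q = 1 + (N * (e * Ni) * e - e * Ni * e - N * (e * e) + e * e) + (N * e - e)
          + (Ni * e - e) - N * (e * u) + e * u + (u * (Ni * e) - u * e) - u * u := by
          simp only [p, q]; noncomm_ring
      _ = 1 := by
          rw [← eNi, ← mul_assoc u, ue, zero_mul, eu, uu, eNi, ← mul_assoc N, hNi, one_mul,
            mul_assoc Ni, ee]
          noncomm_ring
  have hW : ∀ i, (∃ b, B b ∧ F.R i b) → ¬ ∃ b, B b ∧ F.R (F.σ i) b := by
    rintro i ⟨b, hb, hib⟩ ⟨b', hb', hib'⟩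
    have := F.R_σ hib'
    rw [F.σ_σ] at this
    exact h.iso hb' hb (F.trans this hib)
  have hpsupp : ∀ i j, ((N - 1) * e + u) i j ≠ 0 →
      F.R i j ∧ (∃ b, B b ∧ F.R i b) ∧ ∃ b, B b ∧ F.R j b := by
    intro i j hne
    by_cases hu0 : u i j = 0
    · rw [Matrix.add_apply, hu0, add_zero] at hne
      have hb := block (N - 1) (by rw [mul_sub, sub_mul, eN, mul_one, one_mul]) i j hne
      exact ⟨h.full hb.1 hb.2, ⟨i, hb.1, F.refl i⟩, j, hb.2, F.refl j⟩
    · obtain ⟨h1, b, hb, h2, h3⟩ := su i j hu0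
      exact ⟨h1, ⟨b, hb, h2⟩, b, hb, h3⟩
  have hqsupp : ∀ i j, ((Ni - 1) * e - u) i j ≠ 0 →
      F.R i j ∧ (∃ b, B b ∧ F.R i b) ∧ ∃ b, B b ∧ F.R j b := by
    intro i j hne
    by_cases hu0 : u i j = 0
    · rw [Matrix.sub_apply, hu0, sub_zero] at hne
      have hb := block (Ni - 1) (by rw [mul_sub, sub_mul, eNi, mul_one, one_mul]) i j hne
      exact ⟨h.full hb.1 hb.2, ⟨i, hb.1, F.refl i⟩, j, hb.2, F.refl j⟩
    · obtain ⟨h1, b, hb, h2, h3⟩ := su i j hu0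
      exact ⟨h1, ⟨b, hb, h2⟩, b, hb, h3⟩
  have supp_of : ∀ A : Matrix I I ℂ, (∀ i j, A i j ≠ 0 → F.R i j) → F.Supp A := by
    intro A hA i j hR
    by_contra hne
    exact hR (hA i j hne)
  have hp : F.Supp p := supp_one.add (supp_of _ fun i j hne => (hpsupp i j hne).1)
  have hq : F.Supp q := supp_one.add (supp_of _ fun i j hne => (hqsupp i j hne).1)
  obtain ⟨ψ, hψ⟩ := exists_conj (F := F) (fun i => ∃ b, B b ∧ F.R i b) hW p q pq hp hq
    (fun i j hne => (hpsupp i j (by simpa only [p, add_sub_cancel_left] using hne)).2)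
    (fun i j hne => (hqsupp i j (by simpa only [q, add_sub_cancel_left] using hne)).2)
  refine ⟨ψ, fun d b hd hb hdb => ?_⟩
  have hsingle : ∀ i j, (single d b 1 : Matrix I I ℂ) i j ≠ 0 → d = i ∧ b = j := by
    intro i j hne
    by_contra hc
    rw [Matrix.single_apply, if_neg hc] at hne
    exact hne rfl
  rw [(hψ (φ + t • F.formOf (coeff B π)) (single d b 1) (supp_single hdb 1)
    (fun i j hne => (hsingle i j hne).1 ▸ ⟨b, hb, hdb⟩)).1
    (fun i j hne => (hsingle i j hne).2 ▸ ⟨b, hb, F.refl b⟩), ext_eq_sum]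
  have hfinal : q * ξt * p = ξ₀ := by
    have h1 : q * ξt = ξ₀ + X := by
      calc q * ξt = ξt + (Ni * (e * ξt) - e * ξt) - u * ξt := by simp only [q]; noncomm_ring
        _ = Ni * ξt - u * (e * ξt) := by rw [e3]; abel
        _ = ξ₀ + X := by rw [← mul_assoc u, ue, hX]; noncomm_ring
    rw [h1]
    have h2 : (ξ₀ + X) * e = 0 := by rw [add_mul, e4, Xe, add_zero]
    calc (ξ₀ + X) * p = ξ₀ + X + (ξ₀ + X) * ((N - 1) * e) + (ξ₀ + X) * u := by
          simp only [p]; noncomm_ring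
      _ = ξ₀ + X + (ξ₀ + X) * e * (N - 1) - (ξ₀ * ξ₀ᵀ * X + X * ξ₀ᵀ * X) := by
          rw [sub_mul, ← eN, one_mul, hu]; noncomm_ring
      _ = ξ₀ := by rw [h2, ξξX, Xξ]; noncomm_ring
  have hval : (if π d = π b then (1 : ℂ) else 0) = ξ₀ b d := by
    rw [hξ₀]
    by_cases hπ : π d = π b
    · rw [if_pos hπ, if_pos ⟨hb, hd, hπ.symm⟩]
    · rw [if_neg hπ, if_neg fun h' => hπ h'.2.2.symm]
  have hcoef : ∀ k l, ¬ B k → B l → F.R k l →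
      ext (φ + t • F.formOf (coeff B π)) (single k l 1) = ξt l k := by
    intro k l hk hl hR
    rw [hξt, Matrix.add_apply, Matrix.smul_apply, hξ, hξ₀, if_pos ⟨hl, hk⟩, smul_eq_mul]
    have : ext (φ + t • F.formOf (coeff B π)) (single k l 1) =
        ext φ (single k l 1) + t * ext (F.formOf (coeff B π)) (single k l 1) := rfl
    rw [this, h.ext_form_single hk hl hR]
    congr 2
    by_cases hπ : π k = π l
    · rw [if_pos hπ, if_pos ⟨hl, hk, hπ.symm⟩]
    · rw [if_neg hπ, if_neg fun h' => hπ h'.2.2.symm]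
  rw [hval, ← hfinal, Matrix.mul_apply]
  refine Finset.sum_congr rfl fun k _ => ?_
  rw [Matrix.mul_apply, Finset.sum_mul]
  refine Finset.sum_congr rfl fun l _ => ?_
  have hent : (p * single d b (1 : ℂ) * q : Matrix I I ℂ) k l = p k d * q b l := by
    rw [Matrix.mul_apply, Finset.sum_eq_single b]
    · rw [mul_single_apply_same, mul_one]
    · intro j _ hj
      rw [mul_single_apply_of_ne _ _ _ _ _ hj, zero_mul]
    · exact fun h' => (h' (Finset.mem_univ _)).elim
  rw [hent]
  by_cases hpk : p k d = 0
  · rw [hpk, mul_zero, zero_mul, zero_mul]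
  by_cases hql : q b l = 0
  · rw [hql, mul_zero, zero_mul, zero_mul, zero_mul]
  have hkd := hp.rel hpk
  have hbl := hq.rel hql
  rw [hcoef k l (fun hk => hd (h.row hk hkd)) (h.row hb hbl) (F.trans hkd (F.trans hdb hbl))]
  ring

/-- Foldings preserve the index. -/
theorem lieIndex_eq : lieIndex ℂ F.algebra = lieIndex ℂ G.algebra := by
  classical
  -- No nondegenerate summand is needed here. The bad parameters are roots of a characteristic
  -- polynomial, those where `ξ ξ₀ᵀ + t` is singular.
  refine lieIndex_eq_of_reduction h.hom (ideal F B) ⊥ (F.formOf (coeff B π)) ?_ h.form_hom ?_ ?_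
  · intro m hm
    rw [sup_bot_eq] at hm
    exact h.hom_mem_ideal hm
  · intro φ hφ
    have hφ' : ∀ d b, ¬ B d → B b → F.R d b →
        ext φ (single d b 1) = if π d = π b then 1 else 0 := by
      intro d b hd hb hdb
      rw [← h.ext_form_single hd hb hdb, ext_apply, ext_apply]
      exact hφ _ (Submodule.mem_sup_left (h.sk_single_mem hd hb hdb))
    refine ⟨?_, ?_, fun m v hv => h.apply_lie_hom hφ' m hv, ?_, ?_,
      fun v hv => h.eq_zero_of_lie hφ' hv⟩
    · intro x hx
      obtain ⟨v, hv, m, hm⟩ := h.exists_add_hom hφ' hx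
      exact ⟨v, hv, 0, Submodule.zero_mem _, m, by rw [add_zero, hm]⟩
    · intro x hx v _
      rw [(Submodule.mem_bot ℂ).1 hx, zero_lie, map_zero]
    · intro x hx m
      rw [(Submodule.mem_bot ℂ).1 hx, zero_lie, map_zero]
    · intro x hx _
      exact (Submodule.mem_bot ℂ).1 hx
  · intro φ
    let ξ : Matrix I I ℂ := of fun i j => if B i ∧ ¬ B j then ext φ (single j i 1) else 0
    let ξ₀ : Matrix I I ℂ := of fun i j => if B i ∧ ¬ B j ∧ π i = π j then 1 else 0
    refine (finite_det_add_smul_one_eq_zero (ξ * ξ₀ᵀ)).subset fun t ht => ?_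
    by_contra hdet
    obtain ⟨e, he⟩ := h.exists_conj_normal φ t ξ ξ₀ (fun _ _ => rfl) (fun _ _ => rfl) hdet
    refine ht ⟨e, fun w hw => ?_⟩
    rw [sup_bot_eq] at hw
    rw [← sub_eq_zero]
    refine h.eq_zero_on_ideal
      (φ := (φ + t • F.formOf (coeff B π)) ∘ₗ (e : F.algebra →ₗ[ℂ] F.algebra) -
        F.formOf (coeff B π)) ?_ hw
    intro d b hd hb hdb
    rw [LinearMap.sub_apply, sub_eq_zero]
    refine Eq.trans ?_ (h.ext_form_single hd hb hdb).symm
    exact he d b hd hb hdb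

end SignedPreorder.Folding

end FoldingIndex

/-! ### Adding a class and its mirror image; splitting off `gl_d` -/

section Extensions

open Matrix Module

namespace SignedPreorder

section

variable {J : Type*} {d : ℕ}

/-- The position of an element of a sum: initial, in the middle, or final. -/
def level : Fin d ⊕ J ⊕ Fin d → ℕ
  | .inl _ => 0
  | .inr (.inl _) => 1
  | .inr (.inr _) => 2

@[simp]
theorem level_inl (b : Fin d) : level (.inl b : Fin d ⊕ J ⊕ Fin d) = 0 := rfl

@[simp]
theorem level_mid (j : J) : level (.inr (.inl j) : Fin d ⊕ J ⊕ Fin d) = 1 := rfl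

@[simp]
theorem level_last (b : Fin d) : level (.inr (.inr b) : Fin d ⊕ J ⊕ Fin d) = 2 := rfl

theorem level_le (i : Fin d ⊕ J ⊕ Fin d) : level i ≤ 2 := by
  rcases i with i | i | i <;> simp

/-- The signed preorder obtained by adding an initial class and its mirror image, which are
comparable with the rest if `c` holds. -/
def extension (d : ℕ) (c : Prop) (G : SignedPreorder J) (hG : ∀ j, G.ε (G.σ j) = -G.ε j) :
    SignedPreorder (Fin d ⊕ J ⊕ Fin d) where
  σ
    | .inl b => .inr (.inr b)
    | .inr (.inl j) => .inr (.inl (G.σ j))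
    | .inr (.inr b) => .inl b
  ε
    | .inl _ => 1
    | .inr (.inl j) => G.ε j
    | .inr (.inr _) => -1
  R
    | .inl _, .inl _ => True
    | .inl _, .inr _ => c
    | .inr (.inl _), .inl _ => False
    | .inr (.inl i), .inr (.inl j) => G.R i j
    | .inr (.inl _), .inr (.inr _) => c
    | .inr (.inr _), .inr (.inr _) => True
    | .inr (.inr _), _ => False
  σ_σ := by rintro (a | a | a) <;> simp [G.σ_σ]
  ε_mul_self := by rintro (a | a | a) <;> simp [G.ε_mul_self]
  ε_σ := by rintro (a | a | a) (b | b | b) <;> simp [hG]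
  refl := by rintro (a | a | a) <;> simp [G.refl]
  trans := by
    rintro (i | i | i) (j | j | j) (k | k | k) <;> simp
    · exact fun h _ => h
    · exact G.trans
  R_σ := by
    rintro (i | i | i) (j | j | j) <;> simp
    exact G.R_σ

/-- The block diagonal matrix with given blocks and the mirror image of the first one. -/
def blocks (Y : Matrix (Fin d) (Fin d) ℂ) (x : Matrix J J ℂ) :
    Matrix (Fin d ⊕ J ⊕ Fin d) (Fin d ⊕ J ⊕ Fin d) ℂ :=
  of fun
    | .inl i, .inl j => Y i j
    | .inr (.inl i), .inr (.inl j) => x i j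
    -- The involution pairs the two outer classes without reversing the index, so the mirror image
    -- of `Y` is `-Yᵀ`.
    | .inr (.inr i), .inr (.inr j) => -Y j i
    | _, _ => 0

theorem blocks_eq_zero (Y : Matrix (Fin d) (Fin d) ℂ) (x : Matrix J J ℂ)
    {i j : Fin d ⊕ J ⊕ Fin d} (h : level i ≠ level j) : blocks Y x i j = 0 := by
  rcases i with i | i | i <;> rcases j with j | j | j <;> first | rfl | exact (h rfl).elim

theorem blocks_lie [Fintype J] (Y Y' : Matrix (Fin d) (Fin d) ℂ) (x x' : Matrix J J ℂ) :
    blocks (Y * Y' - Y' * Y) (x * x' - x' * x) =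
      blocks Y x * blocks Y' x' - blocks Y' x' * blocks Y x := by
  ext i j
  rcases i with i | i | i <;> rcases j with j | j | j <;>
    simp [blocks, Matrix.mul_apply, Fintype.sum_sum_type, mul_comm]

variable (c : Prop) (G : SignedPreorder J) (hG : ∀ j, G.ε (G.σ j) = -G.ε j)

theorem adj_blocks (Y : Matrix (Fin d) (Fin d) ℂ) {x : Matrix J J ℂ} (hx : G.adj x = -x) :
    (extension d c G hG).adj (blocks Y x) = -blocks Y x := by
  ext i j
  rw [adj_apply]
  rcases i with i | i | i <;> rcases j with j | j | j <;> simp [blocks, extension]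
  have := congrFun (congrFun hx i) j
  rwa [adj_apply] at this

theorem supp_blocks (Y : Matrix (Fin d) (Fin d) ℂ) {x : Matrix J J ℂ} (hx : G.Supp x) :
    (extension d c G hG).Supp (blocks Y x) := by
  intro i j
  rcases i with i | i | i <;> rcases j with j | j | j <;> simp [blocks, extension]
  exact hx i j

variable [Fintype J] [DecidableEq J]

/-- The subalgebra of block diagonal matrices, the first block of which lies in `L`. -/
def blockHom (L : LieSubalgebra ℂ (Matrix (Fin d) (Fin d) ℂ)) :
    L × G.algebra →ₗ⁅ℂ⁆ (extension d c G hG).algebra where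
  toFun z := ⟨blocks z.1 z.2, adj_blocks c G hG _ (adj_coe z.2),
    supp_blocks c G hG _ (supp_coe z.2)⟩
  map_add' z w := by
    apply Subtype.ext
    ext i j
    change blocks (z.1 + w.1 : Matrix _ _ ℂ) (z.2 + w.2 : Matrix J J ℂ) i j =
      blocks (z.1 : Matrix _ _ ℂ) (z.2 : Matrix J J ℂ) i j + blocks w.1 w.2 i j
    rcases i with i | i | i <;> rcases j with j | j | j <;> simp [blocks]
    ring
  map_smul' a z := by
    apply Subtype.ext
    ext i j
    change blocks (a • (z.1 : Matrix (Fin d) (Fin d) ℂ)) (a • (z.2 : Matrix J J ℂ)) i j =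
      a * blocks (z.1 : Matrix _ _ ℂ) (z.2 : Matrix J J ℂ) i j
    rcases i with i | i | i <;> rcases j with j | j | j <;> simp [blocks]
  map_lie' {z w} := Subtype.ext (blocks_lie _ _ _ _)

theorem coe_blockHom (L : LieSubalgebra ℂ (Matrix (Fin d) (Fin d) ℂ)) (z : L × G.algebra) :
    (blockHom c G hG L z : Matrix (Fin d ⊕ J ⊕ Fin d) (Fin d ⊕ J ⊕ Fin d) ℂ) =
      blocks z.1 z.2 := rfl

theorem eq_zero_of_blocks {L : LieSubalgebra ℂ (Matrix (Fin d) (Fin d) ℂ)} {z : L × G.algebra}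
    (h : ∀ i j : Fin d ⊕ J ⊕ Fin d, level i = level j → blocks (z.1 : Matrix _ _ ℂ)
      (z.2 : Matrix J J ℂ) i j = 0) : z = 0 := by
  refine Prod.ext (Subtype.ext ?_) (Subtype.ext ?_)
  · ext i j
    exact h (.inl i) (.inl j) rfl
  · ext i j
    exact h (.inr (.inl i)) (.inr (.inl j)) rfl

theorem middle_mem (A : (extension d c G hG).algebra) :
    (A : Matrix (Fin d ⊕ J ⊕ Fin d) (Fin d ⊕ J ⊕ Fin d) ℂ).submatrix
      (fun j => .inr (.inl j)) (fun j => .inr (.inl j)) ∈ G.algebra := by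
  refine ⟨?_, fun i j hR => supp_coe A (.inr (.inl i)) (.inr (.inl j)) hR⟩
  ext i j
  exact congrFun (congrFun (adj_coe A) (.inr (.inl i))) (.inr (.inl j))

theorem last_apply (A : (extension d c G hG).algebra) (b b' : Fin d) :
    (A : Matrix (Fin d ⊕ J ⊕ Fin d) (Fin d ⊕ J ⊕ Fin d) ℂ) (.inr (.inr b)) (.inr (.inr b')) =
      -(A : Matrix (Fin d ⊕ J ⊕ Fin d) (Fin d ⊕ J ⊕ Fin d) ℂ) (.inl b') (.inl b) := by
  have := congrFun (congrFun (adj_coe A) (.inr (.inr b))) (.inr (.inr b'))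
  rw [adj_apply, neg_apply] at this
  rw [← neg_eq_iff_eq_neg, ← this]
  simp [extension]

/-- The index of an extension by an incomparable class. -/
theorem lieIndex_extension_false :
    lieIndex ℂ (extension d False G hG).algebra = d + lieIndex ℂ G.algebra := by
  have hbij : Function.Bijective (blockHom (d := d) False G hG ⊤) := by
    constructor
    · rw [← LieHom.coe_toLinearMap, ← LinearMap.ker_eq_bot, Submodule.eq_bot_iff]
      intro z hz
      refine eq_zero_of_blocks G fun i j _ => ?_
      have : blockHom False G hG ⊤ z = 0 := hz
      rw [← coe_blockHom False G hG, this]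
      rfl
    · intro A
      refine ⟨(⟨(A : Matrix (Fin d ⊕ J ⊕ Fin d) (Fin d ⊕ J ⊕ Fin d) ℂ).submatrix
        Sum.inl Sum.inl, trivial⟩, ⟨_, middle_mem False G hG A⟩), ?_⟩
      apply Subtype.ext
      rw [coe_blockHom]
      ext i j
      rcases i with i | i | i <;> rcases j with j | j | j <;>
        first
        | rfl
        | exact (last_apply False G hG A i j).symm
        | exact (supp_coe A _ _ id).symm
  have e := LieEquiv.ofBijective (blockHom (d := d) False G hG ⊤) hbij
  rw [← lieIndex_congr e, lieIndex_prod, lieIndex_gl]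

end

end SignedPreorder

/-- Two invertible symmetric complex matrices of the same size are congruent. -/
theorem exists_congruence {d : ℕ} {A B : Matrix (Fin d) (Fin d) ℂ} (hA : Aᵀ = A) (hB : Bᵀ = B)
    (hA' : A.det ≠ 0) (hB' : B.det ≠ 0) :
    ∃ p q : Matrix (Fin d) (Fin d) ℂ, p * q = 1 ∧ pᵀ * A * p = B := by
  have assoc : ∀ C : Matrix (Fin d) (Fin d) ℂ, Cᵀ = C →
      QuadraticMap.associated C.toQuadraticForm' = Matrix.toLinearMap₂' ℂ C := by
    intro C hC
    refine QuadraticMap.associated_left_inverse ℂ fun x y => ?_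
    rw [Matrix.toLinearMap₂'_apply', Matrix.toLinearMap₂'_apply',
      dotProduct_mulVec, ← mulVec_transpose, hC, dotProduct_comm]
  have sep : ∀ C : Matrix (Fin d) (Fin d) ℂ, Cᵀ = C → C.det ≠ 0 →
      (QuadraticMap.associated (R := ℂ) C.toQuadraticForm').SeparatingLeft := by
    intro C hC hdet
    rw [assoc C hC]
    exact (Matrix.separatingLeft_iff_det_ne_zero.2 hdet).toLinearMap₂'
  obtain ⟨e⟩ := QuadraticForm.equivalent_of_isAlgClosed _ _ (sep B hB hB') (sep A hA hA')
  refine ⟨LinearMap.toMatrix' (e.toLinearEquiv : (Fin d → ℂ) →ₗ[ℂ] Fin d → ℂ),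
    LinearMap.toMatrix' (e.toLinearEquiv.symm : (Fin d → ℂ) →ₗ[ℂ] Fin d → ℂ), ?_, ?_⟩
  · rw [← LinearMap.toMatrix'_comp, ← LinearMap.toMatrix'_id]
    congr 1
    exact LinearMap.ext fun v => e.toLinearEquiv.apply_symm_apply v
  · have mat : ∀ C : Matrix (Fin d) (Fin d) ℂ, Cᵀ = C →
        C.toQuadraticForm'.toMatrix' = C := by
      intro C hC
      rw [QuadraticForm.toMatrix', assoc C hC, LinearMap.toMatrix'_toLinearMap₂']
    have hcomp : A.toQuadraticForm'.comp (e.toLinearEquiv : (Fin d → ℂ) →ₗ[ℂ] Fin d → ℂ) =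
        B.toQuadraticForm' := by
      ext v
      exact e.map_app v
    have h1 := congrArg QuadraticForm.toMatrix' hcomp
    rwa [QuadraticForm.toMatrix'_comp, mat A hA, mat B hB] at h1

end Extensions

/-! ### Tail blocks and the reduction to the orthogonal algebra -/

section TailIndex

open Matrix Module

/-- The antidiagonal permutation matrix. -/
def antidiagonalMatrix (d : ℕ) : Matrix (Fin d) (Fin d) ℂ :=
  of fun b b' => if b' = Fin.rev b then 1 else 0

theorem transpose_antidiagonalMatrix (d : ℕ) :
    (antidiagonalMatrix d)ᵀ = antidiagonalMatrix d := by
  ext i j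
  change (if i = Fin.rev j then (1 : ℂ) else 0) = if j = Fin.rev i then 1 else 0
  congr 1
  exact propext ⟨fun h => by rw [h, Fin.rev_rev], fun h => by rw [h, Fin.rev_rev]⟩

theorem antidiagonalMatrix_mul_self (d : ℕ) :
    antidiagonalMatrix d * antidiagonalMatrix d = 1 := by
  ext i j
  rw [Matrix.mul_apply, Finset.sum_eq_single (Fin.rev i)]
  · simp [antidiagonalMatrix, Matrix.one_apply, eq_comm]
  · intro k _ hk
    simp [antidiagonalMatrix, hk]
  · exact fun h' => (h' (Finset.mem_univ _)).elim

namespace SignedPreorder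

/-- The signed preorder of the orthogonal Lie algebra of the antidiagonal symmetric form. -/
def orthogonal (d : ℕ) : SignedPreorder (Fin d) where
  σ := Fin.rev
  ε _ := 1
  R _ _ := True
  σ_σ := Fin.rev_rev
  ε_mul_self _ := one_mul 1
  ε_σ _ _ := rfl
  refl _ := trivial
  trans _ _ := trivial
  R_σ _ := trivial

section

variable {J : Type*} [Fintype J] [DecidableEq J] {d : ℕ}

/-- Matrices that raise the level by `k`. -/
def Raises (k : ℕ) (A : Matrix (Fin d ⊕ J ⊕ Fin d) (Fin d ⊕ J ⊕ Fin d) ℂ) : Prop :=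
  ∀ i j, A i j ≠ 0 → level j = level i + k

theorem Raises.mul {k l : ℕ} {A B : Matrix (Fin d ⊕ J ⊕ Fin d) (Fin d ⊕ J ⊕ Fin d) ℂ}
    (hA : Raises k A) (hB : Raises l B) : Raises (k + l) (A * B) := by
  intro i j hne
  rw [Matrix.mul_apply] at hne
  obtain ⟨m, -, hm⟩ := Finset.exists_ne_zero_of_sum_ne_zero hne
  rw [hB _ _ (right_ne_zero_of_mul hm), hA _ _ (left_ne_zero_of_mul hm), add_assoc]

theorem Raises.eq_zero {k : ℕ} {A : Matrix (Fin d ⊕ J ⊕ Fin d) (Fin d ⊕ J ⊕ Fin d) ℂ}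
    (hA : Raises k A) (hk : 3 ≤ k) : A = 0 := by
  ext i j
  by_contra hne
  have h1 := hA i j hne
  have h2 := level_le j
  omega

variable (G : SignedPreorder J) (hG : ∀ j, G.ε (G.σ j) = -G.ε j)

/-- The elements that raise the level by `k`. -/
def graded (d k : ℕ) : Submodule ℂ (extension d True G hG).algebra where
  carrier := {x | Raises k (x : Matrix (Fin d ⊕ J ⊕ Fin d) (Fin d ⊕ J ⊕ Fin d) ℂ)}
  add_mem' {x y} hx hy i j hne := by
    by_contra hl
    have h1 : (x : Matrix (Fin d ⊕ J ⊕ Fin d) (Fin d ⊕ J ⊕ Fin d) ℂ) i j = 0 :=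
      not_not.1 fun h => hl (hx i j h)
    have h2 : (y : Matrix (Fin d ⊕ J ⊕ Fin d) (Fin d ⊕ J ⊕ Fin d) ℂ) i j = 0 :=
      not_not.1 fun h => hl (hy i j h)
    refine hne ?_
    change _ + _ = (0 : ℂ)
    rw [h1, h2, add_zero]
  zero_mem' _ _ hne := (hne rfl).elim
  smul_mem' a _ hx i j hne := hx i j (right_ne_zero_of_mul (a := a) hne)

theorem level_σ (i : Fin d ⊕ J ⊕ Fin d) : level ((extension d True G hG).σ i) = 2 - level i := by
  rcases i with i | i | i <;> rfl

theorem level_le_of_rel {i j : Fin d ⊕ J ⊕ Fin d} (h : (extension d True G hG).R i j) :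
    level i ≤ level j := by
  rcases i with i | i | i <;> rcases j with j | j | j <;> simp_all [extension]

theorem rel_of_level_lt {i j : Fin d ⊕ J ⊕ Fin d} (h : level i < level j) :
    (extension d True G hG).R i j := by
  rcases i with i | i | i <;> rcases j with j | j | j <;> simp_all [extension]

theorem entry_eq_zero_of_level (x : (extension d True G hG).algebra) {i j : Fin d ⊕ J ⊕ Fin d}
    (h : level j < level i) :
    (x : Matrix (Fin d ⊕ J ⊕ Fin d) (Fin d ⊕ J ⊕ Fin d) ℂ) i j = 0 :=
  supp_coe x i j fun hR => absurd (level_le_of_rel G hG hR) (by omega)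

theorem sk_single_mem_graded {k : ℕ} (hk : 0 < k) {i j : Fin d ⊕ J ⊕ Fin d}
    (h : level j = level i + k) :
    (extension d True G hG).sk (single i j 1) ∈ graded G hG d k := by
  intro a b hne
  rw [(supp_single (rel_of_level_lt G hG (by omega)) 1).coe_sk, adj_single, Matrix.sub_apply,
    Matrix.single_apply, Matrix.single_apply] at hne
  by_cases h1 : i = a ∧ j = b
  · rw [← h1.1, ← h1.2, h]
  · by_cases h2 : (extension d True G hG).σ j = a ∧ (extension d True G hG).σ i = b
    · rw [← h2.1, ← h2.2, level_σ, level_σ]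
      have := level_le i
      have := level_le j
      omega
    · rw [if_neg h1, if_neg h2, sub_zero] at hne
      exact (hne rfl).elim

/-- The component of an element that raises the level by `k`. -/
def component (k : ℕ) (x : (extension d True G hG).algebra) : (extension d True G hG).algebra :=
  ⟨of fun i j => if level j = level i + k then
      (x : Matrix (Fin d ⊕ J ⊕ Fin d) (Fin d ⊕ J ⊕ Fin d) ℂ) i j else 0, by
    constructor
    · ext i j
      rw [adj_apply, neg_apply, of_apply, of_apply, level_σ, level_σ]
      have h1 := level_le i
      have h2 := level_le j
      by_cases h : level j = level i + k
      · rw [if_pos h, if_pos (by omega), ← adj_apply, adj_coe]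
        rfl
      · by_cases h' : 2 - level i = 2 - level j + k
        · omega
        · rw [if_neg h, if_neg h', mul_zero, neg_zero]
    · intro i j hR
      rw [of_apply]
      split_ifs
      · exact supp_coe x i j hR
      · rfl⟩

theorem component_mem (k : ℕ) (x : (extension d True G hG).algebra) :
    component G hG k x ∈ graded G hG d k := by
  intro i j hne
  by_contra h
  exact hne (if_neg h)

/-- The coefficients of the normal form on the elements that raise the level by two. -/
noncomputable def tailCoeff (J : Type*) (d : ℕ) :
    Matrix (Fin d ⊕ J ⊕ Fin d) (Fin d ⊕ J ⊕ Fin d) ℂ :=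
  of fun
    | .inl b, .inr (.inr b') => if b' = Fin.rev b then 1 / 2 else 0
    | _, _ => 0

theorem raises_tailCoeff : Raises 2 (tailCoeff J d) := by
  intro i j hne
  rcases i with i | i | i <;> rcases j with j | j | j <;> first | rfl | exact (hne rfl).elim

/-- The normal form on the elements that raise the level. -/
noncomputable def tailForm (d : ℕ) : Dual ℂ (extension d True G hG).algebra :=
  (extension d True G hG).formOf (tailCoeff J d)

theorem tailForm_eq_zero {k : ℕ} (hk : k ≠ 2) {x : (extension d True G hG).algebra}
    (hx : x ∈ graded G hG d k) : tailForm G hG d x = 0 := by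
  rw [tailForm, formOf_apply]
  refine Finset.sum_eq_zero fun i _ => Finset.sum_eq_zero fun j _ => ?_
  by_contra hne
  have h1 := raises_tailCoeff _ _ (left_ne_zero_of_mul hne)
  have h2 := hx _ _ (right_ne_zero_of_mul hne)
  omega

/-- The mirror image of an antidiagonal slot is antidiagonal, and the signs at its two ends are
opposite; the skew extension adds the two coefficients `1/2`. -/
theorem ext_tailForm_single (b b' : Fin d) :
    ext (tailForm G hG d) (single (.inl b) (.inr (.inr b')) 1) =
      if b' = Fin.rev b then 1 else 0 := by
  rw [tailForm, ext_formOf_single _ (rel_of_level_lt G hG (by simp))]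
  by_cases h : b' = Fin.rev b
  · subst h
    simp [tailCoeff, extension]
    norm_num
  · have h' : b ≠ Fin.rev b' := fun h' => h (by rw [h', Fin.rev_rev])
    simp [tailCoeff, extension, h, h']

theorem blockHom_mem_graded (L : LieSubalgebra ℂ (Matrix (Fin d) (Fin d) ℂ)) (z : L × G.algebra) :
    blockHom True G hG L z ∈ graded G hG d 0 := by
  intro i j hne
  by_contra h
  exact hne (blocks_eq_zero _ _ fun h' => h h'.symm)

theorem eq_zero_on_top {ψ : Dual ℂ (extension d True G hG).algebra}
    (h : ∀ b b', ψ ((extension d True G hG).sk (single (.inl b) (.inr (.inr b')) 1)) = 0)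
    {v : (extension d True G hG).algebra} (hv : v ∈ graded G hG d 2) : ψ v = 0 := by
  have h1 : ψ ((extension d True G hG).sk v) = 0 := by
    refine ext_eq_zero_of_single fun i j hne => ?_
    have hl := hv i j hne
    rcases i with i | i | i <;> rcases j with j | j | j <;> simp at hl
    exact h i j
  rw [sk_coe, map_smul, smul_eq_mul] at h1
  exact (mul_eq_zero.1 h1).resolve_left two_ne_zero

section Normal

variable {G hG} {φ : Dual ℂ (extension d True G hG).algebra}
  (h2 : ∀ b b' : Fin d, ext φ (single (.inl b) (.inr (.inr b')) 1) =
    if b' = Fin.rev b then 1 else 0)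
include h2

/-- The value measures how far the first block of `x` is from being skew for the antidiagonal
symmetric form. Orthogonality to degree two is thus membership of this block in `so_d`, with no
condition on the other entries. -/
theorem apply_lie_top (x : (extension d True G hG).algebra) (b b' : Fin d) :
    φ ⁅x, (extension d True G hG).sk (single (.inl b) (.inr (.inr b')) 1)⁆ =
      (x : Matrix (Fin d ⊕ J ⊕ Fin d) (Fin d ⊕ J ⊕ Fin d) ℂ) (.inl (Fin.rev b')) (.inl b) +
      (x : Matrix (Fin d ⊕ J ⊕ Fin d) (Fin d ⊕ J ⊕ Fin d) ℂ) (.inl (Fin.rev b)) (.inl b') := by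
  have h0 : ∀ k : Fin d, (b' = Fin.rev k) = (k = Fin.rev b') := fun k =>
    propext ⟨fun h => by rw [h, Fin.rev_rev], fun h => by rw [h, Fin.rev_rev]⟩
  rw [apply_lie_sk φ x (supp_single (rel_of_level_lt G hG (by simp)) 1), ext_mul_single,
    ext_single_mul]
  simp only [Fintype.sum_sum_type]
  have z1 : ∀ k : J, (x : Matrix (Fin d ⊕ J ⊕ Fin d) (Fin d ⊕ J ⊕ Fin d) ℂ)
      (.inr (.inl k)) (.inl b) = 0 := fun k => entry_eq_zero_of_level G hG x (by simp)
  have z2 : ∀ k, (x : Matrix (Fin d ⊕ J ⊕ Fin d) (Fin d ⊕ J ⊕ Fin d) ℂ)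
      (.inr (.inr k)) (.inl b) = 0 := fun k => entry_eq_zero_of_level G hG x (by simp)
  have z3 : ∀ k, (x : Matrix (Fin d ⊕ J ⊕ Fin d) (Fin d ⊕ J ⊕ Fin d) ℂ)
      (.inr (.inr b')) (.inl k) = 0 := fun k => entry_eq_zero_of_level G hG x (by simp)
  have z4 : ∀ k, (x : Matrix (Fin d ⊕ J ⊕ Fin d) (Fin d ⊕ J ⊕ Fin d) ℂ)
      (.inr (.inr b')) (.inr (.inl k)) = 0 := fun k => entry_eq_zero_of_level G hG x (by simp)
  simp only [z1, z2, z3, z4, h2, h0, zero_mul, mul_ite, mul_one, mul_zero, Finset.sum_const_zero,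
    add_zero, zero_add, Finset.sum_ite_eq', Finset.mem_univ, if_true]
  rw [last_apply, sub_neg_eq_add]

theorem apply_lie_blockHom (z : (orthogonal d).algebra × G.algebra)
    {v : (extension d True G hG).algebra} (hv : v ∈ graded G hG d 2) :
    φ ⁅blockHom True G hG (orthogonal d).algebra z, v⁆ = 0 := by
  refine eq_zero_on_top G hG (ψ := kirillovForm ℂ _ φ _) (fun b b' => ?_) hv
  rw [kirillovForm_apply, apply_lie_top h2]
  have := congrFun (congrFun (adj_coe z.1) (Fin.rev b)) b'
  rw [adj_apply, neg_apply] at this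
  change (z.1 : Matrix (Fin d) (Fin d) ℂ) (Fin.rev b') b +
    (z.1 : Matrix (Fin d) (Fin d) ℂ) (Fin.rev b) b' = 0
  change 1 * 1 * (z.1 : Matrix (Fin d) (Fin d) ℂ) (Fin.rev b') (Fin.rev (Fin.rev b)) = _ at this
  rw [Fin.rev_rev] at this
  linear_combination this

theorem eq_zero_of_lie_top {v : (extension d True G hG).algebra} (hv : v ∈ graded G hG d 2)
    (h0 : ∀ x, φ ⁅v, x⁆ = 0) : v = 0 := by
  apply Subtype.ext
  ext i j
  by_contra hne
  have hl := hv i j hne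
  rcases i with i | i | i <;> rcases j with j | j | j <;> simp at hl
  refine hne ?_
  have hR : (extension d True G hG).R (.inl (Fin.rev j)) (.inl i) := trivial
  have h1 := h0 ((extension d True G hG).sk (single (.inl (Fin.rev j)) (.inl i) 1))
  rw [apply_lie_sk φ v (supp_single hR 1), ext_mul_single, ext_single_mul] at h1
  simp only [Fintype.sum_sum_type] at h1
  have z : ∀ a b, level b ≠ level a + 2 →
      (v : Matrix (Fin d ⊕ J ⊕ Fin d) (Fin d ⊕ J ⊕ Fin d) ℂ) a b = 0 := fun a b h =>
    not_not.1 fun h' => h (hv a b h')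
  have z1 : ∀ a, (v : Matrix (Fin d ⊕ J ⊕ Fin d) (Fin d ⊕ J ⊕ Fin d) ℂ) a
      (.inl (Fin.rev j)) = 0 := fun a => z _ _ (by simp)
  have z2 : ∀ a, (v : Matrix (Fin d ⊕ J ⊕ Fin d) (Fin d ⊕ J ⊕ Fin d) ℂ) (.inl i)
      (.inl a) = 0 := fun a => z _ _ (by simp)
  have z3 : ∀ a, (v : Matrix (Fin d ⊕ J ⊕ Fin d) (Fin d ⊕ J ⊕ Fin d) ℂ) (.inl i)
      (.inr (.inl a)) = 0 := fun a => z _ _ (by simp)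
  simp only [z1, z2, z3, h2, Fin.rev_rev, zero_mul, mul_ite, mul_one, mul_zero,
    Finset.sum_const_zero, add_zero, zero_add, Finset.sum_ite_eq', Finset.mem_univ, if_true,
    zero_sub, neg_eq_zero] at h1
  exact h1

/-- Degree one is paired with itself through degree two: the entry of `w` at `(i, j)` is its bracket
value with the unit from `j` to the reversal of `i` in the last class. The other nonzero entries are
mirror images of these. -/
theorem eq_zero_of_lie_middle {w : (extension d True G hG).algebra} (hw : w ∈ graded G hG d 1)
    (h0 : ∀ x ∈ graded G hG d 1, φ ⁅w, x⁆ = 0) : w = 0 := by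
  have z : ∀ a b, level b ≠ level a + 1 →
      (w : Matrix (Fin d ⊕ J ⊕ Fin d) (Fin d ⊕ J ⊕ Fin d) ℂ) a b = 0 := fun a b h =>
    not_not.1 fun h' => h (hw a b h')
  have key : ∀ i j, (w : Matrix (Fin d ⊕ J ⊕ Fin d) (Fin d ⊕ J ⊕ Fin d) ℂ) (.inl i)
      (.inr (.inl j)) = 0 := by
    intro i j
    have h1 := h0 ((extension d True G hG).sk (single (.inr (.inl j)) (.inr (.inr (Fin.rev i))) 1))
      (sk_single_mem_graded G hG one_pos (by simp))
    rw [apply_lie_sk φ w (supp_single (rel_of_level_lt G hG (by simp)) 1), ext_mul_single,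
      ext_single_mul] at h1
    simp only [Fintype.sum_sum_type] at h1
    have h0 : ∀ k : Fin d, (Fin.rev i = Fin.rev k) = (k = i) := fun k =>
      propext ⟨fun h => (Fin.rev_injective h).symm, fun h => by rw [h]⟩
    have z1 : ∀ a, (w : Matrix (Fin d ⊕ J ⊕ Fin d) (Fin d ⊕ J ⊕ Fin d) ℂ) (.inr (.inr (Fin.rev i)))
        a = 0 := fun a => z _ _ (by have := level_le a; simp; omega)
    have z2 : ∀ a, (w : Matrix (Fin d ⊕ J ⊕ Fin d) (Fin d ⊕ J ⊕ Fin d) ℂ) (.inr (.inl a))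
        (.inr (.inl j)) = 0 := fun a => z _ _ (by simp)
    have z3 : ∀ a, (w : Matrix (Fin d ⊕ J ⊕ Fin d) (Fin d ⊕ J ⊕ Fin d) ℂ) (.inr (.inr a))
        (.inr (.inl j)) = 0 := fun a => z _ _ (by simp)
    simp only [z1, z2, z3, h2, h0, zero_mul, mul_ite, mul_one, mul_zero,
      Finset.sum_const_zero, add_zero, Finset.sum_ite_eq', Finset.mem_univ, if_true,
      sub_zero] at h1
    exact h1
  apply Subtype.ext
  ext i j
  by_contra hne
  have hl := hw i j hne
  rcases i with i | i | i <;> rcases j with j | j | j <;> simp at hl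
  · exact hne (key i j)
  · have := congrFun (congrFun (adj_coe w) (.inr (.inl i))) (.inr (.inr j))
    rw [adj_apply, neg_apply] at this
    refine hne (neg_eq_zero.1 (this.symm.trans ?_))
    change _ * (w : Matrix (Fin d ⊕ J ⊕ Fin d) (Fin d ⊕ J ⊕ Fin d) ℂ) (.inl j)
      (.inr (.inl (G.σ i))) = 0
    rw [key, mul_zero]

theorem exists_decomposition {x : (extension d True G hG).algebra}
    (hx : ∀ v ∈ graded G hG d 2, φ ⁅x, v⁆ = 0) :
    ∃ v ∈ graded G hG d 2, ∃ w ∈ graded G hG d 1, ∃ m,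
      x = v + w + blockHom True G hG (orthogonal d).algebra m := by
  have hy : (x : Matrix (Fin d ⊕ J ⊕ Fin d) (Fin d ⊕ J ⊕ Fin d) ℂ).submatrix Sum.inl Sum.inl ∈
      (orthogonal d).algebra := by
    refine ⟨?_, fun _ _ h => (h trivial).elim⟩
    ext i j
    have := hx _ (sk_single_mem_graded G hG two_pos (i := .inl j) (j := .inr (.inr (Fin.rev i)))
      (by simp))
    rw [apply_lie_top h2, Fin.rev_rev] at this
    rw [adj_apply, neg_apply, submatrix_apply, submatrix_apply]
    change 1 * 1 * (x : Matrix (Fin d ⊕ J ⊕ Fin d) (Fin d ⊕ J ⊕ Fin d) ℂ) (.inl (Fin.rev j))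
      (.inl (Fin.rev i)) = _
    linear_combination this
  let m : (orthogonal d).algebra × G.algebra := (⟨_, hy⟩, ⟨_, middle_mem True G hG x⟩)
  refine ⟨x - component G hG 1 x - blockHom True G hG (orthogonal d).algebra m, ?_,
    component G hG 1 x, component_mem G hG 1 x, m, by abel⟩
  intro i j hne
  by_contra hl
  refine hne ?_
  change (x : Matrix (Fin d ⊕ J ⊕ Fin d) (Fin d ⊕ J ⊕ Fin d) ℂ) i j -
    (if level j = level i + 1 then
      (x : Matrix (Fin d ⊕ J ⊕ Fin d) (Fin d ⊕ J ⊕ Fin d) ℂ) i j else 0) - blocks _ _ i j = 0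
  rcases lt_trichotomy (level i) (level j) with h | h | h
  · have h1 := level_le j
    rw [if_pos (by omega), blocks_eq_zero _ _ h.ne, sub_self, sub_zero]
  · rw [if_neg (by omega), sub_zero, sub_eq_zero]
    rcases i with i | i | i <;> rcases j with j | j | j <;> simp at h
    · rfl
    · rfl
    · exact last_apply True G hG x i j
  · rw [entry_eq_zero_of_level G hG x h, if_neg (by omega), blocks_eq_zero _ _ h.ne', sub_zero,
      sub_zero]

end Normal

/-- The exponential of an element of level one acts by a unipotent automorphism. -/
theorem exists_exp {w : (extension d True G hG).algebra} (hw : w ∈ graded G hG d 1) :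
    ∃ e : (extension d True G hG).algebra ≃ₗ⁅ℂ⁆ (extension d True G hG).algebra,
      (∀ v ∈ graded G hG d 2, e v = v) ∧ ∀ v ∈ graded G hG d 1, e v = v + ⁅w, v⁆ := by
  set A := (w : Matrix (Fin d ⊕ J ⊕ Fin d) (Fin d ⊕ J ⊕ Fin d) ℂ) with hA
  have hAr : Raises 1 A := hw
  have hadj : (extension d True G hG).adj A = -A := adj_coe w
  -- There are only three levels, so the exponential is `1 + A + A²/2`, and its adjoint is the
  -- exponential of `-A`.
  have hA3 : A * A * A = 0 := ((hAr.mul hAr).mul hAr).eq_zero le_rfl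
  have hadjP : (extension d True G hG).adj (1 + A + (1 / 2 : ℂ) • (A * A)) =
      1 - A + (1 / 2 : ℂ) • (A * A) := by
    rw [map_add, map_add, map_smul, adj_mul, adj_one, hadj, neg_mul_neg, ← sub_eq_add_neg]
  have hS : (extension d True G hG).Supp (1 + A + (1 / 2 : ℂ) • (A * A)) :=
    (supp_one.add (supp_coe w)).add (((supp_coe w).mul (supp_coe w)).smul _)
  have hP : (1 + A + (1 / 2 : ℂ) • (A * A)) *
      (extension d True G hG).adj (1 + A + (1 / 2 : ℂ) • (A * A)) = 1 := by
    rw [hadjP]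
    have hA4 : A * A * (A * A) = 0 := by rw [← mul_assoc, hA3, zero_mul]
    simp only [add_mul, mul_add, mul_sub, one_mul, mul_one, Matrix.smul_mul,
      Matrix.mul_smul, ← mul_assoc, hA3, zero_mul, smul_zero, add_zero]
    module
  refine ⟨conj _ hS hP, fun v hv => ?_, fun v hv => ?_⟩
  · set C := (v : Matrix (Fin d ⊕ J ⊕ Fin d) (Fin d ⊕ J ⊕ Fin d) ℂ) with hC
    have hCr : Raises 2 C := hv
    have z1 : A * C = 0 := (hAr.mul hCr).eq_zero le_rfl
    have z2 : C * A = 0 := (hCr.mul hAr).eq_zero le_rfl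
    apply Subtype.ext
    rw [coe_conj, hadjP, ← hC]
    simp only [add_mul, mul_add, mul_sub, one_mul, mul_one, Matrix.smul_mul, Matrix.mul_smul,
      mul_assoc, z1]
    simp only [← mul_assoc, z2, zero_mul, mul_zero, smul_zero, sub_zero, add_zero]
  · set C := (v : Matrix (Fin d ⊕ J ⊕ Fin d) (Fin d ⊕ J ⊕ Fin d) ℂ) with hC
    have hCr : Raises 1 C := hv
    have z1 : A * A * C = 0 := ((hAr.mul hAr).mul hCr).eq_zero le_rfl
    have z2 : A * C * A = 0 := ((hAr.mul hCr).mul hAr).eq_zero le_rfl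
    have z3 : C * A * A = 0 := ((hCr.mul hAr).mul hAr).eq_zero le_rfl
    apply Subtype.ext
    rw [coe_conj, hadjP, ← hC]
    change _ = C + (A * C - C * A)
    simp only [add_mul, mul_add, mul_sub, one_mul, mul_one, Matrix.smul_mul, Matrix.mul_smul,
      ← mul_assoc, z1, z2, z3, zero_mul, smul_zero, add_zero]
    abel

/-- Normalization of the part of a form on the elements that raise the level by two. -/
theorem exists_conj_top (φ : Dual ℂ (extension d True G hG).algebra)
    (hdet : (of fun b b' : Fin d => ext φ (single (.inl b) (.inr (.inr b')) 1)).det ≠ 0) :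
    ∃ e : (extension d True G hG).algebra ≃ₗ⁅ℂ⁆ (extension d True G hG).algebra,
      ∀ b b' : Fin d, φ (e ((extension d True G hG).sk (single (.inl b) (.inr (.inr b')) 1))) =
        if b' = Fin.rev b then 1 else 0 := by
  set S : Matrix (Fin d) (Fin d) ℂ :=
    of fun b b' : Fin d => ext φ (single (.inl b) (.inr (.inr b')) 1) with hS
  -- The signs at the ends of a top slot are opposite, which turns skewness of the extended form
  -- into symmetry of `S`; this is why an orthogonal stabiliser appears.
  have hsymm : Sᵀ = S := by
    ext b b'
    change ext φ (single (.inl b') (.inr (.inr b)) 1) = ext φ (single (.inl b) (.inr (.inr b')) 1)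
    have h1 := ext_adj φ (single (.inl b) (.inr (.inr b')) 1)
    rw [adj_single] at h1
    have h3 : (single ((extension d True G hG).σ (.inr (.inr b')))
        ((extension d True G hG).σ (.inl b)) ((extension d True G hG).ε (.inl b) *
          (extension d True G hG).ε (.inr (.inr b'))) :
          Matrix (Fin d ⊕ J ⊕ Fin d) (Fin d ⊕ J ⊕ Fin d) ℂ) =
        (-1 : ℂ) • single (.inl b') (.inr (.inr b)) 1 := by
      rw [smul_single]
      simp [extension]
    rw [h3, map_smul, smul_eq_mul, neg_one_mul, neg_inj] at h1
    exact h1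
  set Q := antidiagonalMatrix d
  have hQ : Q * Q = 1 := antidiagonalMatrix_mul_self d
  have hQsymm : Qᵀ = Q := transpose_antidiagonalMatrix d
  have hQdet : Q.det ≠ 0 := by
    intro h
    have := congrArg Matrix.det hQ
    rw [det_mul, h, det_one, zero_mul] at this
    exact zero_ne_one this
  -- The factor `GL_d` acts on degree two by `S ↦ p₀ᵀ S p₀`, so normalising amounts to a congruence
  -- of symmetric matrices.
  obtain ⟨p₀, q₀, hpq, hp₀⟩ := exists_congruence hsymm hQsymm hdet hQdet
  let emb : Matrix (Fin d) (Fin d) ℂ → Matrix (Fin d ⊕ J ⊕ Fin d) (Fin d ⊕ J ⊕ Fin d) ℂ :=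
    fun Y => of fun
      | .inl i, .inl j => Y i j
      | _, _ => 0
  have emb_mul : ∀ Y Y', emb Y * emb Y' = emb (Y * Y') := by
    intro Y Y'
    ext i j
    rcases i with i | i | i <;> rcases j with j | j | j <;>
      simp [emb, Matrix.mul_apply, Fintype.sum_sum_type]
  have emb_add : ∀ Y Y', emb Y + emb Y' = emb (Y + Y') := by
    intro Y Y'
    ext i j
    rcases i with i | i | i <;> rcases j with j | j | j <;> simp [emb]
  have emb_zero : emb 0 = 0 := by
    ext i j
    rcases i with i | i | i <;> rcases j with j | j | j <;> simp [emb]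
  have emb_ne : ∀ Y i j, emb Y i j ≠ 0 → level i = 0 ∧ level j = 0 := by
    intro Y i j hne
    rcases i with i | i | i <;> rcases j with j | j | j <;>
      first | exact ⟨rfl, rfl⟩ | exact (hne rfl).elim
  have emb_supp : ∀ Y, (extension d True G hG).Supp (emb Y) := by
    intro Y i j hR
    by_contra hne
    have := emb_ne Y i j hne
    rcases i with i | i | i <;> rcases j with j | j | j <;> simp at this
    exact hR trivial
  have hpq' : (1 + emb (p₀ - 1)) * (1 + emb (q₀ - 1)) = 1 := by
    have : (1 + emb (p₀ - 1)) * (1 + emb (q₀ - 1)) =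
        1 + (emb (p₀ - 1) + emb (q₀ - 1) + emb (p₀ - 1) * emb (q₀ - 1)) := by noncomm_ring
    rw [this, emb_mul, emb_add, emb_add]
    have h0 : p₀ - 1 + (q₀ - 1) + (p₀ - 1) * (q₀ - 1) = 0 := by
      calc _ = p₀ * q₀ - 1 := by noncomm_ring
        _ = 0 := by rw [hpq, sub_self]
    rw [h0, emb_zero, add_zero]
  obtain ⟨e, he⟩ := exists_conj (F := extension d True G hG) (fun i => level i = 0)
    (fun i hi => by rw [level_σ, hi]; decide) (1 + emb (p₀ - 1)) (1 + emb (q₀ - 1)) hpq'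
    (supp_one.add (emb_supp _)) (supp_one.add (emb_supp _))
    (fun i j hne => emb_ne (p₀ - 1) i j (by rwa [add_sub_cancel_left] at hne))
    (fun i j hne => emb_ne (q₀ - 1) i j (by rwa [add_sub_cancel_left] at hne))
  refine ⟨e, fun b b' => ?_⟩
  have hsingle : ∀ i j, (single (.inl b) (.inr (.inr b')) 1 :
      Matrix (Fin d ⊕ J ⊕ Fin d) (Fin d ⊕ J ⊕ Fin d) ℂ) i j ≠ 0 →
      .inl b = i ∧ .inr (.inr b') = j := by
    intro i j hne
    by_contra hc
    rw [Matrix.single_apply, if_neg hc] at hne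
    exact hne rfl
  rw [(he φ (single (.inl b) (.inr (.inr b')) 1)
    (supp_single (rel_of_level_lt G hG (by simp)) 1)
    (fun i j hne => (hsingle i j hne).1 ▸ rfl)).2
    (fun i j hne => (hsingle i j hne).2 ▸ (by simp)), ext_eq_sum]
  have hent : ∀ i j, ((1 + emb (p₀ - 1)) * single (.inl b) (.inr (.inr b')) (1 : ℂ) *
      (extension d True G hG).adj (1 + emb (p₀ - 1)) :
      Matrix (Fin d ⊕ J ⊕ Fin d) (Fin d ⊕ J ⊕ Fin d) ℂ) i j =
      (1 + emb (p₀ - 1)) i (.inl b) *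
        (extension d True G hG).adj (1 + emb (p₀ - 1)) (.inr (.inr b')) j := by
    intro i j
    rw [Matrix.mul_apply, Finset.sum_eq_single (.inr (.inr b'))]
    · rw [mul_single_apply_same, mul_one]
    · intro k _ hk
      rw [mul_single_apply_of_ne _ _ _ _ _ hk, zero_mul]
    · exact fun h' => (h' (Finset.mem_univ _)).elim
  have c1 : ∀ k : Fin d, (1 + emb (p₀ - 1)) (.inl k) (.inl b) = p₀ k b := by
    intro k
    simp [emb, Matrix.one_apply]
  have c2 : ∀ k, (1 + emb (p₀ - 1)) (.inr k) (.inl b) = 0 := by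
    rintro (k | k) <;> simp [emb]
  have c3 : ∀ k : Fin d, (extension d True G hG).adj (1 + emb (p₀ - 1)) (.inr (.inr b'))
      (.inr (.inr k)) = p₀ k b' := by
    intro k
    rw [adj_apply]
    simp [emb, extension, Matrix.one_apply]
  have c4 : ∀ k : Fin d, (extension d True G hG).adj (1 + emb (p₀ - 1)) (.inr (.inr b'))
      (.inl k) = 0 := by
    intro k
    rw [adj_apply]
    simp [emb, extension]
  have c5 : ∀ k : J, (extension d True G hG).adj (1 + emb (p₀ - 1)) (.inr (.inr b'))
      (.inr (.inl k)) = 0 := by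
    intro k
    rw [adj_apply]
    simp [emb, extension]
  have hQb : (if b' = Fin.rev b then (1 : ℂ) else 0) = Q b b' := rfl
  rw [hQb, ← hp₀]
  simp only [hent, Fintype.sum_sum_type, c1, c2, c3, c4, c5, zero_mul, mul_zero,
    Finset.sum_const_zero, add_zero, zero_add]
  simp only [Matrix.mul_apply, Finset.sum_mul, transpose_apply]
  rw [Finset.sum_comm]
  refine Finset.sum_congr rfl fun k _ => Finset.sum_congr rfl fun l _ => ?_
  rw [hS, of_apply]
  ring

/-- The index of an extension by a comparable class. -/
theorem lieIndex_extension_true (d : ℕ) :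
    lieIndex ℂ (extension d True G hG).algebra = d / 2 + lieIndex ℂ G.algebra := by
  rw [← lieIndex_of_rel_true (orthogonal d) (fun _ => rfl) (fun _ _ => trivial), ← lieIndex_prod]
  have lie_mem : ∀ {k l : ℕ} {x y : (extension d True G hG).algebra}, x ∈ graded G hG d k →
      y ∈ graded G hG d l → ⁅x, y⁆ ∈ graded G hG d (k + l) := by
    intro k l x y hx hy i j hne
    rw [coe_lie] at hne
    by_cases h : ((x : Matrix (Fin d ⊕ J ⊕ Fin d) (Fin d ⊕ J ⊕ Fin d) ℂ) *
        (y : Matrix (Fin d ⊕ J ⊕ Fin d) (Fin d ⊕ J ⊕ Fin d) ℂ)) i j = 0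
    · rw [Matrix.sub_apply, h, zero_sub, neg_ne_zero] at hne
      rw [add_comm k l]
      exact Raises.mul hy hx i j hne
    · exact Raises.mul hx hy i j h
  have hsup : ∀ w ∈ graded G hG d 2 ⊔ graded G hG d 1, ∃ u ∈ graded G hG d 2,
      ∃ v ∈ graded G hG d 1, w = u + v := by
    intro w hw
    obtain ⟨u, hu, v, hv, rfl⟩ := Submodule.mem_sup.1 hw
    exact ⟨u, hu, v, hv, rfl⟩
  refine lieIndex_eq_of_reduction (blockHom True G hG (orthogonal d).algebra) (graded G hG d 2)
    (graded G hG d 1) (tailForm G hG d) ?_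
    (fun m => tailForm_eq_zero G hG (by omega) (blockHom_mem_graded G hG _ m)) ?_ ?_
  · intro m hm
    obtain ⟨u, hu, v, hv, huv⟩ := hsup _ hm
    refine eq_zero_of_blocks G fun i j hij => ?_
    rw [← coe_blockHom True G hG, huv]
    change (u : Matrix (Fin d ⊕ J ⊕ Fin d) (Fin d ⊕ J ⊕ Fin d) ℂ) i j +
      (v : Matrix (Fin d ⊕ J ⊕ Fin d) (Fin d ⊕ J ⊕ Fin d) ℂ) i j = 0
    have h1 := not_not.1 fun h => absurd (hu i j h) (by omega)
    have h2 := not_not.1 fun h => absurd (hv i j h) (by omega)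
    rw [h1, h2, add_zero]
  · intro φ hφ
    have h2 : ∀ b b' : Fin d, ext φ (single (.inl b) (.inr (.inr b')) 1) =
        if b' = Fin.rev b then 1 else 0 := by
      intro b b'
      rw [← ext_tailForm_single G hG, ext_apply, ext_apply]
      exact hφ _ (Submodule.mem_sup_left (sk_single_mem_graded G hG two_pos (by simp)))
    have h1 : ∀ w ∈ graded G hG d 1, φ w = 0 := fun w hw =>
      (hφ w (Submodule.mem_sup_right hw)).trans (tailForm_eq_zero G hG (by omega) hw)
    refine ⟨fun x hx => exists_decomposition h2 hx, fun w hw v hv => ?_,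
      fun m v hv => apply_lie_blockHom h2 m hv, fun w hw m => ?_,
      fun w hw h0 => eq_zero_of_lie_middle h2 hw h0, fun v hv h0 => eq_zero_of_lie_top h2 hv h0⟩
    · have : ⁅w, v⁆ = 0 := Subtype.ext (Raises.eq_zero (lie_mem hw hv) le_rfl)
      rw [this, map_zero]
    · exact h1 _ (lie_mem hw (blockHom_mem_graded G hG _ m))
  · intro φ
    let S : Matrix (Fin d) (Fin d) ℂ :=
      of fun b b' : Fin d => ext φ (single (.inl b) (.inr (.inr b')) 1)
    set Q := antidiagonalMatrix d
    have hQ : Q * Q = 1 := antidiagonalMatrix_mul_self d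
    -- Since `Q² = 1`, the matrix `S + t Q = (S Q + t) Q` is invertible for all but finitely many
    -- `t`.
    refine (finite_det_add_smul_one_eq_zero (S * Q)).subset fun t ht => ?_
    by_contra hdet
    have hdet : (S * Q + t • (1 : Matrix (Fin d) (Fin d) ℂ)).det ≠ 0 := hdet
    refine ht ?_
    have hdet' : (of fun b b' : Fin d => ext (φ + t • tailForm G hG d)
        (single (.inl b) (.inr (.inr b')) 1)).det ≠ 0 := by
      have hmat : (of fun b b' : Fin d => ext (φ + t • tailForm G hG d)
          (single (.inl b) (.inr (.inr b')) 1)) = S + t • Q := by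
        ext b b'
        change ext φ _ + t * ext (tailForm G hG d) _ = ext φ _ + t * _
        rw [ext_tailForm_single]
        rfl
      intro h0
      refine hdet ?_
      rw [← hQ, ← Matrix.smul_mul, ← add_mul, det_mul, ← hmat, h0, zero_mul]
    obtain ⟨e₁, he₁⟩ := exists_conj_top G hG (φ + t • tailForm G hG d) hdet'
    set χ : Dual ℂ (extension d True G hG).algebra :=
      (φ + t • tailForm G hG d) ∘ₗ
        (e₁ : (extension d True G hG).algebra →ₗ[ℂ] (extension d True G hG).algebra) with hχ
    have htop : ∀ v ∈ graded G hG d 2, χ v = tailForm G hG d v := by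
      intro v hv
      rw [← sub_eq_zero]
      refine eq_zero_on_top G hG (ψ := χ - tailForm G hG d) (fun b b' => ?_) hv
      rw [LinearMap.sub_apply, sub_eq_zero]
      exact (he₁ b b').trans (ext_tailForm_single G hG b b').symm
    -- With the top normalised, the exponential of `w` changes the form on degree one by `v ↦ φ₁ [w,
    -- v]`, where `φ₁` is `tailForm`. Nondegeneracy of degree one allows `w` to be chosen so that
    -- this cancels the degree-one part.
    let T : graded G hG d 1 →ₗ[ℂ] Dual ℂ (graded G hG d 1) :=
      (kirillovForm ℂ _ (tailForm G hG d)).compl₁₂ (graded G hG d 1).subtype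
        (graded G hG d 1).subtype
    have hT : Function.Injective T := by
      rw [← LinearMap.ker_eq_bot, Submodule.eq_bot_iff]
      intro w hw
      refine Subtype.ext (eq_zero_of_lie_middle (ext_tailForm_single G hG) w.2 fun x hx => ?_)
      exact LinearMap.congr_fun (LinearMap.mem_ker.1 hw) ⟨x, hx⟩
    obtain ⟨w, hw⟩ := (LinearMap.injective_iff_surjective_of_finrank_eq_finrank
      Subspace.dual_finrank_eq.symm).1 hT (-(χ ∘ₗ (graded G hG d 1).subtype))
    obtain ⟨e₂, h2, h1⟩ := exists_exp G hG w.2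
    refine ⟨e₂.trans e₁, fun x hx => ?_⟩
    obtain ⟨u, hu, v, hv, rfl⟩ := hsup x hx
    change χ (e₂ (u + v)) = _
    rw [map_add, h2 u hu, h1 v hv, map_add, map_add, map_add, htop u hu,
      htop _ (lie_mem w.2 hv), tailForm_eq_zero G hG (by omega) hv]
    have := LinearMap.congr_fun hw ⟨v, hv⟩
    have : tailForm G hG d ⁅(w : (extension d True G hG).algebra), v⁆ = -χ v := this
    rw [this, add_neg_cancel]

end

end SignedPreorder

end TailIndex

/-! ### Block levels of palindromic compositions -/

section Blocks

theorem fullComposition_cons (n c : ℕ) (a : List ℕ) :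
    fullComposition n (c :: a) = c :: (fullComposition (n - c) a ++ [c]) := by
  simp [fullComposition, Nat.sub_sub]

theorem sum_fullComposition {n : ℕ} {a : List ℕ} (h : a.sum ≤ n) :
    (fullComposition n a).sum = 2 * n := by
  simp only [fullComposition, List.sum_append, List.sum_reverse, List.sum_singleton]
  omega

theorem blockIndex_lt_length {l : List ℕ} {i : ℕ} (h : i < l.sum) : blockIndex l i < l.length := by
  induction l generalizing i with
  | nil => simp at h
  | cons c l ih =>
    rw [List.sum_cons] at h
    rw [blockIndex, List.length_cons]
    split_ifs with hc
    · omega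
    · have := ih (i := i - c) (by omega)
      omega

theorem blockIndex_append_of_lt {l l' : List ℕ} {i : ℕ} (h : i < l.sum) :
    blockIndex (l ++ l') i = blockIndex l i := by
  induction l generalizing i with
  | nil => simp at h
  | cons c l ih =>
    rw [List.sum_cons] at h
    rw [List.cons_append, blockIndex, blockIndex]
    split_ifs with hc
    · rfl
    · rw [ih (by omega)]

theorem blockIndex_append_of_le {l l' : List ℕ} {i : ℕ} (h : l.sum ≤ i) :
    blockIndex (l ++ l') i = blockIndex l' (i - l.sum) + l.length := by
  induction l generalizing i with
  | nil => simp
  | cons c l ih =>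
    rw [List.sum_cons] at h
    rw [List.cons_append, blockIndex, List.sum_cons, List.length_cons]
    split_ifs with hc
    · have : l.sum = 0 ∧ i = c := by omega
      omega
    · rw [ih (by omega), Nat.sub_sub, add_assoc]

/-- The block of the position `i` in the palindromic composition attached to `a`. -/
def blockLevel (n : ℕ) (a : List ℕ) (i : ℕ) : ℕ := blockIndex (fullComposition n a) i

theorem blockLevel_nil {n i : ℕ} (h : i < 2 * n) : blockLevel n [] i = 0 := by
  simp [blockLevel, fullComposition, blockIndex, h]

theorem blockLevel_lt {n : ℕ} {a : List ℕ} (ha : a.sum ≤ n) {i : ℕ} (h : i < 2 * n) :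
    blockLevel n a i < (fullComposition n a).length :=
  blockIndex_lt_length (by rwa [sum_fullComposition ha])

theorem blockLevel_cons {n c : ℕ} {a : List ℕ} (ha : (c :: a).sum ≤ n) {i : ℕ} (hi : i < 2 * n) :
    blockLevel n (c :: a) i = if i < c then 0 else if i < 2 * n - c then
      blockLevel (n - c) a (i - c) + 1 else (fullComposition (n - c) a).length + 1 := by
  rw [List.sum_cons] at ha
  have hs := sum_fullComposition (n := n - c) (a := a) (by omega)
  rw [blockLevel, fullComposition_cons, blockIndex]
  split_ifs with h1 h2
  · rfl
  · rw [blockIndex_append_of_lt (by omega), blockLevel]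
  · rw [blockIndex_append_of_le (by omega), blockIndex, if_pos (by omega), zero_add]

theorem blockLevel_mono (n : ℕ) (a : List ℕ) : Monotone (blockLevel n a) := blockIndex_mono _

/-- The composition is a palindrome, so reversing positions reverses the order of the blocks; the
induction peels the outer block off both ends at once. It supplies the mirror axiom of the seaweed
preorder. -/
theorem blockLevel_rev {n : ℕ} {a : List ℕ} (ha : a.sum ≤ n) {i j : ℕ} (hi : i < 2 * n)
    (hj : j < 2 * n) : blockLevel n a (2 * n - 1 - j) ≤ blockLevel n a (2 * n - 1 - i) ↔
      blockLevel n a i ≤ blockLevel n a j := by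
  induction a generalizing n i j with
  | nil =>
    rw [blockLevel_nil hi, blockLevel_nil hj, blockLevel_nil (by omega), blockLevel_nil (by omega)]
  | cons c a ih =>
    have ha' : a.sum ≤ n - c := by
      rw [List.sum_cons] at ha
      omega
    have hc : c ≤ n := by
      rw [List.sum_cons] at ha
      omega
    have bound : ∀ k, k < 2 * (n - c) →
        blockLevel (n - c) a k < (fullComposition (n - c) a).length := fun k hk =>
      blockLevel_lt ha' hk
    by_cases hi' : c ≤ i ∧ i < 2 * n - c
    · have bi := bound (i - c) (by omega)
      have bi' := bound (2 * n - 1 - i - c) (by omega)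
      by_cases hj' : c ≤ j ∧ j < 2 * n - c
      · have := ih ha' (i := i - c) (j := j - c) (by omega) (by omega)
        have e1 : 2 * (n - c) - 1 - (i - c) = 2 * n - 1 - i - c := by omega
        have e2 : 2 * (n - c) - 1 - (j - c) = 2 * n - 1 - j - c := by omega
        rw [e1, e2] at this
        rw [blockLevel_cons ha hi, blockLevel_cons ha hj, blockLevel_cons ha (by omega),
          blockLevel_cons ha (by omega)]
        split_ifs <;> omega
      · rw [blockLevel_cons ha hi, blockLevel_cons ha hj, blockLevel_cons ha (by omega),
          blockLevel_cons ha (by omega)]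
        split_ifs <;> omega
    · by_cases hj' : c ≤ j ∧ j < 2 * n - c
      · have bj := bound (j - c) (by omega)
        have bj' := bound (2 * n - 1 - j - c) (by omega)
        rw [blockLevel_cons ha hi, blockLevel_cons ha hj, blockLevel_cons ha (by omega),
          blockLevel_cons ha (by omega)]
        split_ifs <;> omega
      · rw [blockLevel_cons ha hi, blockLevel_cons ha hj, blockLevel_cons ha (by omega),
          blockLevel_cons ha (by omega)]
        split_ifs <;> omega

theorem isAdmissible_iff_blockLevel {n : ℕ} {a b : List ℕ} {i j : Fin (2 * n)} :
    IsAdmissible n a b i j ↔ blockLevel n a i ≤ blockLevel n a j ∧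
      blockLevel n b j ≤ blockLevel n b i := isAdmissible_iff n a b i j

end Blocks

/-! ### Isomorphisms of signed preorders -/

namespace SignedPreorder

/-- Isomorphic signed preorders have algebras of the same index. -/
theorem lieIndex_congr {I I' : Type*} [Fintype I] [DecidableEq I] [Fintype I'] [DecidableEq I']
    (F : SignedPreorder I) (F' : SignedPreorder I') (e : I' ≃ I)
    (hσ : ∀ i, e (F'.σ i) = F.σ (e i)) (hε : ∀ i j, F'.ε i * F'.ε j = F.ε (e i) * F.ε (e j))
    (hR : ∀ i j, F'.R i j ↔ F.R (e i) (e j)) : lieIndex ℂ F.algebra = lieIndex ℂ F'.algebra := by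
  have hσ' : ∀ i, e.symm (F.σ i) = F'.σ (e.symm i) := fun i => by
    rw [e.symm_apply_eq, hσ, e.apply_symm_apply]
  let f : F.algebra ≃ₗ⁅ℂ⁆ F'.algebra :=
    { toFun := fun x => ⟨(x : Matrix I I ℂ).submatrix e e, by
        ext i j
        have := congrFun (congrFun (adj_coe x) (e i)) (e j)
        rw [adj_apply, ← hε, ← hσ, ← hσ] at this
        exact this, fun i j h => supp_coe x _ _ fun h' => h ((hR i j).2 h')⟩
      map_add' := fun _ _ => rfl
      map_smul' := fun _ _ => rfl
      map_lie' := by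
        intro x y
        apply Subtype.ext
        change ((x : Matrix I I ℂ) * y - y * x).submatrix e e =
          (x : Matrix I I ℂ).submatrix e e * (y : Matrix I I ℂ).submatrix e e -
            (y : Matrix I I ℂ).submatrix e e * (x : Matrix I I ℂ).submatrix e e
        rw [Matrix.submatrix_mul_equiv, Matrix.submatrix_mul_equiv]
        rfl
      invFun := fun x => ⟨(x : Matrix I' I' ℂ).submatrix e.symm e.symm, by
        ext i j
        have := congrFun (congrFun (adj_coe x) (e.symm i)) (e.symm j)
        rw [adj_apply, hε, e.apply_symm_apply, e.apply_symm_apply, ← hσ', ← hσ'] at this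
        exact this, fun i j h => supp_coe x _ _ fun h' => h (by
          have := (hR _ _).1 h'
          rwa [e.apply_symm_apply, e.apply_symm_apply] at this)⟩
      left_inv := fun x => by
        apply Subtype.ext
        ext i j
        change (x : Matrix I I ℂ) (e (e.symm i)) (e (e.symm j)) = _
        rw [e.apply_symm_apply, e.apply_symm_apply]
      right_inv := fun x => by
        apply Subtype.ext
        ext i j
        change (x : Matrix I' I' ℂ) (e.symm (e i)) (e.symm (e j)) = _
        rw [e.symm_apply_apply, e.symm_apply_apply] }
  exact _root_.lieIndex_congr f

end SignedPreorder

/-! ### Seaweeds as signed preorders: flip, component deletion and tail blocks -/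

section SeaweedOrder

open Matrix

/-- The signed preorder of a seaweed of type C. -/
def seaweedOrder (n : ℕ) (a b : List ℕ) (ha : a.sum ≤ n) (hb : b.sum ≤ n) :
    SignedPreorder (Fin (2 * n)) where
  σ := Fin.rev
  ε i := if (i : ℕ) < n then 1 else -1
  R := IsAdmissible n a b
  σ_σ := Fin.rev_rev
  ε_mul_self i := by split_ifs <;> norm_num
  ε_σ i j := by
    rw [Fin.val_rev, Fin.val_rev]
    have := i.2
    have := j.2
    split_ifs <;> first | omega | norm_num
  refl i := Or.inl ⟨le_rfl, rfl⟩
  trans := IsAdmissible.trans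
  R_σ {i j} h := by
    rw [isAdmissible_iff_blockLevel] at h ⊢
    rw [Fin.val_rev, Fin.val_rev, Nat.sub_add_eq, Nat.sub_add_eq, Nat.sub_right_comm,
      Nat.sub_right_comm _ _ 1, blockLevel_rev ha i.2 j.2, blockLevel_rev hb j.2 i.2]
    exact h

theorem seaweedC_eq {n : ℕ} {a b : List ℕ} (ha : a.sum ≤ n) (hb : b.sum ≤ n) :
    seaweedC n a b = (seaweedOrder n a b ha hb).algebra := by
  ext A
  have hs : ∀ i : Fin (2 * n), (if ((Fin.rev i : Fin (2 * n)) : ℕ) < n then (1 : ℂ) else -1) =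
      -if (i : ℕ) < n then 1 else -1 := by
    intro i
    rw [Fin.val_rev]
    have := i.2
    split_ifs <;> first | omega | norm_num
  have hsq : ∀ i : Fin (2 * n), (if (i : ℕ) < n then (1 : ℂ) else -1) *
      (if (i : ℕ) < n then 1 else -1) = 1 := by
    intro i
    split_ifs <;> norm_num
  have key : A ∈ skewAdjointMatricesLieSubalgebra (symplecticForm n) ↔
      (seaweedOrder n a b ha hb).adj A = -A := by
    rw [mem_skewAdjointMatricesLieSubalgebra, mem_skewAdjointMatricesSubmodule,
      Matrix.IsSkewAdjoint, Matrix.IsAdjointPair, ← Matrix.ext_iff, ← Matrix.ext_iff]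
    have e1 : ∀ i j, (Aᵀ * symplecticForm n) i j =
        -(A (Fin.rev j) i * if (j : ℕ) < n then 1 else -1) := by
      intro i j
      rw [Matrix.mul_apply, Finset.sum_eq_single (Fin.rev j)]
      · rw [transpose_apply, symplecticForm, of_apply, if_pos (Fin.rev_rev j).symm, hs, mul_neg]
      · intro k _ hk
        have : j ≠ Fin.rev k := fun h => hk (by rw [h, Fin.rev_rev])
        simp [symplecticForm, this]
      · exact fun h' => (h' (Finset.mem_univ _)).elim
    have e2 : ∀ i j, (symplecticForm n * -A) i j =
        -((if (i : ℕ) < n then 1 else -1) * A (Fin.rev i) j) := by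
      intro i j
      rw [Matrix.mul_apply, Finset.sum_eq_single (Fin.rev i)]
      · simp [symplecticForm]
      · intro k _ hk
        simp [symplecticForm, hk]
      · exact fun h' => (h' (Finset.mem_univ _)).elim
    have e3 : ∀ i j, (seaweedOrder n a b ha hb).adj A i j =
        (if (i : ℕ) < n then 1 else -1) * (if (j : ℕ) < n then 1 else -1) *
          A (Fin.rev j) (Fin.rev i) := fun _ _ => rfl
    simp only [e1, e2, e3, Matrix.neg_apply, neg_inj]
    constructor
    · intro h i j
      have := h (Fin.rev i) j
      rw [hs, Fin.rev_rev] at this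
      linear_combination (if (i : ℕ) < n then (1 : ℂ) else -1) * this - A i j * hsq i
    · intro h i j
      have := h (Fin.rev i) j
      rw [hs, Fin.rev_rev] at this
      linear_combination (-(if (i : ℕ) < n then (1 : ℂ) else -1)) * this +
        (-(if (j : ℕ) < n then (1 : ℂ) else -1)) * A (Fin.rev j) i * hsq i
  exact and_congr key Iff.rfl

theorem lieIndex_seaweedC {n : ℕ} {a b : List ℕ} (ha : a.sum ≤ n) (hb : b.sum ≤ n) :
    lieIndex ℂ (seaweedC n a b) = lieIndex ℂ (seaweedOrder n a b ha hb).algebra :=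
  lieIndex_congr (LieEquiv.ofEq _ _ (by rw [seaweedC_eq ha hb]))

theorem seaweedOrder_ε_σ {n : ℕ} {a b : List ℕ} (ha : a.sum ≤ n) (hb : b.sum ≤ n)
    (i : Fin (2 * n)) : (seaweedOrder n a b ha hb).ε ((seaweedOrder n a b ha hb).σ i) =
      -(seaweedOrder n a b ha hb).ε i := by
  change (if ((Fin.rev i : Fin (2 * n)) : ℕ) < n then (1 : ℂ) else -1) =
    -if (i : ℕ) < n then 1 else -1
  rw [Fin.val_rev]
  have := i.2
  split_ifs <;> first | omega | norm_num

/-- Reversal of the positions turns the preorder into its opposite, which exchanges the roles of `a`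
and `b`. It flips all signs at once, leaving their products unchanged. -/
theorem lieIndex_seaweedC_comm {n : ℕ} {a b : List ℕ} (ha : a.sum ≤ n) (hb : b.sum ≤ n) :
    lieIndex ℂ (seaweedC n a b) = lieIndex ℂ (seaweedC n b a) := by
  rw [lieIndex_seaweedC ha hb, lieIndex_seaweedC hb ha]
  refine SignedPreorder.lieIndex_congr _ _ Fin.revPerm (fun _ => rfl)
    (fun i j => ((seaweedOrder n a b ha hb).ε_σ i j).symm) fun i j => ?_
  rw [Fin.revPerm_apply, Fin.revPerm_apply]
  refine Iff.trans ?_ ((seaweedOrder n a b ha hb).R_σ_iff (i := i) (j := j)).symm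
  change IsAdmissible n b a i j ↔ IsAdmissible n a b j i
  rw [isAdmissible_iff_blockLevel, isAdmissible_iff_blockLevel, and_comm]

/-- The index of a symplectic Lie algebra. -/
theorem lieIndex_seaweedC_nil (n : ℕ) : lieIndex ℂ (seaweedC n [] []) = n := by
  rw [lieIndex_seaweedC (Nat.zero_le _) (Nat.zero_le _),
    SignedPreorder.lieIndex_of_rel_true _ (fun _ => rfl)]
  · omega
  · intro i j
    refine isAdmissible_iff_blockLevel.2 ?_
    rw [blockLevel_nil i.2, blockLevel_nil j.2]
    exact ⟨le_rfl, le_rfl⟩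

/-- Positions split into an initial segment, a middle part and a final segment. -/
noncomputable def splitEquiv {n c : ℕ} (hc : c ≤ n) :
    Fin c ⊕ Fin (2 * (n - c)) ⊕ Fin c ≃ Fin (2 * n) :=
  Equiv.ofBijective (fun
    | .inl i => ⟨i, by omega⟩
    | .inr (.inl i) => ⟨i + c, by omega⟩
    | .inr (.inr i) => ⟨2 * n - 1 - i, by omega⟩) (by
    rw [Fintype.bijective_iff_injective_and_card]
    refine ⟨?_, ?_⟩
    · rintro (i | i | i) (j | j | j) h
      all_goals
        have h := congrArg Fin.val h
        have := i.2
        have := j.2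
        simp at h
      · exact congrArg _ (Fin.ext h)
      · omega
      · omega
      · omega
      · exact congrArg _ (congrArg _ (Fin.ext h))
      · omega
      · omega
      · omega
      · exact congrArg _ (congrArg _ (Fin.ext (by omega)))
    · simp
      omega)

/-- The relations not listed are mirror images of listed ones. The proposition `p` is false for a
component deletion and true for a tail block. -/
theorem lieIndex_seaweedC_of_split {n c : ℕ} {a b a' b' : List ℕ} (hc : c ≤ n) (ha : a.sum ≤ n)
    (hb : b.sum ≤ n) (ha' : a'.sum ≤ n - c) (hb' : b'.sum ≤ n - c) (p : Prop)
    (h1 : ∀ i j : Fin c, IsAdmissible n a b (splitEquiv hc (.inl i)) (splitEquiv hc (.inl j)))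
    (h2 : ∀ (i : Fin c) j,
      IsAdmissible n a b (splitEquiv hc (.inl i)) (splitEquiv hc (.inr (.inl j))) ↔ p)
    (h3 : ∀ i j : Fin c,
      IsAdmissible n a b (splitEquiv hc (.inl i)) (splitEquiv hc (.inr (.inr j))) ↔ p)
    (h4 : ∀ i (j : Fin c),
      ¬ IsAdmissible n a b (splitEquiv hc (.inr (.inl i))) (splitEquiv hc (.inl j)))
    (h5 : ∀ i j : Fin c,
      ¬ IsAdmissible n a b (splitEquiv hc (.inr (.inr i))) (splitEquiv hc (.inl j)))
    (h6 : ∀ i j,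
      IsAdmissible n a b (splitEquiv hc (.inr (.inl i))) (splitEquiv hc (.inr (.inl j))) ↔
      IsAdmissible (n - c) a' b' i j) :
    lieIndex ℂ (seaweedC n a b) = lieIndex ℂ (SignedPreorder.extension c p
      (seaweedOrder (n - c) a' b' ha' hb') (seaweedOrder_ε_σ ha' hb')).algebra := by
  have hσ : ∀ i, splitEquiv hc ((SignedPreorder.extension c p (seaweedOrder (n - c) a' b' ha' hb')
      (seaweedOrder_ε_σ ha' hb')).σ i) = Fin.rev (splitEquiv hc i) := by
    rintro (i | i | i)
    · exact Fin.ext (by rw [Fin.val_rev]; change 2 * n - 1 - (i : ℕ) = 2 * n - (i + 1); omega)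
    · refine Fin.ext ?_
      rw [Fin.val_rev]
      change ((Fin.rev i : Fin _) : ℕ) + c = 2 * n - (i + c + 1)
      rw [Fin.val_rev]
      omega
    · exact Fin.ext (by rw [Fin.val_rev]; change (i : ℕ) = 2 * n - (2 * n - 1 - i + 1); omega)
  have hR := fun i j => (seaweedOrder n a b ha hb).R_σ_iff (i := i) (j := j)
  rw [lieIndex_seaweedC ha hb]
  refine SignedPreorder.lieIndex_congr _ _ (splitEquiv hc) hσ ?_ ?_
  · have hε : ∀ i, (SignedPreorder.extension c p (seaweedOrder (n - c) a' b' ha' hb')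
        (seaweedOrder_ε_σ ha' hb')).ε i = (seaweedOrder n a b ha hb).ε (splitEquiv hc i) := by
      rintro (i | i | i)
      · exact (if_pos (show (i : ℕ) < n by omega)).symm
      · change (if (i : ℕ) < n - c then (1 : ℂ) else -1) = if (i : ℕ) + c < n then 1 else -1
        split_ifs <;> first | rfl | omega
      · exact (if_neg (show ¬ 2 * n - 1 - (i : ℕ) < n by omega)).symm
    intro i j
    rw [hε, hε]
  · have mirror : ∀ i j, IsAdmissible n a b (splitEquiv hc i) (splitEquiv hc j) ↔
        IsAdmissible n a b (Fin.rev (splitEquiv hc j)) (Fin.rev (splitEquiv hc i)) :=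
      fun i j => (hR _ _).symm
    rintro (i | i | i) (j | j | j)
    · exact iff_of_true trivial (h1 i j)
    · exact (h2 i j).symm
    · exact (h3 i j).symm
    · exact iff_of_false id (h4 i j)
    · exact (h6 i j).symm
    · refine Iff.trans ?_ (mirror _ _).symm
      rw [← hσ, ← hσ]
      exact (h2 _ _).symm
    · exact iff_of_false id (h5 i j)
    · refine Iff.trans ?_ (mirror _ _).symm
      rw [← hσ, ← hσ]
      exact iff_of_false id (h4 _ _)
    · refine Iff.trans ?_ (mirror _ _).symm
      rw [← hσ, ← hσ]
      exact iff_of_true trivial (h1 _ _)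

/-- The first `c` positions have the lowest level for both compositions, while admissibility asks
the two levels to move in opposite directions; so they are incomparable with all others and `gl_c`
splits off. -/
theorem lieIndex_seaweedC_deletion {n c : ℕ} {a b : List ℕ} (ha : (c :: a).sum ≤ n)
    (hb : (c :: b).sum ≤ n) :
    lieIndex ℂ (seaweedC n (c :: a) (c :: b)) = c + lieIndex ℂ (seaweedC (n - c) a b) := by
  have ha' : a.sum ≤ n - c := by rw [List.sum_cons] at ha; omega
  have hb' : b.sum ≤ n - c := by rw [List.sum_cons] at hb; omega
  have hc : c ≤ n := by rw [List.sum_cons] at ha; omega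
  rw [lieIndex_seaweedC ha' hb', ← SignedPreorder.lieIndex_extension_false,
    lieIndex_seaweedC_of_split hc ha hb ha' hb' False]
  all_goals
    intro i j
    have := i.2
    have := j.2
    rw [isAdmissible_iff_blockLevel, blockLevel_cons ha (Fin.is_lt _),
      blockLevel_cons ha (Fin.is_lt _), blockLevel_cons hb (Fin.is_lt _),
      blockLevel_cons hb (Fin.is_lt _)]
    simp only [splitEquiv, Equiv.ofBijective_apply]
  · split_ifs
    omega
  · rw [iff_false]
    split_ifs <;> omega
  · rw [iff_false]
    split_ifs <;> omega
  · split_ifs <;> omega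
  · split_ifs <;> omega
  · rw [isAdmissible_iff_blockLevel, Nat.add_sub_cancel, Nat.add_sub_cancel]
    split_ifs <;> omega

/-- With `b` empty its level is constant, so the preorder is the order of the levels for `a` and the
first block lies below everything else. -/
theorem lieIndex_seaweedC_tail {n c : ℕ} {a : List ℕ} (ha : (c :: a).sum ≤ n) :
    lieIndex ℂ (seaweedC n (c :: a) []) = c / 2 + lieIndex ℂ (seaweedC (n - c) a []) := by
  have ha' : a.sum ≤ n - c := by rw [List.sum_cons] at ha; omega
  have hc : c ≤ n := by rw [List.sum_cons] at ha; omega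
  rw [lieIndex_seaweedC (b := []) ha' (Nat.zero_le _), ← SignedPreorder.lieIndex_extension_true,
    lieIndex_seaweedC_of_split (b := []) (b' := []) hc ha (Nat.zero_le _) ha' (Nat.zero_le _) True]
  all_goals
    intro i j
    have := i.2
    have := j.2
    rw [isAdmissible_iff_blockLevel, blockLevel_cons ha (Fin.is_lt _),
      blockLevel_cons ha (Fin.is_lt _), blockLevel_nil (Fin.is_lt _),
      blockLevel_nil (Fin.is_lt _)]
    simp only [splitEquiv, Equiv.ofBijective_apply]
  · split_ifs
    omega
  · rw [iff_true]
    split_ifs <;> omega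
  · rw [iff_true]
    split_ifs <;> omega
  · split_ifs <;> omega
  · split_ifs <;> omega
  · rw [isAdmissible_iff_blockLevel, Nat.add_sub_cancel, Nat.add_sub_cancel, blockLevel_nil i.2,
      blockLevel_nil j.2]
    split_ifs <;> omega

end SeaweedOrder

/-! ### The winding moves as foldings -/

section Winding

namespace SignedPreorder

variable {n N x y : ℕ} {F : SignedPreorder (Fin (2 * n))} {G : SignedPreorder (Fin (2 * N))}
  {π : Fin (2 * n) → Fin (2 * N)} {α β : Fin (2 * n) → ℕ} {α' β' : Fin (2 * N) → ℕ} {A C : ℕ}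

set_option maxHeartbeats 1000000 in
/-- The folding behind the rotation contraction. -/
theorem Folding.of_rotation (hyx : y < x) (hxy : x < 2 * y) (hxn : x ≤ n) (hN : N + x = n + y)
    (hA : 0 < A) (hC : 0 < C)
    (hFσ : ∀ i, (F.σ i : ℕ) + i + 1 = 2 * n) (hGσ : ∀ i, (G.σ i : ℕ) + i + 1 = 2 * N)
    (hFε : ∀ i, F.ε i = if (i : ℕ) < n then 1 else -1)
    (hGε : ∀ i, G.ε i = if (i : ℕ) < N then 1 else -1)
    (hF : ∀ i j, F.R i j ↔ α i ≤ α j ∧ β j ≤ β i)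
    (hG : ∀ i j, G.R i j ↔ α' i ≤ α' j ∧ β' j ≤ β' i)
    (hα : ∀ i : Fin (2 * n), ((i : ℕ) < x ∧ α i = 0) ∨
      (x ≤ i ∧ i + x < 2 * n ∧ 0 < α i ∧ α i < A) ∨ (2 * n ≤ i + x ∧ α i = A))
    (hβ : ∀ i : Fin (2 * n), ((i : ℕ) < y ∧ β i = 0) ∨
      (y ≤ i ∧ i + y < 2 * n ∧ 0 < β i ∧ β i < C) ∨ (2 * n ≤ i + y ∧ β i = C))
    (hα' : ∀ i : Fin (2 * N), ((i : ℕ) < y ∧ α' i = 0) ∨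
      (y ≤ i ∧ i + y < 2 * N ∧ 0 < α' i ∧ α' i < A) ∨ (2 * N ≤ i + y ∧ α' i = A))
    (hβ' : ∀ i : Fin (2 * N), ((i : ℕ) + x < 2 * y ∧ β' i = 0) ∨
      (2 * y ≤ i + x ∧ i + 2 * y < 2 * N + x ∧ 0 < β' i ∧ β' i < C) ∨
      (2 * N + x ≤ i + 2 * y ∧ β' i = C))
    (hπ : ∀ i : Fin (2 * n), ((i : ℕ) < y ∧ (π i : ℕ) = i) ∨
      (y ≤ i ∧ i + y < 2 * n ∧ (π i : ℕ) + x = i + y) ∨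
      (2 * n ≤ i + y ∧ (π i : ℕ) + 2 * x = i + 2 * y))
    (hπα : ∀ i, α' (π i) = α i)
    (hπβ : ∀ i : Fin (2 * n), y ≤ i → i + y < 2 * n → β' (π i) = β i) :
    Folding F G (fun i => (i : ℕ) < y) π := by
  have map_σ : ∀ i, π (F.σ i) = G.σ (π i) := fun i => by
    have := hFσ i
    have := hGσ (π i)
    have := hπ i
    have := hπ (F.σ i)
    exact Fin.ext (by omega)
  -- The levels for `a` agree here, so the relation is lost because the new level of `j` for `b`
  -- exceeds that of `i`. Then `j ≥ 2y - x` has the partner `d = j + (x - y)` outside `B`, and no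
  -- partner of `i` outside `B` is related to `d`.
  have kill : ∀ i j : Fin (2 * n), (i : ℕ) < y → (j : ℕ) < y → ¬ G.R (π i) (π j) →
      ∃ d b : Fin (2 * n), ¬ (d : ℕ) < y ∧ (b : ℕ) < y ∧ F.R d b ∧ π b = π i ∧ π d = π j ∧
        i = b ∧ ∀ k : Fin (2 * n), ¬ (k : ℕ) < y → π k = π b → ¬ F.R k d := by
    intro i j hi hj h
    rw [hG, hπα, hπα] at h
    have ai := hα i
    have aj := hα j
    have bi := hβ' (π i)
    have bj := hβ' (π j)
    have pj := hπ j
    have pi := hπ i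
    let d : Fin (2 * n) := ⟨j + (x - y), by omega⟩
    have hd : (d : ℕ) = j + (x - y) := rfl
    have ad := hα d
    have pd := hπ d
    have hdj : π d = π j := Fin.ext (by omega)
    have bd := hπβ d (by omega) (by omega)
    rw [hdj] at bd
    refine ⟨d, i, by omega, hi, (hF _ _).2 ⟨by omega, ?_⟩, rfl, hdj, rfl, fun k hk hki hR => ?_⟩
    · have := hβ i
      omega
    · have pk := hπ k
      rw [hki] at pk
      have bk := hπβ k (by omega) (by omega)
      rw [hki] at bk
      have := (hF _ _).1 hR
      omega
  have row : ∀ {i j : Fin (2 * n)}, (i : ℕ) < y → F.R i j → (j : ℕ) < y := by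
    intro i j hi hR
    have := (hF _ _).1 hR
    have := hβ i
    have := hβ j
    have := i.2
    omega
  have full : ∀ {i j : Fin (2 * n)}, (i : ℕ) < y → (j : ℕ) < y → F.R i j := by
    intro i j hi hj
    refine (hF _ _).2 ?_
    have := hβ i
    have := hβ j
    have := hα i
    have := hα j
    have := i.2
    have := j.2
    omega
  have iso : ∀ {i j : Fin (2 * n)}, (i : ℕ) < y → (j : ℕ) < y → ¬ F.R (F.σ i) j := by
    intro i j hi hj hR
    have := (hF _ _).1 hR
    have := hα (F.σ i)
    have := hFσ i
    have := hα j
    omega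
  have map_ε : ∀ i, G.ε (π i) = F.ε i := fun i => by
    rw [hFε, hGε]
    have := hπ i
    congr 1
    rw [eq_iff_iff]
    omega
  have inj : ∀ {i j : Fin (2 * n)}, ((i : ℕ) < y ↔ (j : ℕ) < y) →
      ((F.σ i : ℕ) < y ↔ (F.σ j : ℕ) < y) → π i = π j → i = j := by
    intro i j h1 h2 h
    have := hπ i
    have := hπ j
    have := hFσ i
    have := hFσ j
    have := congrArg Fin.val h
    exact Fin.ext (by omega)
  have rel_of_eq : ∀ {i j : Fin (2 * n)}, ¬ (i : ℕ) < y → (j : ℕ) < y → π i = π j → F.R i j := by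
    intro i j hi hj h
    have := hπ i
    have := hπ j
    have := hα i
    have := hα j
    have := hβ j
    have := congrArg Fin.val h
    have := i.2
    have := j.2
    exact (hF _ _).2 (by omega)
  have matched : ∀ {d b : Fin (2 * n)}, ¬ (d : ℕ) < y → (b : ℕ) < y → F.R d b →
      (∃ k : Fin (2 * n), (k : ℕ) < y ∧ π k = π d) ∨
      ∃ k : Fin (2 * n), ¬ (k : ℕ) < y ∧ π k = π b ∧ F.R k d := by
    intro d b hd hb hR
    have := (hF _ _).1 hR
    have := hα d
    have := hα b
    -- A relation from `d` into `B` forces `d < x`, so in a rotation the partner of `d` always lies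
    -- in `B`.
    let k : Fin (2 * n) := ⟨d - (x - y), by omega⟩
    have hk : (k : ℕ) = d - (x - y) := rfl
    have := hπ k
    have := hπ d
    exact Or.inl ⟨k, by omega, Fin.ext (by omega)⟩
  have rel_of_map : ∀ {i j : Fin (2 * n)}, ((i : ℕ) < y ↔ (j : ℕ) < y) →
      ((F.σ i : ℕ) < y ↔ (F.σ j : ℕ) < y) → G.R (π i) (π j) → F.R i j := by
    intro i j h1 h2 h
    have h := (hG _ _).1 h
    rw [hπα, hπα] at h
    refine (hF _ _).2 ⟨h.1, ?_⟩
    have := hβ i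
    have := hβ j
    have := hFσ i
    have := hFσ j
    by_cases hi : y ≤ i ∧ i + y < 2 * n
    · rw [hπβ i hi.1 hi.2, hπβ j (by omega) (by omega)] at h
      exact h.2
    · omega
  have exists_mid : ∀ {i j : Fin (2 * n)} {l : Fin (2 * N)}, ((i : ℕ) < y ↔ (j : ℕ) < y) →
      ((F.σ i : ℕ) < y ↔ (F.σ j : ℕ) < y) → G.R (π i) l → G.R l (π j) →
      ∃ k : Fin (2 * n), ((i : ℕ) < y ↔ (k : ℕ) < y) ∧
        ((F.σ i : ℕ) < y ↔ (F.σ k : ℕ) < y) ∧ π k = l := by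
    intro i j l h1 h2 h h'
    have h := (hG _ _).1 h
    have h' := (hG _ _).1 h'
    have si := hFσ i
    have sj := hFσ j
    have pi := hπ i
    have pj := hπ j
    -- The number `t` is the displacement of the part under `π`: `0` on `B`, `x - y` in the middle
    -- and `2 (x - y)` on the mirror image of `B`.
    have lift : ∀ t, l + t < 2 * n → ((i : ℕ) < y ↔ l + t < y) →
        (2 * n ≤ (i : ℕ) + y ↔ 2 * n ≤ l + t + y) →
        ((l + t < y ∧ t = 0) ∨ (y ≤ l + t ∧ l + t + y < 2 * n ∧ t = x - y) ∨
          (2 * n ≤ l + t + y ∧ t = 2 * (x - y))) →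
        ∃ k : Fin (2 * n), ((i : ℕ) < y ↔ (k : ℕ) < y) ∧
          ((F.σ i : ℕ) < y ↔ (F.σ k : ℕ) < y) ∧ π k = l := by
      clear pi pj h h' h1 h2
      intro t ht t1 t2 t3
      have sk := hFσ ⟨l + t, ht⟩
      have pk := hπ ⟨l + t, ht⟩
      dsimp only at sk pk
      exact ⟨⟨l + t, ht⟩, t1, by omega, Fin.ext (by omega)⟩
    rcases pi with ⟨hi, ei⟩ | ⟨hi, hi', ei⟩ | ⟨hi, ei⟩
    · have ai := hα' (π j)
      have al := hα' l
      have hl : (l : ℕ) < y := by omega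
      exact lift 0 (by omega) (by omega) (by omega) (by omega)
    · have hj : y ≤ (j : ℕ) ∧ (j : ℕ) + y < 2 * n ∧ (π j : ℕ) + x = j + y := by omega
      have bi := hβ' (π i)
      have bj := hβ' (π j)
      have bl := hβ' l
      have hl : 2 * y ≤ (l : ℕ) + x ∧ (l : ℕ) + 2 * y < 2 * N + x := by
        clear pj h1 h2 si sj lift
        omega
      clear bi bj bl h h' pj
      exact lift (x - y) (by omega) (by omega) (by omega) (by omega)
    · have ai := hα' (π i)
      have al := hα' l
      have hl : 2 * N ≤ (l : ℕ) + y := by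
        clear pj h1 h2 si sj lift
        omega
      have := l.2
      clear ai al h h' pj
      exact lift (2 * (x - y)) (by omega) (by omega) (by omega) (by omega)
  have exists_rel : ∀ {l l' : Fin (2 * N)}, G.R l l' →
      ∃ i j : Fin (2 * n), ((i : ℕ) < y ↔ (j : ℕ) < y) ∧
      ((F.σ i : ℕ) < y ↔ (F.σ j : ℕ) < y) ∧ π i = l ∧ π j = l' := by
    intro l l' h
    have h := (hG _ _).1 h
    have := hα' l
    have := hα' l'
    have := hβ' l
    have := hβ' l'
    have := l.2
    have := l'.2
    have lift : ∀ t, t = 0 ∨ t = x - y ∨ t = 2 * (x - y) → l + t < 2 * n → l' + t < 2 * n →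
        ((l + t < y ∧ l' + t < y ∧ t = 0) ∨ (y ≤ l + t ∧ l + t + y < 2 * n ∧ y ≤ l' + t ∧
          l' + t + y < 2 * n ∧ t = x - y) ∨
          (2 * n ≤ l + t + y ∧ 2 * n ≤ l' + t + y ∧ t = 2 * (x - y))) →
          ∃ i j : Fin (2 * n), ((i : ℕ) < y ↔ (j : ℕ) < y) ∧
          ((F.σ i : ℕ) < y ↔ (F.σ j : ℕ) < y) ∧ π i = l ∧ π j = l' := by
      intro t ht hl hl' hc
      refine ⟨⟨l + t, hl⟩, ⟨l' + t, hl'⟩, ?_⟩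
      have := hFσ ⟨l + t, hl⟩
      have := hFσ ⟨l' + t, hl'⟩
      have := hπ ⟨l + t, hl⟩
      have := hπ ⟨l' + t, hl'⟩
      dsimp only at *
      refine ⟨by omega, by omega, Fin.ext (by omega), Fin.ext (by omega)⟩
    by_cases c1 : (l' : ℕ) + x < 2 * y
    · exact lift 0 (by omega) (by omega) (by omega) (by omega)
    · by_cases c2 : (l : ℕ) + 2 * y < 2 * N + x ∧ (l' : ℕ) + 2 * y < 2 * N + x
      · exact lift (x - y) (by omega) (by omega) (by omega) (by omega)
      · exact lift (2 * (x - y)) (by omega) (by omega) (by omega) (by omega)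
  have balance : ∀ {d b : Fin (2 * n)}, ¬ (d : ℕ) < y → (b : ℕ) < y → F.R d b → G.R (π b) (π d) →
      ((∃ k : Fin (2 * n), (((k : ℕ) < y ↔ (d : ℕ) < y) ∧
        ((F.σ k : ℕ) < y ↔ (F.σ d : ℕ) < y)) ∧ π k = π b) ↔
        ∃ k : Fin (2 * n), (k : ℕ) < y ∧ π k = π d) := by
    intro d b hd hb hR h
    have hR := (hF _ _).1 hR
    have h := (hG _ _).1 h
    have := hα d
    have := hα b
    have := hβ' (π b)
    have := hβ' (π d)
    have := hπ b
    have pd := hπ d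
    have := hFσ d
    let k : Fin (2 * n) := ⟨d - (x - y), by omega⟩
    have hk : (k : ℕ) = d - (x - y) := rfl
    have := hπ k
    let k' : Fin (2 * n) := ⟨b + (x - y), by omega⟩
    have hk' : (k' : ℕ) = b + (x - y) := rfl
    have := hπ k'
    have := hFσ k'
    exact iff_of_true ⟨k', ⟨by omega, by omega⟩, Fin.ext (by omega)⟩
      ⟨k, by omega, Fin.ext (by omega)⟩
  refine ⟨row, full, iso, map_σ, map_ε, inj, rel_of_eq, matched, rel_of_map, exists_mid, exists_rel,
    balance, fun {i j} h1 h2 hR h => ?_⟩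
  · have h1 : (i : ℕ) < y ↔ (j : ℕ) < y := h1
    have h2 : (F.σ i : ℕ) < y ↔ (F.σ j : ℕ) < y := h2
    by_cases hi : (i : ℕ) < y
    · obtain ⟨d, b, e1, e2, e3, e4, e5, e6, e7⟩ := kill i j hi (h1.1 hi) h
      exact ⟨d, b, e1, e2, e3, Or.inl ⟨e4, e5, Or.inl ⟨e6, e7⟩⟩⟩
    · by_cases hi' : (F.σ i : ℕ) < y
      · rw [← G.R_σ_iff, ← map_σ, ← map_σ] at h
        obtain ⟨d, b, e1, e2, e3, e4, e5, e6, e7⟩ := kill _ _ (h2.1 hi') hi' h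
        exact ⟨d, b, e1, e2, e3, Or.inr ⟨e4, e5, Or.inl ⟨e6, e7⟩⟩⟩
      · have := hFσ i
        have := hFσ j
        refine (h ((hG _ _).2 ?_)).elim
        rw [hπα, hπα, hπβ i (by omega) (by omega), hπβ j (by omega) (by omega)]
        exact (hF _ _).1 hR

set_option maxHeartbeats 1000000 in
/-- The folding behind the block elimination and the pure contraction. -/
theorem Folding.of_contraction (hxy : 2 * y ≤ x) (hxn : x ≤ n) (hN : N + y = n)
    (hA : 0 < A) (hC : 0 < C)
    (hFσ : ∀ i, (F.σ i : ℕ) + i + 1 = 2 * n) (hGσ : ∀ i, (G.σ i : ℕ) + i + 1 = 2 * N)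
    (hFε : ∀ i, F.ε i = if (i : ℕ) < n then 1 else -1)
    (hGε : ∀ i, G.ε i = if (i : ℕ) < N then 1 else -1)
    (hF : ∀ i j, F.R i j ↔ α i ≤ α j ∧ β j ≤ β i)
    (hG : ∀ i j, G.R i j ↔ α' i ≤ α' j ∧ β' j ≤ β' i)
    (hα : ∀ i : Fin (2 * n), ((i : ℕ) < x ∧ α i = 0) ∨
      (x ≤ i ∧ i + x < 2 * n ∧ 0 < α i ∧ α i < A) ∨ (2 * n ≤ i + x ∧ α i = A))
    (hβ : ∀ i : Fin (2 * n), ((i : ℕ) < y ∧ β i = 0) ∨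
      (y ≤ i ∧ i + y < 2 * n ∧ 0 < β i ∧ β i < C) ∨ (2 * n ≤ i + y ∧ β i = C))
    (hβm : Monotone β)
    (hα' : ∀ i : Fin (2 * N), ((i : ℕ) + 2 * y < x ∧ α' i = 0) ∨
      (x ≤ i + 2 * y ∧ i + y < x ∧ α' i = 1) ∨
      (x ≤ i + y ∧ i + x < 2 * N + y ∧ 1 < α' i ∧ α' i ≤ A) ∨
      (2 * N + y ≤ i + x ∧ i + x < 2 * N + 2 * y ∧ α' i = A + 1) ∨
      (2 * N + 2 * y ≤ i + x ∧ α' i = A + 2))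
    (hπ : ∀ i : Fin (2 * n), ((i : ℕ) < y ∧ (π i : ℕ) + 2 * y = i + x) ∨
      (y ≤ i ∧ i + y < 2 * n ∧ (π i : ℕ) + y = i) ∨ (2 * n ≤ i + y ∧ (π i : ℕ) + x = i))
    (hπα : ∀ i : Fin (2 * n), x ≤ i → i + x < 2 * n → α' (π i) = α i + 1)
    (hπβ : ∀ i : Fin (2 * n), y ≤ i → i + y < 2 * n → β i = β' (π i) + 1) :
    Folding F G (fun i => (i : ℕ) < y) π := by
  have map_σ : ∀ i, π (F.σ i) = G.σ (π i) := fun i => by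
    have := hFσ i
    have := hGσ (π i)
    have := hπ i
    have := hπ (F.σ i)
    exact Fin.ext (by omega)
  have kill : ∀ i j : Fin (2 * n), (i : ℕ) < y → (j : ℕ) < y → ¬ G.R (π i) (π j) →
      ∃ d b : Fin (2 * n), ¬ (d : ℕ) < y ∧ (b : ℕ) < y ∧ F.R d b ∧ π b = π i ∧ π d = π j ∧
        i = b ∧ ∀ k : Fin (2 * n), ¬ (k : ℕ) < y → π k = π b → ¬ F.R k d := by
    intro i j hi hj h
    rw [hG] at h
    have ai := hα' (π i)
    have aj := hα' (π j)
    have pj := hπ j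
    have pi := hπ i
    let d : Fin (2 * n) := ⟨j + (x - y), by omega⟩
    have hd : (d : ℕ) = j + (x - y) := rfl
    have ad := hα d
    have pd := hπ d
    have hdj : π d = π j := Fin.ext (by omega)
    have bd := hπβ d (by omega) (by omega)
    rw [hdj] at bd
    refine ⟨d, i, by omega, hi, (hF _ _).2 ⟨by omega, ?_⟩, rfl, hdj, rfl, fun k hk hki hR => ?_⟩
    · have := hβ i
      omega
    · have pk := hπ k
      rw [hki] at pk
      have bk := hπβ k (by omega) (by omega)
      rw [hki] at bk
      have := (hF _ _).1 hR
      omega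
  -- The block `x` is cut into pieces of lengths `x - 2y` and `y`. What is lost are the relations
  -- from `i ≥ x - y`, which has the partner `b = i - (x - y)` in `B`, to `j < x - y`, which has
  -- none; the slot `(j, b)` then kills the entry.
  have kill' : ∀ i j : Fin (2 * n), y ≤ (i : ℕ) → (i : ℕ) < x → (j : ℕ) < x → y ≤ (j : ℕ) →
      ¬ α' (π i) ≤ α' (π j) →
      ∃ d b : Fin (2 * n), ¬ (d : ℕ) < y ∧ (b : ℕ) < y ∧ F.R d b ∧ π b = π i ∧ π d = π j ∧
        j = d ∧ ∀ k : Fin (2 * n), (k : ℕ) < y → π k ≠ π d := by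
    intro i j hi hi' hj hj' h
    have ai := hα' (π i)
    have aj := hα' (π j)
    have pj := hπ j
    have pi := hπ i
    let b : Fin (2 * n) := ⟨i - (x - y), by omega⟩
    have hb : (b : ℕ) = i - (x - y) := rfl
    have pb := hπ b
    refine ⟨j, b, by omega, by omega, (hF _ _).2 ⟨?_, ?_⟩, Fin.ext (by omega), rfl, rfl,
      fun k hk hkj => ?_⟩
    · have := hα j
      omega
    · have := hβ b
      omega
    · have pk := hπ k
      rw [hkj] at pk
      omega
  have row : ∀ {i j : Fin (2 * n)}, (i : ℕ) < y → F.R i j → (j : ℕ) < y := by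
    intro i j hi hR
    have := (hF _ _).1 hR
    have := hβ i
    have := hβ j
    have := i.2
    omega
  have full : ∀ {i j : Fin (2 * n)}, (i : ℕ) < y → (j : ℕ) < y → F.R i j := by
    intro i j hi hj
    refine (hF _ _).2 ?_
    have := hβ i
    have := hβ j
    have := hα i
    have := hα j
    have := i.2
    have := j.2
    omega
  have iso : ∀ {i j : Fin (2 * n)}, (i : ℕ) < y → (j : ℕ) < y → ¬ F.R (F.σ i) j := by
    intro i j hi hj hR
    have := (hF _ _).1 hR
    have := hα (F.σ i)
    have := hFσ i
    have := hα j
    omega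
  have map_ε : ∀ i, G.ε (π i) = F.ε i := fun i => by
    rw [hFε, hGε]
    have := hπ i
    congr 1
    rw [eq_iff_iff]
    omega
  have inj : ∀ {i j : Fin (2 * n)}, ((i : ℕ) < y ↔ (j : ℕ) < y) →
      ((F.σ i : ℕ) < y ↔ (F.σ j : ℕ) < y) → π i = π j → i = j := by
    intro i j h1 h2 h
    have := hπ i
    have := hπ j
    have := hFσ i
    have := hFσ j
    have := congrArg Fin.val h
    exact Fin.ext (by omega)
  have rel_of_eq : ∀ {i j : Fin (2 * n)}, ¬ (i : ℕ) < y → (j : ℕ) < y → π i = π j → F.R i j := by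
    intro i j hi hj h
    have := hπ i
    have := hπ j
    have := hα i
    have := hα j
    have := hβ j
    have := congrArg Fin.val h
    have := i.2
    have := j.2
    exact (hF _ _).2 (by omega)
  have matched : ∀ {d b : Fin (2 * n)}, ¬ (d : ℕ) < y → (b : ℕ) < y → F.R d b →
      (∃ k : Fin (2 * n), (k : ℕ) < y ∧ π k = π d) ∨
      ∃ k : Fin (2 * n), ¬ (k : ℕ) < y ∧ π k = π b ∧ F.R k d := by
    intro d b hd hb hR
    have := (hF _ _).1 hR
    have := hα d
    have := hα b
    -- Unlike in a rotation, `d` may have no partner in `B`; then the partner `b + (x - y)` of `b`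
    -- serves.
    by_cases hc : (d : ℕ) < x - y
    · let k : Fin (2 * n) := ⟨b + (x - y), by omega⟩
      have hk : (k : ℕ) = b + (x - y) := rfl
      have := hπ k
      have := hπ b
      have := hα k
      exact Or.inr ⟨k, by omega, Fin.ext (by omega), (hF _ _).2 ⟨by omega,
        hβm (Fin.le_def.2 (by omega))⟩⟩
    · let k : Fin (2 * n) := ⟨d - (x - y), by omega⟩
      have hk : (k : ℕ) = d - (x - y) := rfl
      have := hπ k
      have := hπ d
      exact Or.inl ⟨k, by omega, Fin.ext (by omega)⟩
  have rel_of_map : ∀ {i j : Fin (2 * n)}, ((i : ℕ) < y ↔ (j : ℕ) < y) →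
      ((F.σ i : ℕ) < y ↔ (F.σ j : ℕ) < y) → G.R (π i) (π j) → F.R i j := by
    intro i j h1 h2 h
    have h := (hG _ _).1 h
    refine (hF _ _).2 ?_
    have := hβ i
    have := hβ j
    have := hα i
    have := hα j
    have := hFσ i
    have := hFσ j
    by_cases hi : y ≤ i ∧ i + y < 2 * n
    · have := hπβ i hi.1 hi.2
      have := hπβ j (by omega) (by omega)
      have := hα' (π i)
      have := hα' (π j)
      have := hπ i
      have := hπ j
      have := hπα i
      have := hπα j
      refine ⟨?_, by omega⟩
      by_cases ci : x ≤ i ∧ i + x < 2 * n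
      · have := hπα i ci.1 ci.2
        by_cases cj : x ≤ j ∧ j + x < 2 * n
        · have := hπα j cj.1 cj.2
          omega
        · omega
      · by_cases cj : x ≤ j ∧ j + x < 2 * n
        · have := hπα j cj.1 cj.2
          omega
        · omega
    · omega
  have exists_mid : ∀ {i j : Fin (2 * n)} {l : Fin (2 * N)}, ((i : ℕ) < y ↔ (j : ℕ) < y) →
      ((F.σ i : ℕ) < y ↔ (F.σ j : ℕ) < y) → G.R (π i) l → G.R l (π j) →
      ∃ k : Fin (2 * n), ((i : ℕ) < y ↔ (k : ℕ) < y) ∧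
        ((F.σ i : ℕ) < y ↔ (F.σ k : ℕ) < y) ∧ π k = l := by
    intro i j l h1 h2 h h'
    have h := (hG _ _).1 h
    have h' := (hG _ _).1 h'
    have si := hFσ i
    have sj := hFσ j
    have pi := hπ i
    have pj := hπ j
    have lift : ∀ t, t < 2 * n → ((i : ℕ) < y ↔ t < y) →
        (2 * n ≤ (i : ℕ) + y ↔ 2 * n ≤ t + y) →
        ((t < y ∧ t + x = l + 2 * y) ∨ (y ≤ t ∧ t + y < 2 * n ∧ t = l + y) ∨
          (2 * n ≤ t + y ∧ t = l + x)) →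
        ∃ k : Fin (2 * n), ((i : ℕ) < y ↔ (k : ℕ) < y) ∧
          ((F.σ i : ℕ) < y ↔ (F.σ k : ℕ) < y) ∧ π k = l := by
      clear pi pj h h' h1 h2
      intro t ht t1 t2 t3
      have sk := hFσ ⟨t, ht⟩
      have pk := hπ ⟨t, ht⟩
      dsimp only at sk pk
      exact ⟨⟨t, ht⟩, t1, by omega, Fin.ext (by omega)⟩
    have ai := hα' (π i)
    have aj := hα' (π j)
    have al := hα' l
    rcases pi with ⟨hi, ei⟩ | ⟨hi, hi', ei⟩ | ⟨hi, ei⟩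
    · have hj : (π j : ℕ) + 2 * y = j + x ∧ (j : ℕ) < y := by omega
      have hl : x ≤ (l : ℕ) + 2 * y ∧ l + y < x := by
        clear pj h1 h2 si sj lift
        omega
      clear ai aj al h h' pj
      exact lift (l + 2 * y - x) (by omega) (by omega) (by omega) (by omega)
    · have := l.2
      clear ai aj al h h' pj
      exact lift (l + y) (by omega) (by omega) (by omega) (by omega)
    · have hj : (π j : ℕ) + x = j ∧ 2 * n ≤ (j : ℕ) + y := by omega
      have hl : 2 * N + y ≤ (l : ℕ) + x ∧ l + x < 2 * N + 2 * y := by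
        have := j.2
        have := i.2
        clear pj h1 h2 si sj lift
        omega
      clear ai aj al h h' pj
      exact lift (l + x) (by omega) (by omega) (by omega) (by omega)
  have exists_rel : ∀ {l l' : Fin (2 * N)}, G.R l l' →
      ∃ i j : Fin (2 * n), ((i : ℕ) < y ↔ (j : ℕ) < y) ∧
      ((F.σ i : ℕ) < y ↔ (F.σ j : ℕ) < y) ∧ π i = l ∧ π j = l' := by
    intro l l' h
    have := l.2
    have := l'.2
    -- The middle part alone already maps bijectively onto the folded positions.
    let i : Fin (2 * n) := ⟨l + y, by omega⟩
    let j : Fin (2 * n) := ⟨l' + y, by omega⟩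
    have hi : (i : ℕ) = l + y := rfl
    have hj : (j : ℕ) = l' + y := rfl
    have := hFσ i
    have := hFσ j
    have := hπ i
    have := hπ j
    exact ⟨i, j, by omega, by omega, Fin.ext (by omega), Fin.ext (by omega)⟩
  have balance : ∀ {d b : Fin (2 * n)}, ¬ (d : ℕ) < y → (b : ℕ) < y → F.R d b → G.R (π b) (π d) →
      ((∃ k : Fin (2 * n), (((k : ℕ) < y ↔ (d : ℕ) < y) ∧
        ((F.σ k : ℕ) < y ↔ (F.σ d : ℕ) < y)) ∧ π k = π b) ↔
        ∃ k : Fin (2 * n), (k : ℕ) < y ∧ π k = π d) := by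
    intro d b hd hb hR h
    have hR := (hF _ _).1 hR
    have h := (hG _ _).1 h
    have := hα d
    have := hα b
    have := hα' (π b)
    have := hα' (π d)
    have := hπ b
    have pd := hπ d
    have := hFσ d
    let k : Fin (2 * n) := ⟨d - (x - y), by omega⟩
    have hk : (k : ℕ) = d - (x - y) := rfl
    have := hπ k
    let k' : Fin (2 * n) := ⟨b + (x - y), by omega⟩
    have hk' : (k' : ℕ) = b + (x - y) := rfl
    have := hπ k'
    have := hFσ k'
    exact iff_of_true ⟨k', ⟨by omega, by omega⟩, Fin.ext (by omega)⟩
      ⟨k, by omega, Fin.ext (by omega)⟩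
  refine ⟨row, full, iso, map_σ, map_ε, inj, rel_of_eq, matched, rel_of_map, exists_mid, exists_rel,
    balance, fun {i j} h1 h2 hR h => ?_⟩
  · have h1 : (i : ℕ) < y ↔ (j : ℕ) < y := h1
    have h2 : (F.σ i : ℕ) < y ↔ (F.σ j : ℕ) < y := h2
    by_cases hi : (i : ℕ) < y
    · obtain ⟨d, b, e1, e2, e3, e4, e5, e6, e7⟩ := kill i j hi (h1.1 hi) h
      exact ⟨d, b, e1, e2, e3, Or.inl ⟨e4, e5, Or.inl ⟨e6, e7⟩⟩⟩
    by_cases hi' : (F.σ i : ℕ) < y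
    · rw [← G.R_σ_iff, ← map_σ, ← map_σ] at h
      obtain ⟨d, b, e1, e2, e3, e4, e5, e6, e7⟩ := kill _ _ (h2.1 hi') hi' h
      exact ⟨d, b, e1, e2, e3, Or.inr ⟨e4, e5, Or.inl ⟨e6, e7⟩⟩⟩
    have si := hFσ i
    have sj := hFσ j
    have bi := hπβ i (by omega) (by omega)
    have bj := hπβ j (by omega) (by omega)
    have ai := hα i
    have aj := hα j
    have pi := hπ i
    have pj := hπ j
    have ai' := hα' (π i)
    have aj' := hα' (π j)
    have hR := (hF _ _).1 hR
    have h' := h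
    rw [hG] at h'
    by_cases cj : (j : ℕ) < x
    · have hjx : (i : ℕ) < x := by omega
      obtain ⟨d, b, e1, e2, e3, e4, e5, e6, e7⟩ :=
        kill' i j (by omega) hjx cj (by omega) (by omega)
      exact ⟨d, b, e1, e2, e3, Or.inl ⟨e4, e5, Or.inr ⟨e6, e7⟩⟩⟩
    by_cases ci : 2 * n ≤ (i : ℕ) + x
    · have cjx : 2 * n ≤ (j : ℕ) + x := by omega
      rw [← G.R_σ_iff, ← map_σ, ← map_σ, hG] at h
      have psi := hπ (F.σ i)
      have psj := hπ (F.σ j)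
      have bsi := hπβ (F.σ i) (by omega) (by omega)
      have bsj := hπβ (F.σ j) (by omega) (by omega)
      have hRσ := (hF _ _).1 (F.R_σ ((hF _ _).2 hR))
      obtain ⟨d, b, e1, e2, e3, e4, e5, e6, e7⟩ :=
        kill' (F.σ j) (F.σ i) (by omega) (by omega) (by omega) (by omega) (by omega)
      exact ⟨d, b, e1, e2, e3, Or.inr ⟨e4, e5, Or.inr ⟨e6, e7⟩⟩⟩
    by_cases c1 : x ≤ (i : ℕ)
    · have := hπα i c1 (by omega)
      by_cases c2 : (j : ℕ) + x < 2 * n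
      · have := hπα j (by omega) c2
        omega
      · omega
    · omega

end SignedPreorder

end Winding

/-! ### Invariance of the index under the contraction moves -/

section Contraction

theorem blockLevel_cons_cases {n c m : ℕ} {a : List ℕ} (ha : (c :: a).sum ≤ n) (hm : m + c = n)
    {i : ℕ} (hi : i < 2 * n) :
    (i < c ∧ blockLevel n (c :: a) i = 0) ∨
      (c ≤ i ∧ i + c < 2 * n ∧ blockLevel n (c :: a) i = blockLevel m a (i - c) + 1 ∧
        blockLevel m a (i - c) < (fullComposition m a).length) ∨
      (2 * n ≤ i + c ∧ blockLevel n (c :: a) i = (fullComposition m a).length + 1) := by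
  have ha' : a.sum ≤ m := by
    rw [List.sum_cons] at ha
    omega
  have hnc : n - c = m := by omega
  rw [blockLevel_cons ha hi, hnc]
  by_cases h1 : i < c
  · exact Or.inl ⟨h1, if_pos h1⟩
  · rw [if_neg h1]
    by_cases h2 : i < 2 * n - c
    · exact Or.inr (Or.inl ⟨by omega, by omega, if_pos h2, blockLevel_lt ha' (by omega)⟩)
    · exact Or.inr (Or.inr ⟨by omega, if_neg h2⟩)

theorem blockLevel_cons_cons_cases {n c d m : ℕ} {a : List ℕ} (ha : (d :: a).sum ≤ m + d)
    (hm : m + d + c = n) {i : ℕ} (hi : i < 2 * n) :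
    (i < c ∧ blockLevel n (c :: d :: a) i = 0) ∨
      (c ≤ i ∧ i < c + d ∧ blockLevel n (c :: d :: a) i = 1) ∨
      (c + d ≤ i ∧ i + (c + d) < 2 * n ∧
        blockLevel n (c :: d :: a) i = blockLevel m a (i - (c + d)) + 2 ∧
        blockLevel m a (i - (c + d)) < (fullComposition m a).length) ∨
      (2 * n ≤ i + (c + d) ∧ i + c < 2 * n ∧
        blockLevel n (c :: d :: a) i = (fullComposition m a).length + 2) ∨
      (2 * n ≤ i + c ∧ blockLevel n (c :: d :: a) i = (fullComposition m a).length + 3) := by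
  have hca : (c :: d :: a).sum ≤ n := by
    rw [List.sum_cons]
    omega
  have h1 := blockLevel_cons_cases hca hm hi
  have hl : (fullComposition (m + d) (d :: a)).length = (fullComposition m a).length + 2 := by
    rw [fullComposition_cons, Nat.add_sub_cancel]
    simp
  rw [hl] at h1
  by_cases h : c ≤ i ∧ i + c < 2 * n
  · have h2 := blockLevel_cons_cases ha rfl (i := i - c) (by omega)
    rw [Nat.sub_sub] at h2
    omega
  · omega

/-- A leading block of length zero does not matter. -/
theorem seaweedC_zero_cons {n : ℕ} {a : List ℕ} (b : List ℕ) (ha : a.sum ≤ n) :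
    seaweedC n (0 :: a) b = seaweedC n a b := by
  -- The empty block raises every level by one, and only comparisons of levels matter.
  have hlevel : ∀ i : Fin (2 * n), blockLevel n (0 :: a) i = blockLevel n a i + 1 := fun i => by
    rw [blockLevel_cons (by rwa [List.sum_cons, zero_add]) i.2, if_neg (Nat.not_lt_zero _),
      if_pos (by rw [Nat.sub_zero]; exact i.2), Nat.sub_zero, Nat.sub_zero]
  have h : ∀ i j, IsAdmissible n (0 :: a) b i j ↔ IsAdmissible n a b i j := fun i j => by
    rw [isAdmissible_iff_blockLevel, isAdmissible_iff_blockLevel, hlevel, hlevel,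
      Nat.add_le_add_iff_right]
  ext A
  exact and_congr Iff.rfl (forall₂_congr fun i j => by rw [h])

variable {n x y : ℕ} {xs ys : List ℕ}

theorem val_σ_add (a b : List ℕ) (ha : a.sum ≤ n) (hb : b.sum ≤ n) (i : Fin (2 * n)) :
    ((seaweedOrder n a b ha hb).σ i : ℕ) + i + 1 = 2 * n := by
  change ((Fin.rev i : Fin _) : ℕ) + i + 1 = 2 * n
  rw [Fin.val_rev]
  omega

/-- The index is invariant under rotation contraction. -/
theorem lieIndex_seaweedC_rotation (hyx : y < x) (hxy : x < 2 * y) (ha : (x :: xs).sum ≤ n)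
    (hb : (y :: ys).sum ≤ n) : lieIndex ℂ (seaweedC n (x :: xs) (y :: ys)) =
      lieIndex ℂ (seaweedC (n - (x - y)) (y :: xs) ((2 * y - x) :: ys)) := by
  have hx := ha
  have hy := hb
  rw [List.sum_cons] at hx hy
  obtain ⟨N, hN⟩ : ∃ N, N = n - (x - y) := ⟨_, rfl⟩
  have hNx : N + x = n + y := by omega
  have ha' : (y :: xs).sum ≤ N := by
    rw [List.sum_cons]
    omega
  have hb' : ((2 * y - x) :: ys).sum ≤ N := by
    rw [List.sum_cons]
    omega
  rw [← hN, lieIndex_seaweedC ha hb, lieIndex_seaweedC ha' hb']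
  -- The first `y` positions stay fixed and the rest moves down, so that `b` is glued to `b + (x -
  -- y)` whenever the latter is at least `y`.
  let π : Fin (2 * n) → Fin (2 * N) := fun i =>
    ⟨if (i : ℕ) < y then i else if (i : ℕ) + y < 2 * n then i - (x - y) else i - 2 * (x - y), by
      have := i.2
      split_ifs <;> omega⟩
  have hπ : ∀ i : Fin (2 * n), ((i : ℕ) < y ∧ (π i : ℕ) = i) ∨
      (y ≤ i ∧ i + y < 2 * n ∧ (π i : ℕ) + x = i + y) ∨
      (2 * n ≤ i + y ∧ (π i : ℕ) + 2 * x = i + 2 * y) := by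
    intro i
    have hi : (π i : ℕ) = if (i : ℕ) < y then (i : ℕ) else
      if (i : ℕ) + y < 2 * n then i - (x - y) else i - 2 * (x - y) := rfl
    split_ifs at hi <;> omega
  have mx : n - x + x = n := by omega
  have my : n - y + y = n := by omega
  have mx' : n - x + y = N := by omega
  have my' : n - y + (2 * y - x) = N := by omega
  have sα := fun i : Fin (2 * n) => blockLevel_cons_cases ha mx i.2
  have sβ := fun i : Fin (2 * n) => blockLevel_cons_cases hb my i.2
  have sα' := fun i : Fin (2 * N) => blockLevel_cons_cases ha' mx' i.2
  have sβ' := fun i : Fin (2 * N) => blockLevel_cons_cases hb' my' i.2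
  refine (SignedPreorder.Folding.of_rotation (π := π)
    (α := fun i => blockLevel n (x :: xs) i) (β := fun i => blockLevel n (y :: ys) i)
    (α' := fun i => blockLevel N (y :: xs) i) (β' := fun i => blockLevel N ((2 * y - x) :: ys) i)
    (A := (fullComposition (n - x) xs).length + 1)
    (C := (fullComposition (n - y) ys).length + 1)
    hyx hxy (by omega) hNx (Nat.succ_pos _) (Nat.succ_pos _) (val_σ_add _ _ ha hb)
    (val_σ_add _ _ ha' hb') (fun _ => rfl) (fun _ => rfl)
    (fun _ _ => isAdmissible_iff_blockLevel) (fun _ _ => isAdmissible_iff_blockLevel)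
    ?_ ?_ ?_ ?_ hπ ?_ ?_).lieIndex_eq
  · intro i
    have := sα i
    omega
  · intro i
    have := sβ i
    omega
  · intro i
    have := sα' i
    omega
  · intro i
    have := sβ' i
    omega
  · intro i
    have h1 := sα i
    have h2 := sα' (π i)
    have h3 := hπ i
    by_cases h : x ≤ (i : ℕ) ∧ (i : ℕ) + x < 2 * n
    · have e : (π i : ℕ) - y = i - x := by omega
      rw [e] at h2
      omega
    · omega
  · intro i hi hi'
    have h1 := sβ i
    have h2 := sβ' (π i)
    have h3 := hπ i
    have e : (π i : ℕ) - (2 * y - x) = i - y := by omega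
    rw [e] at h2
    omega

/-- The index is invariant under pure contraction, also when the first block is empty afterwards,
which amounts to block elimination. -/
theorem lieIndex_seaweedC_contraction (hxy : 2 * y ≤ x) (ha : (x :: xs).sum ≤ n)
    (hb : (y :: ys).sum ≤ n) : lieIndex ℂ (seaweedC n (x :: xs) (y :: ys)) =
      lieIndex ℂ (seaweedC (n - y) ((x - 2 * y) :: y :: xs) ys) := by
  have hx := ha
  have hy := hb
  rw [List.sum_cons] at hx hy
  obtain ⟨N, hN⟩ : ∃ N, N = n - y := ⟨_, rfl⟩
  have hNy : N + y = n := by omega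
  have ha'' : (y :: xs).sum ≤ n - x + y := by
    rw [List.sum_cons]
    omega
  have ha' : ((x - 2 * y) :: y :: xs).sum ≤ N := by
    rw [List.sum_cons, List.sum_cons]
    omega
  have hb' : ys.sum ≤ N := by omega
  rw [← hN, lieIndex_seaweedC ha hb, lieIndex_seaweedC ha' hb']
  -- The first `y` positions land on the new block of length `y` and the last `y` on its mirror
  -- image; again `b` is glued to `b + (x - y)`.
  let π : Fin (2 * n) → Fin (2 * N) := fun i =>
    ⟨if (i : ℕ) < y then i + x - 2 * y else if (i : ℕ) + y < 2 * n then i - y else i - x, by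
      have := i.2
      split_ifs <;> omega⟩
  have hπ : ∀ i : Fin (2 * n), ((i : ℕ) < y ∧ (π i : ℕ) + 2 * y = i + x) ∨
      (y ≤ i ∧ i + y < 2 * n ∧ (π i : ℕ) + y = i) ∨ (2 * n ≤ i + y ∧ (π i : ℕ) + x = i) := by
    intro i
    have hi : (π i : ℕ) = if (i : ℕ) < y then (i : ℕ) + x - 2 * y else
      if (i : ℕ) + y < 2 * n then i - y else i - x := rfl
    split_ifs at hi <;> omega
  have mx : n - x + x = n := by omega
  have mx' : n - x + y + (x - 2 * y) = N := by omega
  have sα := fun i : Fin (2 * n) => blockLevel_cons_cases ha mx i.2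
  have sβ := fun i : Fin (2 * n) => blockLevel_cons_cases hb hNy i.2
  have sα' := fun i : Fin (2 * N) => blockLevel_cons_cons_cases ha'' mx' i.2
  refine (SignedPreorder.Folding.of_contraction (π := π)
    (α := fun i => blockLevel n (x :: xs) i) (β := fun i => blockLevel n (y :: ys) i)
    (α' := fun i => blockLevel N ((x - 2 * y) :: y :: xs) i) (β' := fun i => blockLevel N ys i)
    (A := (fullComposition (n - x) xs).length + 1)
    (C := (fullComposition N ys).length + 1)
    hxy (by omega) hNy (Nat.succ_pos _) (Nat.succ_pos _) (val_σ_add _ _ ha hb)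
    (val_σ_add _ _ ha' hb') (fun _ => rfl) (fun _ => rfl)
    (fun _ _ => isAdmissible_iff_blockLevel) (fun _ _ => isAdmissible_iff_blockLevel)
    ?_ ?_ (fun i j hij => blockLevel_mono _ _ (Fin.le_def.1 hij)) ?_ hπ ?_ ?_).lieIndex_eq
  · intro i
    have := sα i
    omega
  · intro i
    have := sβ i
    omega
  · intro i
    have := sα' i
    omega
  · intro i hi hi'
    have h1 := sα i
    have h2 := sα' (π i)
    have h3 := hπ i
    have e : (π i : ℕ) - (x - 2 * y + y) = i - x := by omega
    rw [e] at h2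
    omega
  · intro i hi hi'
    have h1 := sβ i
    have h3 := hπ i
    have e : (π i : ℕ) = i - y := by omega
    rw [e]
    omega

end Contraction

/-! ### The index formula and its solutions of value one -/

section Classification

namespace HomotopyType

/-- The index that a homotopy type prescribes. -/
def index (H : HomotopyType) : ℕ :=
  H.nontail.sum + (H.tail.map (· / 2)).sum + H.aftertail / 2

end HomotopyType

/-- Peeling off the tail blocks one at a time, each contributing half its size rounded down, leaves
a symplectic algebra of rank `n - a.sum`. -/
theorem lieIndex_seaweedC_tails {n : ℕ} {a : List ℕ} (ha : a.sum ≤ n) :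
    lieIndex ℂ (seaweedC n a []) = (a.map (· / 2)).sum + (n - a.sum) := by
  induction a generalizing n with
  | nil => simpa using lieIndex_seaweedC_nil n
  | cons c a ih =>
    rw [lieIndex_seaweedC_tail ha, ih (by rw [List.sum_cons] at ha; omega), List.map_cons,
      List.sum_cons, List.sum_cons]
    omega

/-- The homotopy type determines the index; its components are positive and its aftertail is
even. -/
theorem lieIndex_seaweedC_eq_index (n : ℕ) (a b : List ℕ) (ha : ∀ x ∈ a, 0 < x)
    (hb : ∀ x ∈ b, 0 < x) (han : a.sum ≤ n) (hbn : b.sum ≤ n) :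
    lieIndex ℂ (seaweedC n a b) = (homotopyTypeC n a b).index ∧
      (∀ c ∈ (homotopyTypeC n a b).nontail, 0 < c) ∧
      (∀ d ∈ (homotopyTypeC n a b).tail, 0 < d) ∧ 2 ∣ (homotopyTypeC n a b).aftertail := by
  induction n, a, b using homotopyTypeC.induct with
  | case1 n b =>
    rw [homotopyTypeC]
    refine ⟨?_, by simp, hb, dvd_mul_right _ _⟩
    rw [lieIndex_seaweedC_comm han hbn, lieIndex_seaweedC_tails hbn]
    simp [HomotopyType.index]
  | case2 n x xs =>
    rw [homotopyTypeC]
    refine ⟨?_, by simp, ha, dvd_mul_right _ _⟩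
    rw [lieIndex_seaweedC_tails han]
    simp [HomotopyType.index]
  | case3 n x xs y ys h ih =>
    rw [homotopyTypeC, if_pos h, lieIndex_seaweedC_comm han hbn]
    exact ih hb ha hbn han
  | case4 n xs y ys h ih =>
    rw [homotopyTypeC, if_neg h, if_pos rfl, lieIndex_seaweedC_deletion han hbn]
    rw [List.sum_cons] at han hbn
    obtain ⟨h1, h2, h3, h4⟩ := ih (fun z hz => ha z (List.mem_cons_of_mem _ hz))
      (fun z hz => hb z (List.mem_cons_of_mem _ hz)) (by omega) (by omega)
    refine ⟨?_, ?_, h3, h4⟩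
    · rw [h1]
      simp [HomotopyType.index, add_assoc]
    · exact List.forall_mem_cons.2 ⟨ha y List.mem_cons_self, h2⟩
  | case5 n x xs y ys h1 h2 h3 ih =>
    rw [homotopyTypeC, if_neg h1, if_neg h2, if_pos h3,
      lieIndex_seaweedC_rotation (by omega) h3 han hbn]
    rw [List.forall_mem_cons] at ha hb
    rw [List.sum_cons] at han hbn
    refine ih (List.forall_mem_cons.2 ⟨hb.1, ha.2⟩) (List.forall_mem_cons.2 ⟨by omega, hb.2⟩) ?_ ?_
    · rw [List.sum_cons]
      omega
    · rw [List.sum_cons]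
      omega
  | case6 n xs y ys h1 h2 h3 ih =>
    have hs : (y :: xs).sum ≤ n - y := by
      rw [List.sum_cons] at han ⊢
      omega
    -- Block elimination is the pure contraction whose first block `2y - 2y` is empty and can be
    -- dropped.
    rw [homotopyTypeC, if_neg h1, if_neg h2, if_neg h3, if_pos rfl,
      lieIndex_seaweedC_contraction le_rfl han hbn, Nat.sub_self, seaweedC_zero_cons _ hs]
    rw [List.forall_mem_cons] at ha hb
    rw [List.sum_cons] at hbn
    exact ih (List.forall_mem_cons.2 ⟨hb.1, ha.2⟩) hb.2 hs (by omega)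
  -- The branch `y = 0` cannot occur, since all blocks are positive.
  | case7 => exact (lt_irrefl 0 (hb 0 List.mem_cons_self)).elim
  | case8 n x xs y ys h1 h2 h3 h4 h5 ih =>
    rw [homotopyTypeC, if_neg h1, if_neg h2, if_neg h3, if_neg h4, if_neg h5,
      lieIndex_seaweedC_contraction (by omega) han hbn]
    rw [List.forall_mem_cons] at ha hb
    rw [List.sum_cons] at han hbn
    refine ih (List.forall_mem_cons.2 ⟨by omega, List.forall_mem_cons.2 ⟨hb.1, ha.2⟩⟩) hb.2 ?_ ?_
    · rw [List.sum_cons, List.sum_cons]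
      omega
    · omega

theorem List.sum_map_half_eq_zero {l : List ℕ} (hl : ∀ x ∈ l, 0 < x)
    (h : (l.map (· / 2)).sum = 0) : l = List.replicate l.length 1 := by
  refine List.eq_replicate_iff.2 ⟨rfl, fun x hx => ?_⟩
  have := hl x hx
  have := List.sum_eq_zero_iff.1 h (x / 2) (List.mem_map_of_mem hx)
  omega

theorem List.sum_map_half_eq_one {l : List ℕ} (hl : ∀ x ∈ l, 0 < x)
    (h : (l.map (· / 2)).sum = 1) : ∃ p q, l = List.replicate p 1 ++ [2] ++ List.replicate q 1 ∨
      l = List.replicate p 1 ++ [3] ++ List.replicate q 1 := by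
  induction l with
  | nil => simp at h
  | cons x l ih =>
    rw [List.forall_mem_cons] at hl
    rw [List.map_cons, List.sum_cons] at h
    by_cases hx : x = 1
    · obtain ⟨p, q, hpq⟩ := ih hl.2 (by omega)
      refine ⟨p + 1, q, ?_⟩
      rcases hpq with hpq | hpq <;> simp [hx, hpq, List.replicate_succ]
    · have e := List.sum_map_half_eq_zero hl.2 (by omega)
      refine ⟨0, l.length, ?_⟩
      have : x = 2 ∨ x = 3 := by omega
      rcases this with rfl | rfl
      · exact Or.inl (congrArg _ e)
      · exact Or.inr (congrArg _ e)

/-- A sum of natural numbers is 1 when exactly one term is 1 and the others vanish. Positivity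
excludes further non-tail components and tail components of size 0; evenness of the aftertail
excludes the values 1 and 3, which rounding would let through. -/
theorem HomotopyType.index_eq_one_iff {H : HomotopyType} (hc : ∀ c ∈ H.nontail, 0 < c)
    (hd : ∀ d ∈ H.tail, 0 < d) (he : 2 ∣ H.aftertail) : H.index = 1 ↔
      (∃ p q : ℕ, H = ⟨[], List.replicate p 1 ++ [2] ++ List.replicate q 1, 0⟩) ∨
      (∃ p q : ℕ, H = ⟨[], List.replicate p 1 ++ [3] ++ List.replicate q 1, 0⟩) ∨
      (∃ p : ℕ, H = ⟨[], List.replicate p 1, 2⟩) ∨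
      (∃ p : ℕ, H = ⟨[1], List.replicate p 1, 0⟩) := by
  constructor
  · obtain ⟨c, d, e⟩ := H
    dsimp only at hc hd he
    intro h
    change c.sum + (d.map (· / 2)).sum + e / 2 = 1 at h
    cases c with
    | nil =>
      rw [List.sum_nil] at h
      by_cases h' : (d.map (· / 2)).sum = 0
      · have e2 : e = 2 := by omega
        exact Or.inr (Or.inr (Or.inl ⟨d.length, by
          rw [e2, ← List.sum_map_half_eq_zero hd h']⟩))
      · have e0 : e = 0 := by omega
        subst e0
        obtain ⟨p, q, rfl | rfl⟩ := List.sum_map_half_eq_one hd (by omega)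
        · exact Or.inl ⟨p, q, rfl⟩
        · exact Or.inr (Or.inl ⟨p, q, rfl⟩)
    | cons x c =>
      rw [List.forall_mem_cons] at hc
      rw [List.sum_cons] at h
      have e0 : e = 0 := by omega
      have x1 : x = 1 := by omega
      have hc0 : c = [] := List.eq_nil_iff_forall_not_mem.2 fun z hz => by
        have := hc.2 z hz
        have := List.le_sum_of_mem hz
        omega
      exact Or.inr (Or.inr (Or.inr ⟨d.length, by
        rw [e0, x1, hc0, ← List.sum_map_half_eq_zero hd (by omega)]⟩))
  · rintro (⟨p, q, rfl⟩ | ⟨p, q, rfl⟩ | ⟨p, rfl⟩ | ⟨p, rfl⟩) <;> simp [HomotopyType.index]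

end Classification

theorem corollary2p6 (n : ℕ) (a b : List ℕ)
    (ha : ∀ x ∈ a, 0 < x) (hb : ∀ x ∈ b, 0 < x)
    (han : a.sum ≤ n) (hbn : b.sum ≤ n) :
    lieIndex ℂ (seaweedC n a b) = 1 ↔
      (∃ p q : ℕ, homotopyTypeC n a b =
        ⟨[], List.replicate p 1 ++ [2] ++ List.replicate q 1, 0⟩) ∨
      (∃ p q : ℕ, homotopyTypeC n a b =
        ⟨[], List.replicate p 1 ++ [3] ++ List.replicate q 1, 0⟩) ∨
      (∃ p : ℕ, homotopyTypeC n a b = ⟨[], List.replicate p 1, 2⟩) ∨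
      (∃ p : ℕ, homotopyTypeC n a b = ⟨[1], List.replicate p 1, 0⟩) := by
  obtain ⟨h, hc, hd, he⟩ := lieIndex_seaweedC_eq_index n a b ha hb han hbn
  rw [h]
  exact HomotopyType.index_eq_one_iff hc hd he
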